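/- Let $(M,g)$ be a compact $C^\infty$ Riemannian manifold without boundary, of dimension $n$. Let $\Gamma^k$ be the space of $C^k$ vector fields on $M$. Fix a finite covering of $M$ by smooth charts $h_i:U_i\to\mathbb R^n$ and a smooth partition of unity $(\phi_i)$ subordinate to $(U_i)$, and for $v\in\Gamma^R$ put $$\|v\|_{C^R}:=\max_{0\le l\le R}\ \sum_i \sup_{\mathbb R^n}\big|D^l\big((h_i)_*(\phi_i v)\big)\big| ,$$ where $(h_i)_*(\phi_iv)$ is extended by $0$ outside $h_i(U_i)$. For $m\in M$ and $\xi\in T_mM$ let $\mathrm{Exp}_m\{\xi\}=\gamma(1)$, where $\gamma$ is the geodesic of $g$ with $\gamma(0)=m$, $\gamma'(0)=\xi$; for a vector field $v$ let $\mathrm{Exp}\{v\}:M\to M$, $m\mapsto \mathrm{Exp}_m\{v(m)\}$. Let $s_1(w,v)$ be the vector field such that, for every $m\in M$, $w(m)+v(m)+s_1(w,v)(m)$ is the vector of least length in $T_mM$ that $\mathrm{Exp}_m$ maps to $\mathrm{Exp}\{w\}(\mathrm{Exp}\{v\}(m))$. Then there are $\delta,\rho>0$, depending only on $(M,g)$ and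 the chosen charts and partition of unity, such that the following hold. 1. For all $w,v\in\Gamma^0$ with $\|w\|_{C^0},\|v\|_{C^0}<\delta$, the field $s_1(w,v)$ is well defined and belongs to $\Gamma^0$, and it is the only $s\in\Gamma^0$ with $\|s\|_{C^0}<\rho$ and $$\mathrm{Exp}\{w\}\circ\mathrm{Exp}\{v\}=\mathrm{Exp}\{w+v+s\}.$$ 2. There is a constant $C>0$ such that for all $w_1,w_2\in\Gamma^1$ and $v\in\Gamma^0$ with $\|w_1\|_{C^1},\|w_2\|_{C^0},\|v\|_{C^0}<\delta$ we have $s_1(w_1+w_2,v)\in\Gamma^0$ and $$\|s_1(w_1+w_2,v)\|_{C^0}\le C\big(\|w_1\|_{C^1}\|v\|_{C^0}+\|w_2\|_{C^0}\big).$$ 3. For every integer $R\ge1$ there is a constant $C_R>0$ such that for all $w,v\in\Gamma^R$ with $\|w\|_{C^1},\|v\|_{C^1}<\delta$ we have $s_1(w,v)\in\Gamma^R$ and $$\|s_1(w,v)\|_{C^R}\le C_R\big(\|w\|_{C^R}+\|w\|_{C^1}\|v\|_{C^R}\big),$$ and, if moreover $w\in\Gamma^{R+1}$, $$\|s_1(w,v)\|_{C^R}\le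 C_R\big(\|w\|_{C^2}\|v\|_{C^R}+\|w\|_{C^{R+1}}\|v\|_{C^0}\big).$$ -/

import Mathlib

open scoped Manifold ContDiff Topology
open Bundle Set

/-- Vector fields on `M` (no regularity): sections of the tangent bundle `TM`. -/
abbrev VField (n : ℕ) (M : Type*) [TopologicalSpace M]
    [ChartedSpace (EuclideanSpace ℝ (Fin n)) M] : Type _ :=
  (m : M) → TangentSpace (𝓡 n) m

/-- Smooth Riemannian metrics on `M`. -/
abbrev SmoothMetric (n : ℕ) (M : Type*) [TopologicalSpace M]
    [ChartedSpace (EuclideanSpace ℝ (Fin n)) M] [IsManifold (𝓡 n) ∞ M] : Type _ :=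
  ContMDiffRiemannianMetric (𝓡 n) ∞ (EuclideanSpace ℝ (Fin n))
    (fun m : M => TangentSpace (𝓡 n) m)

noncomputable section

section VectorFields

variable {n : ℕ} {M : Type*} [TopologicalSpace M] [ChartedSpace (EuclideanSpace ℝ (Fin n)) M]

/-- `v ∈ Γ^k(M, TM)`: `v` is a section of class `C^k` of the tangent bundle. -/
def IsGamma [IsManifold (𝓡 n) ∞ M] (k : ℕ) (v : VField n M) : Prop :=
  ContMDiff (𝓡 n) ((𝓡 n).prod 𝓘(ℝ, EuclideanSpace ℝ (Fin n))) (k : WithTop ℕ∞)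
    (fun m => (⟨m, v m⟩ : TangentBundle (𝓡 n) M))

open Classical in
/-- The push-forward `h_* v` of a vector field by a chart `h`, as a function on `ℝⁿ` with values
in `ℝⁿ`, extended by `0` outside the image of the chart. -/
def pushChart (h : OpenPartialHomeomorph M (EuclideanSpace ℝ (Fin n))) (v : VField n M)
    (x : EuclideanSpace ℝ (Fin n)) : EuclideanSpace ℝ (Fin n) :=
  if x ∈ h.target then
    mfderiv (𝓡 n) 𝓘(ℝ, EuclideanSpace ℝ (Fin n)) h (h.symm x) (v (h.symm x))
  else 0

variable {ι : Type*} [Fintype ι]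

/-- `|v|_l = ∑ᵢ sup_{x ∈ ℝⁿ} ‖D^l ((hᵢ)_* (φᵢ v)) (x)‖`. -/
def seminormC (h : ι → OpenPartialHomeomorph M (EuclideanSpace ℝ (Fin n)))
    (φ : SmoothPartitionOfUnity ι (𝓡 n) M univ) (l : ℕ) (v : VField n M) : ℝ :=
  ∑ i, ⨆ x : EuclideanSpace ℝ (Fin n),
    ‖iteratedFDeriv ℝ l (pushChart (h i) (fun m => φ i m • v m)) x‖

/-- `‖v‖_{C^R} = max_{0 ≤ l ≤ R} |v|_l`. -/
def normC (h : ι → OpenPartialHomeomorph M (EuclideanSpace ℝ (Fin n)))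
    (φ : SmoothPartitionOfUnity ι (𝓡 n) M univ) (R : ℕ) (v : VField n M) : ℝ :=
  (Finset.range (R + 1)).sup' Finset.nonempty_range_add_one (fun l => seminormC h φ l v)

end VectorFields

section Geodesics

variable {n : ℕ} {M : Type*} [TopologicalSpace M] [ChartedSpace (EuclideanSpace ℝ (Fin n)) M]
  [IsManifold (𝓡 n) ∞ M]

/-- The matrix `(g_{ij}(x))` of the metric in the chart `e`, at `x ∈ e.target`. -/
def metricMatrix (g : SmoothMetric n M)
    (e : OpenPartialHomeomorph M (EuclideanSpace ℝ (Fin n))) (x : EuclideanSpace ℝ (Fin n)) :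
    Matrix (Fin n) (Fin n) ℝ :=
  Matrix.of fun i j =>
    g.inner (e.symm x)
      (mfderiv 𝓘(ℝ, EuclideanSpace ℝ (Fin n)) (𝓡 n) e.symm x
        (EuclideanSpace.single i (1 : ℝ) : EuclideanSpace ℝ (Fin n)))
      (mfderiv 𝓘(ℝ, EuclideanSpace ℝ (Fin n)) (𝓡 n) e.symm x
        (EuclideanSpace.single j (1 : ℝ) : EuclideanSpace ℝ (Fin n)))

/-- `∂_l g_{ij}(x)` in the chart `e`. -/
def dMetric (g : SmoothMetric n M)
    (e : OpenPartialHomeomorph M (EuclideanSpace ℝ (Fin n))) (x : EuclideanSpace ℝ (Fin n))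
    (l i j : Fin n) : ℝ :=
  fderiv ℝ (fun y => metricMatrix g e y i j) x (EuclideanSpace.single l (1 : ℝ))

/-- The Christoffel symbol
`Γ^k_{ij} = ½ ∑_l g^{kl} (∂_i g_{jl} + ∂_j g_{il} - ∂_l g_{ij})` of the Levi-Civita (Riemannian)
connection in the chart `e`. -/
def christoffel (g : SmoothMetric n M)
    (e : OpenPartialHomeomorph M (EuclideanSpace ℝ (Fin n))) (x : EuclideanSpace ℝ (Fin n))
    (k i j : Fin n) : ℝ :=
  (1 / 2 : ℝ) * ∑ l, (metricMatrix g e x)⁻¹ k l *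
    (dMetric g e x i j l + dMetric g e x j i l - dMetric g e x l i j)

/-- `γ` is a geodesic of `g` on the open set `s ⊆ ℝ`: it is of class `C²` there, and in every
smooth chart it satisfies `γ̈^k + ∑_{i,j} Γ^k_{ij}(γ) γ̇^i γ̇^j = 0`. -/
def IsGeodesicOn (g : SmoothMetric n M) (γ : ℝ → M) (s : Set ℝ) : Prop :=
  ContMDiffOn 𝓘(ℝ, ℝ) (𝓡 n) 2 γ s ∧
  ∀ t ∈ s, ∀ e ∈ IsManifold.maximalAtlas (𝓡 n) ∞ M, γ t ∈ e.source →
    ∀ k : Fin n,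
      (deriv (deriv (fun τ => e (γ τ))) t) k
        + ∑ i, ∑ j, christoffel g e (e (γ t)) k i j *
            (deriv (fun τ => e (γ τ)) t) i * (deriv (fun τ => e (γ τ)) t) j = 0

/-- `γ` is a geodesic, defined on an open interval containing `[0, 1]`, with `γ(0) = m` and
`γ'(0) = ξ`. -/
def IsGeodesicFrom (g : SmoothMetric n M) (m : M) (ξ : TangentSpace (𝓡 n) m) (γ : ℝ → M) :
    Prop :=
  (∃ ε > 0, IsGeodesicOn g γ (Ioo (-ε) (1 + ε))) ∧
  (⟨γ 0, mfderiv 𝓘(ℝ, ℝ) (𝓡 n) γ 0 (1 : ℝ)⟩ : TangentBundle (𝓡 n) M) = ⟨m, ξ⟩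

open Classical in
/-- The Riemannian exponential map: `Exp_m{ξ} = γ(1)` for the geodesic `γ` with `γ(0) = m`,
`γ'(0) = ξ`, i.e. the point on the geodesic from `m` in the direction `ξ` at distance `|ξ|`. (On a
compact manifold that geodesic always exists; the value `m` otherwise is a convention.) -/
def rexp (g : SmoothMetric n M) (m : M) (ξ : TangentSpace (𝓡 n) m) : M :=
  if H : ∃ γ : ℝ → M, IsGeodesicFrom g m ξ γ then H.choose 1 else m

/-- `Exp{v} : M → M`, `m ↦ Exp_m{v(m)}`. -/
def Exp (g : SmoothMetric n M) (v : VField n M) : M → M :=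
  fun m => rexp g m (v m)

open Classical in
/-- The Riemannian logarithm: the vector `ξ ∈ T_m M` of least length with `Exp_m{ξ} = y`. It is
unique for `y` within the injectivity radius of `m`, where it inverts `Exp_m` on a small ball. -/
def rlog (g : SmoothMetric n M) (m y : M) : TangentSpace (𝓡 n) m :=
  if H : ∃ ξ : TangentSpace (𝓡 n) m, rexp g m ξ = y ∧
      ∀ η : TangentSpace (𝓡 n) m, rexp g m η = y → g.inner m ξ ξ ≤ g.inner m η η
  then H.choose else 0

/-- The vector field `s₁(w, v)` defined by `Exp{w} ∘ Exp{v} = Exp{w + v + s₁(w, v)}`, where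
`w + v + s₁(w, v)` is the small solution. -/
def s₁ (g : SmoothMetric n M) (w v : VField n M) : VField n M :=
  fun m => rlog g m (Exp g w (Exp g v m)) - w m - v m

end Geodesics

end

/-!
# The composition law of small vector fields under the exponential map

In a chart `e`, the exponential map is a smooth map `X (x, v)` with `X (x, 0) = x` and
`∂X/∂v (x, 0) = 1`. Hence `(x, v) ↦ (x, X (x, v))` is invertible near the diagonal, and there is a
smooth `G` such that `G ((x, v), b) + v` is the small vector at `x` with the same exponential as the
vector `b` at `X (x, v)`. If `V` and `W` stand for `v` and `w` in the chart, then `s₁ w v`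
becomes

  `x ↦ G ((x, V x), W (X (x, V x))) - W x`,

and the identities `G ((x, v), 0) = 0`, `G ((x, 0), b) = b` are responsible for the shape of the
estimates. (`IsLocalModel` records what is needed of `X` and `G`, `IsExpModel` their relation to the
metric, and `exists_isExpModel` their existence.)

*The exponential map in a chart.* The geodesic equation is written in Euler–Lagrange form. In this
form it is visibly the same equation in all charts (`geodesicAccel_chartChange`), which is needed
since geodesics are defined by means of all charts. After a cut-off, its solutions near a constant
one exist on `[-1, 2]` and depend smoothly on the initial value, by the inverse function theorem in
the Banach space of continuous functions (`exists_flow`). Geodesics are determined by their initial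
velocity (`IsGeodesicFrom.apply_one_eq`), so that these solutions compute `rexp`
(`exists_rexp_chart`). On small vectors the exponential map is injective, and the metric is
comparable to the Euclidean one of the chart; so a vector of least length with a given exponential
is again small, and the logarithm `rlog` is the local inverse.

*The tame estimates.* The norms `normC h φ k v` are log-convex in `k` up to the factor `3`, by
Landau's inequality for the push-forwards on `ℝⁿ` (`sq_normC_le`). A log-convex sequence lies below
the geometric progression through its end terms, so one may assume bounds
`‖D^k W‖ ≤ A l ^ (k - 1)` with a common slope `l`. Bounds of this type (`GrowthAt`) are stable under
products and compositions: the chain rule for `g ∘ f` is applied after rescaling by `l`. Thus every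
estimate reduces to the extreme terms, and the slope `l` is chosen in the end
(`le_of_geometric_majorants`, `le_of_geometric_majorants'`).

The first `C^R` estimate follows from `G ((x, v), 0) = 0`, which makes `G ((x, V), W ∘ X)` of the
size of `W` (`IsLocalModel.exists_growthAt`). For the second one, the field is written as the
integral over `t ∈ [0, 1]` of the derivative of `G ((x, t V), W (X (x, t V)))`; that derivative is
linear in `V`, with a coefficient of the size of `W` and `DW`
(`IsLocalModel.exists_norm_iteratedFDeriv_le`). The `C⁰` estimate uses the mean value theorem in the
same way. Finally, the bounds in single charts are glued with the partition of unity and compactness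
(`exists_normC_le`).
-/

set_option linter.unusedSectionVars false

set_option maxSynthPendingDepth 3

/-! ### Log-convex sequences -/

/-- A sequence which is log-convex on `[0, m]` up to the factor `K` lies, up to a constant, below
the geometric progression through bounds for its two end terms. -/
lemma logConvex_le_geometric {K : ℝ} (hK : 1 ≤ K) {m : ℕ} {a : ℕ → ℝ} (ha : ∀ k, 0 ≤ a k)
    (hconv : ∀ k, k + 1 < m → a (k + 1) ^ 2 ≤ K ^ 2 * (a k * a (k + 2))) {A l : ℝ}
    (hl : 0 < l) (h0 : a 0 ≤ A) (hm : a m ≤ A * l ^ m) {k : ℕ} (hk : k ≤ m) :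
    a k ≤ K ^ (m ^ 2) * A * l ^ k := by
  have hA : 0 ≤ A := (ha 0).trans h0
  have hK0 : 0 < K := by linarith
  -- the weights `K ^ k²` turn the sequence into an exactly log-convex one
  set b : ℕ → ℝ := fun k => K ^ (k ^ 2) * a k / l ^ k with hb
  have hb0 : ∀ k, 0 ≤ b k := fun k => by have := ha k; positivity
  have hbconv : ∀ k, k + 1 < m → b (k + 1) ^ 2 ≤ b k * b (k + 2) := by
    intro k hk
    have h1 := hconv k hk
    have e1 : b (k + 1) ^ 2 = K ^ (2 * (k + 1) ^ 2) / l ^ (2 * (k + 1)) * a (k + 1) ^ 2 := by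
      simp only [hb]; field_simp; ring
    have e2 : b k * b (k + 2)
        = K ^ (2 * (k + 1) ^ 2) / l ^ (2 * (k + 1)) * (K ^ 2 * (a k * a (k + 2))) := by
      simp only [hb]; field_simp; ring
    rw [e1, e2]
    gcongr
  -- maximum principle
  have hmax : ∀ j ≤ m, b j ≤ max (b 0) (b m) := by
    obtain ⟨i, hi, hmi⟩ := Finset.exists_max_image (Finset.range (m + 1)) b ⟨0, by simp⟩
    have hne : ((Finset.range (m + 1)).filter fun j => b j = b i).Nonempty :=
      ⟨i, by simp [Finset.mem_range.1 hi]⟩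
    obtain ⟨i', hi', hmin⟩ := Finset.exists_min_image _ id hne
    simp only [Finset.mem_filter, Finset.mem_range] at hi' hmin hmi
    intro j hj
    refine (hmi j (by omega)).trans ?_
    rw [← hi'.2]
    rcases Nat.eq_zero_or_pos i' with h | h
    · rw [h]; exact le_max_left _ _
    rcases eq_or_lt_of_le (Nat.lt_succ_iff.1 hi'.1) with h' | h'
    · rw [h']; exact le_max_right _ _
    obtain ⟨p, rfl⟩ : ∃ p, i' = p + 1 := ⟨i' - 1, by omega⟩
    have h1 := hbconv p h'
    have h2 : b (p + 2) ≤ b (p + 1) := by rw [hi'.2]; exact hmi _ (by omega)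
    have h3 : b p ≤ b (p + 1) := by rw [hi'.2]; exact hmi _ (by omega)
    rcases (hb0 (p + 1)).eq_or_lt with h4 | h4
    · rw [← h4]; exact (hb0 0).trans (le_max_left _ _)
    have h5 : b p = b (p + 1) := by
      refine le_antisymm h3 ?_
      have : b (p + 1) * b (p + 1) ≤ b p * b (p + 1) := by
        nlinarith [mul_le_mul_of_nonneg_left h2 (hb0 p)]
      exact le_of_mul_le_mul_right this h4
    have := hmin p ⟨by omega, by rw [h5, hi'.2]⟩
    simp at this
  have hone : ∀ j, 1 ≤ K ^ j := fun j => one_le_pow₀ hK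
  have hbd : max (b 0) (b m) ≤ K ^ (m ^ 2) * A := by
    refine max_le ?_ ?_
    · simp only [hb]; simp
      nlinarith [hone (m ^ 2)]
    · simp only [hb]
      rw [div_le_iff₀ (by positivity)]
      calc K ^ (m ^ 2) * a m ≤ K ^ (m ^ 2) * (A * l ^ m) := by gcongr
        _ = _ := by ring
  have := (hmax k hk).trans hbd
  simp only [hb] at this
  rw [div_le_iff₀ (by positivity)] at this
  refine le_trans ?_ this
  nlinarith [hone (k ^ 2), ha k]

/-- Log-convexity survives truncation from below; this serves to make the sequences positive. -/
lemma sq_max_le_of_logConvex {K e a b c : ℝ} (hK : 1 ≤ K) (he : 0 ≤ e)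
    (ha : 0 ≤ a) (hb : 0 ≤ b) (hc : 0 ≤ c)
    (h : b ^ 2 ≤ K ^ 2 * (a * c)) : max e b ^ 2 ≤ K ^ 2 * (max e a * max e c) := by
  have hK2 : 1 ≤ K ^ 2 := one_le_pow₀ hK
  rcases max_choice e b with h' | h' <;> rw [h']
  · have : e * e ≤ max e a * max e c := by gcongr <;> exact le_max_left _ _
    nlinarith
  · refine h.trans ?_
    gcongr <;> exact le_max_right _ _

lemma exists_one_le_pow_eq (m : ℕ) {T : ℝ} (hT : 1 ≤ T) (h0 : m = 0 → T = 1) :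
    ∃ l : ℝ, 1 ≤ l ∧ l ^ m = T := by
  rcases eq_or_ne m 0 with rfl | hm
  · exact ⟨1, le_rfl, by simp [h0 rfl]⟩
  · refine ⟨T ^ ((m : ℝ)⁻¹), Real.one_le_rpow hT (by positivity), ?_⟩
    exact Real.rpow_inv_natCast_pow (by linarith) hm

/-- A bound in terms of geometric majorants of two log-convex sequences, for all possible
majorants, gives a bound by the top terms. The form of the first `C^R` estimate. -/
lemma le_of_geometric_majorants {K : ℝ} (hK : 1 ≤ K) (R : ℕ) (hR : 1 ≤ R) {c : ℝ} (hc : 0 ≤ c)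
    {w v : ℕ → ℝ} (hw : ∀ k, 0 ≤ w k) (hv : ∀ k, 0 ≤ v k)
    (hwmono : Monotone w)
    (hwc : ∀ k, k + 1 < R → w (k + 1) ^ 2 ≤ K ^ 2 * (w k * w (k + 2)))
    (hvc : ∀ k, k + 1 < R → v (k + 1) ^ 2 ≤ K ^ 2 * (v k * v (k + 2)))
    (hv1 : v 1 ≤ 1) {X : ℝ}
    (hX : ∀ A l : ℝ, 0 < A → 1 ≤ l →
      (∀ k, k < R → w (k + 1) ≤ K ^ (R ^ 2) * A * l ^ k) →
      (∀ k, k < R → v (k + 1) ≤ K ^ (R ^ 2) * l ^ k) → A ≤ max 1 (w 1) →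
      X ≤ c * (A * l ^ (R - 1))) :
    X ≤ 2 * c * (w R + w 1 * v R) := by
  obtain ⟨m, rfl⟩ : ∃ m, R = m + 1 := ⟨R - 1, by omega⟩
  have hKm : K ^ (m ^ 2) ≤ K ^ ((m + 1) ^ 2) := pow_le_pow_right₀ hK (by gcongr; omega)
  have key : ∀ e : ℝ, 0 < e → e ≤ 1 →
      X ≤ c * (max e (w (m + 1)) + max e (w 1) * max 1 (v (m + 1))) := by
    intro e he he1
    -- the truncation by `e` makes `A` positive
    set A := max e (w 1) with hA
    have hA0 : 0 < A := lt_max_of_lt_left he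
    have hAle : A ≤ max e (w (m + 1)) := max_le_max le_rfl (hwmono (by omega))
    have hq : 1 ≤ max e (w (m + 1)) / A := by rwa [one_le_div hA0]
    obtain ⟨l, hl1, hl⟩ := exists_one_le_pow_eq m
      (T := max (max e (w (m + 1)) / A) (max 1 (v (m + 1))))
      (le_max_of_le_left hq) (by
        rintro rfl
        simp only [zero_add]
        rw [max_eq_left hv1, ← hA, div_self hA0.ne', max_self])
    have hl0 : 0 < l := by linarith
    have h1 := hX A l hA0 hl1 ?_ ?_ (max_le_max he1 le_rfl)
    · refine h1.trans ?_
      gcongr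
      rw [show m + 1 - 1 = m by omega, hl, mul_max_of_nonneg _ _ hA0.le, mul_div_cancel₀ _ hA0.ne']
      refine max_le ?_ ?_
      · have : 0 ≤ A * max 1 (v (m + 1)) := by positivity
        linarith
      · have : 0 ≤ max e (w (m + 1)) := by positivity
        linarith
    · intro k hk
      have h2 := logConvex_le_geometric hK (m := m) (a := fun k => max e (w (k + 1)))
        (fun k => by positivity)
        (fun k hk => sq_max_le_of_logConvex hK he.le (hw _) (hw _) (hw _) (hwc _ (by omega)))
        hl0 (le_refl A) (by
          rw [hl, mul_max_of_nonneg _ _ hA0.le, mul_div_cancel₀ _ hA0.ne']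
          exact le_max_left _ _) (show k ≤ m by omega)
      refine (le_max_right _ _).trans (h2.trans ?_)
      gcongr
    · intro k hk
      have h2 := logConvex_le_geometric hK (m := m) (a := fun k => max 1 (v (k + 1))) (A := 1)
        (fun k => by positivity)
        (fun k hk => sq_max_le_of_logConvex hK zero_le_one (hv _) (hv _) (hv _) (hvc _ (by omega)))
        hl0 (by simp [hv1]) (by rw [hl, one_mul]; exact le_max_right _ _) (show k ≤ m by omega)
      refine (le_max_right _ _).trans (h2.trans ?_)
      rw [mul_one]
      gcongr
  -- let `e` tend to `0`
  have lim : Filter.Tendsto (fun e : ℝ => c * (max e (w (m + 1)) + max e (w 1) * max 1 (v (m+1))))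
      (𝓝[>] 0) (𝓝 (c * (max 0 (w (m + 1)) + max 0 (w 1) * max 1 (v (m+1))))) := by
    refine Filter.Tendsto.mono_left ?_ nhdsWithin_le_nhds
    exact Continuous.tendsto (by fun_prop) 0
  have h3 := ge_of_tendsto lim (by
    filter_upwards [Ioc_mem_nhdsGT (zero_lt_one' ℝ)] with e he using key e he.1 he.2)
  rw [max_eq_right (hw _), max_eq_right (hw _)] at h3
  refine h3.trans ?_
  have h4 : w 1 * max 1 (v (m + 1)) ≤ w (m + 1) + w 1 * v (m + 1) := by
    have : max 1 (v (m + 1)) ≤ 1 + v (m + 1) := max_le (by linarith [hv (m + 1)]) (by linarith)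
    have := mul_le_mul_of_nonneg_left this (hw 1)
    have := hwmono (show 1 ≤ m + 1 by omega)
    linarith
  have h5 : 0 ≤ w 1 * v (m + 1) := mul_nonneg (hw _) (hv _)
  nlinarith

/-- The counterpart of `le_of_geometric_majorants` for the second `C^R` estimate. There are four
families of bounds, each with its own critical slope, and `l` is the largest of the four. -/
lemma le_of_geometric_majorants' {K : ℝ} (hK : 1 ≤ K) (R : ℕ) (hR : 1 ≤ R) {c : ℝ} (hc : 0 ≤ c)
    {w v : ℕ → ℝ} (hw : ∀ k, 0 ≤ w k) (hv : ∀ k, 0 ≤ v k)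
    (hwmono : Monotone w) (hvmono : Monotone v)
    (hwc : ∀ k, k < R → w (k + 1) ^ 2 ≤ K ^ 2 * (w k * w (k + 2)))
    (hvc : ∀ k, k + 1 < R → v (k + 1) ^ 2 ≤ K ^ 2 * (v k * v (k + 2)))
    (hv1 : v 1 ≤ 1) (hw1 : w 1 ≤ 1) {X : ℝ}
    (hX : ∀ A B l : ℝ, 0 < A → 0 < B → 1 ≤ l → w 2 ≤ A →
      (∀ k, k < R → w (k + 2) ≤ K ^ (R ^ 2) * A * l ^ k) →
      (∀ k, k < R → w (k + 1) ≤ K ^ (R ^ 2) * l ^ k) →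
      (∀ k, k < R → v (k + 1) ≤ K ^ (R ^ 2) * l ^ k) →
      (∀ k, k ≤ R → v k ≤ K ^ (R ^ 2) * B * l ^ k) →
      X ≤ c * (w 1 * v R + A * B * l ^ (R - 1))) :
    X ≤ 8 * K ^ (R ^ 2) * c * (w 2 * v R + w (R + 1) * v 0) := by
  obtain ⟨m, rfl⟩ : ∃ m, R = m + 1 := ⟨R - 1, by omega⟩
  have hKm : K ^ (m ^ 2) ≤ K ^ ((m + 1) ^ 2) := pow_le_pow_right₀ hK (by gcongr; omega)
  have hK1 : 1 ≤ K ^ ((m + 1) ^ 2) := one_le_pow₀ hK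
  set Q := K ^ ((m + 1) ^ 2) with hQ
  have key : ∀ e : ℝ, 0 < e → e ≤ 1 → X ≤ c * (w 1 * v (m + 1) +
      Q * (max e (w (m + 2)) * max e (v 0) + max e (w 2) * (max e (v (m + 1))
        + max e (v 0) * v (m + 1)))) := by
    intro e he he1
    set A := max e (w 2) with hA
    set B := max e (v 0) with hB
    have hA0 : 0 < A := lt_max_of_lt_left he
    have hB0 : 0 < B := lt_max_of_lt_left he
    have hAle : A ≤ max e (w (m + 2)) := max_le_max le_rfl (hwmono (by omega))
    have hBle : B ≤ max e (v (m + 1)) := max_le_max le_rfl (hvmono (by omega))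
    obtain ⟨l₁, hl₁, hl₁'⟩ := exists_one_le_pow_eq m (T := max e (w (m + 2)) / A)
      (by rwa [one_le_div hA0]) (by rintro rfl; simp only [zero_add]; rw [← hA, div_self hA0.ne'])
    obtain ⟨l₂, hl₂, hl₂'⟩ := exists_one_le_pow_eq m (T := max 1 (v (m + 1)))
      (le_max_left _ _) (by rintro rfl; simpa using hv1)
    obtain ⟨l₃, hl₃, hl₃'⟩ := exists_one_le_pow_eq (m + 1) (T := max 1 (w (m + 2)))
      (le_max_left _ _) (by omega)
    obtain ⟨l₄, hl₄, hl₄'⟩ := exists_one_le_pow_eq (m + 1) (T := max e (v (m + 1)) / B)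
      (by rwa [one_le_div hB0]) (by omega)
    -- bounds valid for every slope above the respective critical one
    have b1 : ∀ k, k < m + 1 → w (k + 2) ≤ Q * A * l₁ ^ k := by
      intro k hk
      have h2 := logConvex_le_geometric hK (m := m) (a := fun k => max e (w (k + 2)))
        (fun k => by positivity)
        (fun k hk => sq_max_le_of_logConvex hK he.le (hw _) (hw _) (hw _) (hwc _ (by omega)))
        (show 0 < l₁ by linarith) (le_refl A) (by
          rw [hl₁', mul_div_cancel₀ _ hA0.ne']) (show k ≤ m by omega)
      refine (le_max_right _ _).trans (h2.trans ?_)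
      gcongr
    have b2 : ∀ k, k < m + 1 → v (k + 1) ≤ Q * l₂ ^ k := by
      intro k hk
      have h2 := logConvex_le_geometric hK (m := m) (a := fun k => max 1 (v (k + 1))) (A := 1)
        (fun k => by positivity)
        (fun k hk => sq_max_le_of_logConvex hK zero_le_one (hv _) (hv _) (hv _) (hvc _ (by omega)))
        (show 0 < l₂ by linarith) (by simp [hv1]) (by rw [hl₂', one_mul]) (show k ≤ m by omega)
      refine (le_max_right _ _).trans (h2.trans ?_)
      rw [mul_one]
      gcongr
    have b3 : ∀ k, k ≤ m + 1 → max 1 (w (k + 1)) ≤ Q * l₃ ^ k := by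
      intro k hk
      have h2 := logConvex_le_geometric hK (m := m + 1) (a := fun k => max 1 (w (k + 1))) (A := 1)
        (fun k => by positivity)
        (fun k hk => sq_max_le_of_logConvex hK zero_le_one (hw _) (hw _) (hw _) (hwc _ (by omega)))
        (show 0 < l₃ by linarith) (by simp [hw1]) (by rw [hl₃', one_mul]) hk
      refine h2.trans ?_
      rw [mul_one]
    have b4 : ∀ k, k ≤ m + 1 → v k ≤ Q * B * l₄ ^ k := by
      intro k hk
      have h2 := logConvex_le_geometric hK (m := m + 1) (a := fun k => max e (v k))
        (fun k => by positivity)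
        (fun k hk => sq_max_le_of_logConvex hK he.le (hv _) (hv _) (hv _) (hvc _ (by omega)))
        (show 0 < l₄ by linarith) (le_refl B) (by
          rw [hl₄', mul_div_cancel₀ _ hB0.ne']) hk
      exact (le_max_right _ _).trans h2
    set l := max (max l₁ l₂) (max l₃ l₄) with hl
    have hl1 : 1 ≤ l := by simp only [hl, le_max_iff]; tauto
    have e1 : l₁ ≤ l := (le_max_left _ _).trans (le_max_left _ _)
    have e2 : l₂ ≤ l := (le_max_right _ _).trans (le_max_left _ _)
    have e3 : l₃ ≤ l := (le_max_left _ _).trans (le_max_right _ _)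
    have e4 : l₄ ≤ l := (le_max_right _ _).trans (le_max_right _ _)
    have h1 := hX A B l hA0 hB0 hl1 (le_max_right _ _)
      (fun k hk => (b1 k hk).trans (by gcongr))
      (fun k hk => (le_max_right _ _).trans ((b3 k hk.le).trans (by gcongr)))
      (fun k hk => (b2 k hk).trans (by gcongr))
      (fun k hk => (b4 k hk).trans (by gcongr))
    refine h1.trans (mul_le_mul_of_nonneg_left (add_le_add le_rfl ?_) hc)
    have hT1 : 0 ≤ max e (w (m + 2)) * B := by positivity
    have hT2 : 0 ≤ A * max e (v (m + 1)) := by positivity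
    have hT3 : 0 ≤ A * (B * v (m + 1)) := by have := hv (m + 1); positivity
    -- it suffices to treat each slope separately
    have hsuff : ∀ l' : ℝ, A * B * l' ^ m ≤ Q * (max e (w (m + 2)) * B +
        A * (max e (v (m + 1)) + B * v (m + 1))) → l = l' →
        A * B * l ^ (m + 1 - 1) ≤ Q * (max e (w (m + 2)) * B +
        A * (max e (v (m + 1)) + B * v (m + 1))) := by
      rintro l' h rfl
      simpa using h
    have hS : max e (w (m + 2)) * B + A * (max e (v (m + 1)) + B * v (m + 1)) ≤
        Q * (max e (w (m + 2)) * B + A * (max e (v (m + 1)) + B * v (m + 1))) := by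
      refine le_mul_of_one_le_left ?_ hK1
      have := hv (m + 1); positivity
    have f1 : A * B * l₁ ^ m ≤ Q * (max e (w (m + 2)) * B +
        A * (max e (v (m + 1)) + B * v (m + 1))) := by
      refine le_trans ?_ hS
      rw [hl₁', mul_comm A B, mul_assoc, mul_div_cancel₀ _ hA0.ne']
      linarith
    have f2 : A * B * l₂ ^ m ≤ Q * (max e (w (m + 2)) * B +
        A * (max e (v (m + 1)) + B * v (m + 1))) := by
      refine le_trans ?_ hS
      rw [hl₂']
      have : max 1 (v (m + 1)) ≤ 1 + v (m + 1) := max_le (by linarith [hv (m + 1)]) (by linarith)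
      calc A * B * max 1 (v (m + 1)) ≤ A * B * (1 + v (m + 1)) := by gcongr
        _ = A * B + A * (B * v (m + 1)) := by ring
        _ ≤ A * max e (v (m + 1)) + A * (B * v (m + 1)) := by gcongr
        _ ≤ _ := by linarith
    have f3 : A * B * l₃ ^ m ≤ Q * (max e (w (m + 2)) * B +
        A * (max e (v (m + 1)) + B * v (m + 1))) := by
      have hp : 0 ≤ A * (max e (v (m + 1)) + B * v (m + 1)) := by
        have := hv (m + 1); positivity
      rcases le_total (w (m + 2)) 1 with h | h
      · have h3 : l₃ ^ (m + 1) = 1 := by rw [hl₃', max_eq_left h]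
        have h4 : l₃ ^ m ≤ 1 := by
          rw [← h3]; exact pow_le_pow_right₀ hl₃ (by omega)
        refine le_trans ?_ hS
        calc A * B * l₃ ^ m ≤ A * B * 1 := by gcongr
          _ ≤ max e (w (m + 2)) * B := by rw [mul_one]; gcongr
          _ ≤ _ := by linarith
      · have h3 : l₃ ^ (m + 1) = w (m + 2) := by rw [hl₃', max_eq_right h]
        have h4 : A ≤ Q * l₃ := by
          have := b3 1 (by omega)
          rw [pow_one] at this
          exact (max_le_max he1 le_rfl).trans this
        calc A * B * l₃ ^ m ≤ (Q * l₃) * B * l₃ ^ m := by gcongr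
          _ = Q * (w (m + 2) * B) := by rw [← h3]; ring
          _ ≤ Q * (max e (w (m + 2)) * B) := by gcongr; exact le_max_right _ _
          _ ≤ _ := by gcongr; linarith
    have f4 : A * B * l₄ ^ m ≤ Q * (max e (w (m + 2)) * B +
        A * (max e (v (m + 1)) + B * v (m + 1))) := by
      refine le_trans ?_ hS
      calc A * B * l₄ ^ m ≤ A * B * l₄ ^ (m + 1) := by
            gcongr
            omega
        _ = A * max e (v (m + 1)) := by rw [hl₄', mul_assoc, mul_div_cancel₀ _ hB0.ne']
        _ ≤ _ := by linarith
    -- the slope `l` is one of the four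
    rcases max_choice (max l₁ l₂) (max l₃ l₄) with h | h
    · rcases max_choice l₁ l₂ with h' | h'
      · exact hsuff _ f1 (h.trans h')
      · exact hsuff _ f2 (h.trans h')
    · rcases max_choice l₃ l₄ with h' | h'
      · exact hsuff _ f3 (h.trans h')
      · exact hsuff _ f4 (h.trans h')
  have lim : Filter.Tendsto (fun e : ℝ => c * (w 1 * v (m + 1) +
      Q * (max e (w (m + 2)) * max e (v 0) + max e (w 2) * (max e (v (m + 1))
        + max e (v 0) * v (m + 1)))))
      (𝓝[>] 0) (𝓝 (c * (w 1 * v (m + 1) +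
      Q * (max 0 (w (m + 2)) * max 0 (v 0) + max 0 (w 2) * (max 0 (v (m + 1))
        + max 0 (v 0) * v (m + 1)))))) := by
    refine Filter.Tendsto.mono_left ?_ nhdsWithin_le_nhds
    exact Continuous.tendsto (by fun_prop) 0
  have h3 := ge_of_tendsto lim (by
    filter_upwards [Ioc_mem_nhdsGT (zero_lt_one' ℝ)] with e he using key e he.1 he.2)
  rw [max_eq_right (hw _), max_eq_right (hw _), max_eq_right (hv _), max_eq_right (hv _)] at h3
  refine h3.trans ?_
  have hv0 : v 0 ≤ 1 := (hvmono (by omega)).trans hv1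
  have i1 : w 1 * v (m + 1) ≤ Q * (w 2 * v (m + 1)) := by
    refine le_trans ?_ (le_mul_of_one_le_left (mul_nonneg (hw _) (hv _)) hK1)
    exact mul_le_mul_of_nonneg_right (hwmono (by omega)) (hv _)
  have i2 : w 2 * (v 0 * v (m + 1)) ≤ w 2 * v (m + 1) := by
    refine mul_le_mul_of_nonneg_left ?_ (hw _)
    exact mul_le_of_le_one_left (hv _) hv0
  have i3 : 0 ≤ w 2 * v (m + 1) := mul_nonneg (hw _) (hv _)
  have i4 : 0 ≤ w (m + 2) * v 0 := mul_nonneg (hw _) (hv _)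
  have hQ0 : 0 ≤ Q := by linarith
  calc _ ≤ c * (Q * (w 2 * v (m + 1)) + Q * (w (m + 2) * v 0 + 2 * (w 2 * v (m + 1)))) := by
        refine mul_le_mul_of_nonneg_left (add_le_add i1 (mul_le_mul_of_nonneg_left ?_ hQ0)) hc
        rw [mul_add]
        linarith
    _ ≤ c * (8 * Q * (w 2 * v (m + 1) + w (m + 2) * v 0)) := by
        gcongr
        nlinarith [mul_nonneg hQ0 i3, mul_nonneg hQ0 i4]
    _ = _ := by ring

/-! ### Functions with geometrically growing derivatives -/

section Growth

variable {E F G H : Type*} [NormedAddCommGroup E] [NormedSpace ℝ E] [NormedAddCommGroup F]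
  [NormedSpace ℝ F] [NormedAddCommGroup G] [NormedSpace ℝ G] [NormedAddCommGroup H]
  [NormedSpace ℝ H]

/-- The derivatives of `f` at `x` of orders `1, …, R` satisfy `‖D^k f(x)‖ ≤ A l^(k-1)`. -/
def DerivGrowthAt (R : ℕ) (A l : ℝ) (f : E → F) (x : E) : Prop :=
  ContDiffAt ℝ R f x ∧ ∀ k, 1 ≤ k → k ≤ R → ‖iteratedFDeriv ℝ k f x‖ ≤ A * l ^ (k - 1)

/-- The derivatives of `f` at `x` satisfy `‖f(x)‖ ≤ A` and `‖D^k f(x)‖ ≤ A l^(k-1)` for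
`1 ≤ k ≤ R`. The truncated subtraction `0 - 1 = 0` is meant here. -/
def GrowthAt (R : ℕ) (A l : ℝ) (f : E → F) (x : E) : Prop :=
  ContDiffAt ℝ R f x ∧ ∀ k, k ≤ R → ‖iteratedFDeriv ℝ k f x‖ ≤ A * l ^ (k - 1)

variable {R : ℕ} {A B C l : ℝ} {f g : E → F} {x : E}

lemma GrowthAt.derivGrowthAt (h : GrowthAt R A l f x) : DerivGrowthAt R A l f x :=
  ⟨h.1, fun k _ hk => h.2 k hk⟩

lemma GrowthAt.norm_le (h : GrowthAt R A l f x) : ‖f x‖ ≤ A := by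
  simpa using h.2 0 (Nat.zero_le _)

lemma DerivGrowthAt.growthAt (h : DerivGrowthAt R A l f x) (h0 : ‖f x‖ ≤ A) :
    GrowthAt R A l f x := by
  refine ⟨h.1, fun k hk => ?_⟩
  rcases Nat.eq_zero_or_pos k with rfl | hk0
  · simpa using h0
  · exact h.2 k hk0 hk

lemma DerivGrowthAt.mono (h : DerivGrowthAt R A l f x) (hl : 0 ≤ l) (hAB : A ≤ B) :
    DerivGrowthAt R B l f x :=
  ⟨h.1, fun k h1 hk => (h.2 k h1 hk).trans (by gcongr)⟩

lemma GrowthAt.mono (h : GrowthAt R A l f x) (hl : 0 ≤ l) (hAB : A ≤ B) :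
    GrowthAt R B l f x :=
  ⟨h.1, fun k hk => (h.2 k hk).trans (by gcongr)⟩

lemma GrowthAt.congr (h : GrowthAt R A l f x) (hfg : g =ᶠ[𝓝 x] f) : GrowthAt R A l g x := by
  refine ⟨h.1.congr_of_eventuallyEq hfg, fun k hk => ?_⟩
  rw [(hfg.iteratedFDeriv ℝ k).eq_of_nhds]
  exact h.2 k hk

lemma GrowthAt.add (hf : GrowthAt R A l f x) (hg : GrowthAt R B l g x) :
    GrowthAt R (A + B) l (fun y => f y + g y) x := by
  refine ⟨hf.1.add hg.1, fun k hk => ?_⟩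
  have hk' : (k : WithTop ℕ∞) ≤ R := by exact_mod_cast hk
  have := iteratedFDeriv_add_apply (i := k) (hf.1.of_le hk') (hg.1.of_le hk')
  rw [show (fun y => f y + g y) = f + g from rfl, this, add_mul]
  exact (norm_add_le _ _).trans (add_le_add (hf.2 k hk) (hg.2 k hk))

lemma GrowthAt.sub (hf : GrowthAt R A l f x) (hg : GrowthAt R B l g x) :
    GrowthAt R (A + B) l (fun y => f y - g y) x := by
  refine ⟨hf.1.sub hg.1, fun k hk => ?_⟩
  have hk' : (k : WithTop ℕ∞) ≤ R := by exact_mod_cast hk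
  have := iteratedFDeriv_sub_apply (i := k) (hf.1.of_le hk') (hg.1.of_le hk')
  rw [show (fun y => f y - g y) = f - g from rfl, this, add_mul]
  exact (norm_sub_le _ _).trans (add_le_add (hf.2 k hk) (hg.2 k hk))

lemma DerivGrowthAt.prodMk {f : E → F} {g : E → G} (hf : DerivGrowthAt R A l f x)
    (hg : DerivGrowthAt R A l g x) : DerivGrowthAt R A l (fun y => (f y, g y)) x := by
  refine ⟨hf.1.prodMk hg.1, fun k h1 hk => ?_⟩
  have hk' : (k : WithTop ℕ∞) ≤ R := by exact_mod_cast hk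
  rw [iteratedFDeriv_prodMk hf.1 hg.1 hk', ContinuousMultilinearMap.opNorm_prod]
  exact max_le (hf.2 k h1 hk) (hg.2 k h1 hk)

lemma DerivGrowthAt.const_smul (hf : DerivGrowthAt R A l f x) {t : ℝ} (ht : t ∈ Icc (0 : ℝ) 1) :
    DerivGrowthAt R A l (fun y => t • f y) x := by
  refine ⟨hf.1.const_smul t, fun k h1 hk => ?_⟩
  have hk' : (k : WithTop ℕ∞) ≤ R := by exact_mod_cast hk
  rw [iteratedFDeriv_const_smul_apply' (hf.1.of_le hk'), norm_smul, Real.norm_of_nonneg ht.1]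
  exact (mul_le_of_le_one_left (norm_nonneg _) ht.2).trans (hf.2 k h1 hk)

lemma derivGrowthAt_id (hl : 1 ≤ l) : DerivGrowthAt R 1 l (fun y : E => y) x := by
  refine ⟨contDiffAt_id, fun k h1 hk => ?_⟩
  obtain ⟨k, rfl⟩ : ∃ j, k = j + 1 := ⟨k - 1, by omega⟩
  have hpos : (0:ℝ) ≤ 1 * l ^ (k + 1 - 1) := by positivity
  rw [← norm_iteratedFDeriv_fderiv]
  have : fderiv ℝ (fun y : E => y) = fun _ => ContinuousLinearMap.id ℝ E := by
    ext1 y; exact fderiv_fun_id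
  rw [this]
  rcases Nat.eq_zero_or_pos k with rfl | hk0
  · simpa using ContinuousLinearMap.norm_id_le
  · rw [iteratedFDeriv_const_of_ne hk0.ne']
    simpa using hpos

/-- The Leibniz rule for norms of derivatives at a point. -/
lemma norm_iteratedFDeriv_bilinear_le (b : F →L[ℝ] G →L[ℝ] H) (hb : ‖b‖ ≤ 1) {n : ℕ}
    {f : E → F} {g : E → G} (hf : ContDiffAt ℝ n f x) (hg : ContDiffAt ℝ n g x) :
    ‖iteratedFDeriv ℝ n (fun y => b (f y) (g y)) x‖ ≤
      ∑ i ∈ Finset.range (n + 1),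
        (n.choose i : ℝ) * ‖iteratedFDeriv ℝ i f x‖ * ‖iteratedFDeriv ℝ (n - i) g x‖ := by
  obtain ⟨u, hu, huo, hxu⟩ := eventually_nhds_iff.1
    ((hf.eventually (by simp)).and (hg.eventually (by simp)))
  have h := b.norm_iteratedFDerivWithin_le_of_bilinear_of_le_one (n := n) (s := u) (x := x)
    (fun y hy => (hu y hy).1.contDiffWithinAt) (fun y hy => (hu y hy).2.contDiffWithinAt)
    huo.uniqueDiffOn hxu le_rfl hb
  simpa only [iteratedFDerivWithin_of_isOpen _ huo hxu] using h

/-- Growth bounds of the same slope multiply: `D^k` of the product distributes `k` derivatives, and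
the exponents of `l` add up to at most `k - 1`. -/
lemma GrowthAt.bilinear (b : F →L[ℝ] G →L[ℝ] H) (hb : ‖b‖ ≤ 1) {f : E → F} {g : E → G}
    (hl : 1 ≤ l) (hf : GrowthAt R A l f x) (hg : GrowthAt R B l g x) :
    GrowthAt R (2 ^ R * A * B) l (fun y => b (f y) (g y)) x := by
  have hA : 0 ≤ A := (norm_nonneg _).trans hf.norm_le
  have hB : 0 ≤ B := (norm_nonneg _).trans hg.norm_le
  have hl0 : 0 ≤ l := by linarith
  refine ⟨(b.isBoundedBilinearMap.contDiff.contDiffAt).comp x (hf.1.prodMk hg.1),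
    fun k hk => ?_⟩
  have hk' : (k : WithTop ℕ∞) ≤ R := by exact_mod_cast hk
  refine (norm_iteratedFDeriv_bilinear_le b hb (hf.1.of_le hk') (hg.1.of_le hk')).trans ?_
  calc ∑ i ∈ Finset.range (k + 1),
        (k.choose i : ℝ) * ‖iteratedFDeriv ℝ i f x‖ * ‖iteratedFDeriv ℝ (k - i) g x‖
      ≤ ∑ i ∈ Finset.range (k + 1), (k.choose i : ℝ) * (A * B * l ^ (k - 1)) := by
        refine Finset.sum_le_sum fun i hi => ?_
        rw [Finset.mem_range] at hi
        rw [mul_assoc]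
        refine mul_le_mul_of_nonneg_left ?_ (by positivity)
        calc ‖iteratedFDeriv ℝ i f x‖ * ‖iteratedFDeriv ℝ (k - i) g x‖
            ≤ (A * l ^ (i - 1)) * (B * l ^ (k - i - 1)) :=
              mul_le_mul (hf.2 i (by omega)) (hg.2 _ (by omega)) (norm_nonneg _) (by positivity)
          _ = A * B * l ^ ((i - 1) + (k - i - 1)) := by rw [pow_add]; ring
          _ ≤ A * B * l ^ (k - 1) := by
              gcongr <;> first | assumption | omega
    _ = 2 ^ k * (A * B * l ^ (k - 1)) := by
        rw [← Finset.sum_mul]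
        congr 1
        exact_mod_cast Nat.sum_range_choose k
    _ ≤ 2 ^ R * A * B * l ^ (k - 1) := by
        rw [mul_assoc (2 ^ R), mul_assoc (2 ^ R)]
        gcongr
        norm_num

/-- The product of a function with derivatives of size `A l^(k-1)`, `k ≥ 1`, and a function with
derivatives of size `B l^k`: the only term exceeding `A B l^(R-1)` is the one in which all
derivatives fall on the second factor. -/
lemma norm_iteratedFDeriv_clm_apply_le {f : E → F →L[ℝ] G} {g : E → F} {a N : ℝ} (hl : 1 ≤ l)
    (hf : GrowthAt R A l f x) (ha : ‖f x‖ ≤ a) (hg : ContDiffAt ℝ R g x) (hB0 : 0 ≤ B)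
    (hB : ∀ k, k ≤ R → ‖iteratedFDeriv ℝ k g x‖ ≤ B * l ^ k)
    (hN : ∀ k, k ≤ R → ‖iteratedFDeriv ℝ k g x‖ ≤ N) {k : ℕ} (hk : k ≤ R) :
    ‖iteratedFDeriv ℝ k (fun y => f y (g y)) x‖ ≤ a * N + 2 ^ R * A * B * l ^ (R - 1) := by
  have hA : 0 ≤ A := (norm_nonneg _).trans hf.norm_le
  have hl0 : 0 ≤ l := by linarith
  have hk' : (k : WithTop ℕ∞) ≤ R := by exact_mod_cast hk
  have hb : ‖(ContinuousLinearMap.id ℝ (F →L[ℝ] G))‖ ≤ 1 := ContinuousLinearMap.norm_id_le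
  refine (norm_iteratedFDeriv_bilinear_le (ContinuousLinearMap.id ℝ (F →L[ℝ] G)) hb
    (hf.1.of_le hk') (hg.of_le hk')).trans ?_
  rw [Finset.sum_range_succ']
  rw [add_comm]
  refine add_le_add ?_ ?_
  · simp only [Nat.choose_zero_right, Nat.cast_one, one_mul, norm_iteratedFDeriv_zero, Nat.sub_zero]
    exact mul_le_mul ha (hN k hk) (norm_nonneg _) ((norm_nonneg _).trans ha)
  calc ∑ i ∈ Finset.range k, (k.choose (i + 1) : ℝ) * ‖iteratedFDeriv ℝ (i + 1) f x‖ *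
          ‖iteratedFDeriv ℝ (k - (i + 1)) g x‖
      ≤ ∑ i ∈ Finset.range k, (k.choose (i + 1) : ℝ) * (A * B * l ^ (R - 1)) := by
        refine Finset.sum_le_sum fun i hi => ?_
        rw [Finset.mem_range] at hi
        rw [mul_assoc]
        refine mul_le_mul_of_nonneg_left ?_ (by positivity)
        calc ‖iteratedFDeriv ℝ (i + 1) f x‖ * ‖iteratedFDeriv ℝ (k - (i + 1)) g x‖
            ≤ (A * l ^ (i + 1 - 1)) * (B * l ^ (k - (i + 1))) :=
              mul_le_mul (hf.2 _ (by omega)) (hB _ (by omega)) (norm_nonneg _) (by positivity)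
          _ = A * B * l ^ ((i + 1 - 1) + (k - (i + 1))) := by rw [pow_add]; ring
          _ ≤ A * B * l ^ (R - 1) := by
              gcongr <;> first | assumption | omega
    _ ≤ 2 ^ k * (A * B * l ^ (R - 1)) := by
        rw [← Finset.sum_mul]
        gcongr
        have := Nat.sum_range_choose k
        rw [Finset.sum_range_succ'] at this
        have h2 : ∑ i ∈ Finset.range k, k.choose (i + 1) ≤ 2 ^ k := by omega
        exact_mod_cast h2
    _ ≤ 2 ^ R * A * B * l ^ (R - 1) := by
        rw [mul_assoc (2 ^ R), mul_assoc (2 ^ R)]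
        gcongr
        norm_num

/-- The constant in the chain rule `GrowthAt.comp`. -/
noncomputable def faaConst (R : ℕ) (C : ℝ) : ℝ :=
  (∑ k ∈ Finset.range (R + 1), (Fintype.card (OrderedFinpartition k) : ℝ)) * C ^ R

lemma one_le_faaConst (R : ℕ) {C : ℝ} (hC : 1 ≤ C) : 1 ≤ faaConst R C := by
  have h1 : (1 : ℝ) ≤ ∑ k ∈ Finset.range (R + 1), (Fintype.card (OrderedFinpartition k) : ℝ) := by
    rw [Finset.sum_range_succ']
    have : 0 ≤ ∑ k ∈ Finset.range R, (Fintype.card (OrderedFinpartition (k + 1)) : ℝ) := by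
      positivity
    have h2 : (1 : ℝ) ≤ Fintype.card (OrderedFinpartition 0) := by
      exact_mod_cast Fintype.card_pos
    linarith
  have h2 : 1 ≤ C ^ R := one_le_pow₀ hC
  unfold faaConst
  nlinarith

/-- The chain rule: by the Faà di Bruno formula, each term of `D^k (g ∘ f)` has a factor
`l^(j-1)` from the `j`-th derivative of `g`, and factors with exponents adding up to `k - j` from
the derivatives of `f`. -/
lemma GrowthAt.comp {g : F → G} {f : E → F} (hl : 1 ≤ l) (hC : 1 ≤ C)
    (hg : GrowthAt R A l g (f x)) (hf : DerivGrowthAt R C l f x) :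
    GrowthAt R (faaConst R C * A) l (fun y => g (f y)) x := by
  have hA : 0 ≤ A := (norm_nonneg _).trans hg.norm_le
  have hl0 : 0 ≤ l := by linarith
  refine ⟨hg.1.comp x hf.1, fun k hk => ?_⟩
  have hk' : (k : WithTop ℕ∞) ≤ R := by exact_mod_cast hk
  rw [show (fun y => g (f y)) = g ∘ f from rfl, iteratedFDeriv_comp hg.1 hf.1 hk']
  have hterm : ∀ c : OrderedFinpartition k,
      ‖(ftaylorSeries ℝ g (f x)).compAlongOrderedFinpartition (ftaylorSeries ℝ f x) c‖
        ≤ C ^ R * (A * l ^ (k - 1)) := by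
    intro c
    refine (c.norm_compAlongOrderedFinpartition_le _ _).trans ?_
    have h1 : ∀ i, ‖ftaylorSeries ℝ f x (c.partSize i)‖ ≤ C * l ^ (c.partSize i - 1) := fun i =>
      hf.2 _ (c.partSize_pos i) ((c.partSize_le i).trans hk)
    have h2 : ∏ i, ‖ftaylorSeries ℝ f x (c.partSize i)‖ ≤ C ^ c.length * l ^ (k - c.length) := by
      calc ∏ i, ‖ftaylorSeries ℝ f x (c.partSize i)‖ ≤ ∏ i, (C * l ^ (c.partSize i - 1)) :=
            Finset.prod_le_prod (fun i _ => norm_nonneg _) fun i _ => h1 i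
        _ = C ^ c.length * l ^ (∑ i, (c.partSize i - 1)) := by
            rw [Finset.prod_mul_distrib, Finset.prod_pow_eq_pow_sum]
            simp
        _ = C ^ c.length * l ^ (k - c.length) := by
            congr 2
            have h3 : ∑ i, c.partSize i = k := by
              have := c.sum_sigma_eq_sum (fun _ => (1 : ℕ))
              simpa using this
            have h4 : ∑ i, (c.partSize i - 1) + c.length = ∑ i, c.partSize i := by
              have h5 : ∑ _i : Fin c.length, 1 = c.length := by simp
              calc _ = ∑ i, (c.partSize i - 1) + ∑ _i : Fin c.length, 1 := by rw [h5]
                _ = ∑ i, c.partSize i := by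
                  rw [← Finset.sum_add_distrib]
                  exact Finset.sum_congr rfl fun i _ => Nat.sub_add_cancel (c.partSize_pos i)
            omega
    calc _ ≤ (A * l ^ (c.length - 1)) * (C ^ c.length * l ^ (k - c.length)) :=
          mul_le_mul (hg.2 _ (c.length_le.trans hk)) h2
            (Finset.prod_nonneg fun i _ => norm_nonneg _) (by positivity)
      _ = C ^ c.length * (A * l ^ ((c.length - 1) + (k - c.length))) := by rw [pow_add]; ring
      _ ≤ C ^ R * (A * l ^ (k - 1)) := by
          have hlen := c.length_le
          have hlen0 : 0 < k → 0 < c.length := c.length_pos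
          gcongr <;> first | assumption | omega
  calc _ ≤ ∑ c : OrderedFinpartition k,
        ‖(ftaylorSeries ℝ g (f x)).compAlongOrderedFinpartition (ftaylorSeries ℝ f x) c‖ :=
        norm_sum_le _ _
    _ ≤ ∑ _c : OrderedFinpartition k, C ^ R * (A * l ^ (k - 1)) :=
        Finset.sum_le_sum fun c _ => hterm c
    _ = Fintype.card (OrderedFinpartition k) * (C ^ R * (A * l ^ (k - 1))) := by
        simp
    _ ≤ (∑ k ∈ Finset.range (R + 1), (Fintype.card (OrderedFinpartition k) : ℝ))
          * (C ^ R * (A * l ^ (k - 1))) := by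
        gcongr
        exact Finset.single_le_sum (f := fun k => (Fintype.card (OrderedFinpartition k) : ℝ))
          (fun _ _ => by positivity) (Finset.mem_range.2 (by omega))
    _ = _ := by unfold faaConst; ring

/-- A smooth function satisfies uniform growth bounds on a compact set. -/
lemma exists_growthAt_of_isCompact {Ω K : Set E} (hΩ : IsOpen Ω) (hf : ContDiffOn ℝ ∞ f Ω)
    (hK : IsCompact K) (hKΩ : K ⊆ Ω) (R : ℕ) :
    ∃ A, 1 ≤ A ∧ ∀ x ∈ K, ∀ l, 1 ≤ l → GrowthAt R A l f x := by
  have hbd : ∀ k : ℕ, ∃ A : ℝ, ∀ x ∈ K, ‖iteratedFDeriv ℝ k f x‖ ≤ A := by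
    intro k
    have hc : ContinuousOn (fun x => iteratedFDeriv ℝ k f x) Ω := by
      have := hf.continuousOn_iteratedFDerivWithin (m := k) (by exact_mod_cast le_top)
        hΩ.uniqueDiffOn
      exact this.congr fun x hx => (iteratedFDerivWithin_of_isOpen k hΩ hx).symm
    exact hK.exists_bound_of_continuousOn (hc.mono hKΩ)
  choose A hA using hbd
  refine ⟨1 + ∑ k ∈ Finset.range (R + 1), |A k|, ?_, fun x hx l hl => ⟨?_, fun k hk => ?_⟩⟩
  · have : 0 ≤ ∑ k ∈ Finset.range (R + 1), |A k| := by positivity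
    linarith
  · exact (hf.contDiffAt (hΩ.mem_nhds (hKΩ hx))).of_le (by exact_mod_cast le_top)
  · have h1 : |A k| ≤ ∑ k ∈ Finset.range (R + 1), |A k| :=
      Finset.single_le_sum (f := fun k => |A k|) (fun _ _ => abs_nonneg _)
        (Finset.mem_range.2 (by omega))
    have h2 := (hA k x hx).trans (le_abs_self _)
    have h3 : 1 ≤ l ^ (k - 1) := one_le_pow₀ hl
    have h4 : 0 ≤ |A k| := abs_nonneg _
    nlinarith

lemma growthAt_fderiv (hf : ContDiffAt ℝ (R + 1 : ℕ) f x)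
    (h : ∀ k, k ≤ R → ‖iteratedFDeriv ℝ (k + 1) f x‖ ≤ A * l ^ (k - 1)) :
    GrowthAt R A l (fderiv ℝ f) x := by
  refine ⟨hf.fderiv_right (by norm_cast), fun k hk => ?_⟩
  rw [norm_iteratedFDeriv_fderiv]
  exact h k hk

end Growth

/-! ### Differentiation under the integral sign -/

section Parametric

universe u

variable {E : Type u} [NormedAddCommGroup E] [NormedSpace ℝ E] [FiniteDimensional ℝ E]

lemma exists_bound_near {G : Type*} [NormedAddCommGroup G] [NormedSpace ℝ G] {U : Set E}
    (hU : IsOpen U) {f : ℝ × E → G} (hf : ∀ t ∈ Icc (0 : ℝ) 1, ∀ x ∈ U, ContinuousAt f (t, x))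
    {x : E} (hx : x ∈ U) :
    ∃ r > 0, Metric.ball x r ⊆ U ∧
      ∃ C, ∀ t ∈ Icc (0 : ℝ) 1, ∀ y ∈ Metric.ball x r, ‖f (t, y)‖ ≤ C := by
  have : ProperSpace E := FiniteDimensional.proper ℝ E
  obtain ⟨r, hr, hrU⟩ := Metric.nhds_basis_closedBall.mem_iff.1 (hU.mem_nhds hx)
  obtain ⟨C, hC⟩ := (isCompact_Icc.prod (isCompact_closedBall x r)).exists_bound_of_continuousOn
    (s := Icc (0 : ℝ) 1 ×ˢ Metric.closedBall x r) (f := f)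
    (fun p hp => (hf p.1 hp.1 p.2 (hrU hp.2)).continuousWithinAt)
  exact ⟨r, hr, Metric.ball_subset_closedBall.trans hrU, C, fun t ht y hy =>
    hC (t, y) ⟨ht, Metric.ball_subset_closedBall hy⟩⟩

lemma continuousOn_slice {G : Type*} [NormedAddCommGroup G] {U : Set E}
    {f : ℝ × E → G} (hf : ∀ t ∈ Icc (0 : ℝ) 1, ∀ x ∈ U, ContinuousAt f (t, x)) {x : E}
    (hx : x ∈ U) : ContinuousOn (fun t => f (t, x)) (Icc 0 1) := fun t ht =>
  (ContinuousAt.comp (f := fun t : ℝ => (t, x)) (hf t ht x hx)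
    (by fun_prop)).continuousWithinAt

lemma intervalIntegrable_slice {G : Type*} [NormedAddCommGroup G] {U : Set E}
    {f : ℝ × E → G} (hf : ∀ t ∈ Icc (0 : ℝ) 1, ∀ x ∈ U, ContinuousAt f (t, x)) {x : E}
    (hx : x ∈ U) : IntervalIntegrable (fun t => f (t, x)) MeasureTheory.volume 0 1 := by
  apply ContinuousOn.intervalIntegrable
  rw [uIcc_of_le zero_le_one]
  exact continuousOn_slice hf hx

/-- Differentiation under the integral sign for an integrand of class `C^l`, with the resulting
bound on the `l`-th derivative of the integral. -/
theorem contDiffOn_integral_and_norm_le (l : ℕ) {G : Type u} [NormedAddCommGroup G]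
    [NormedSpace ℝ G] [CompleteSpace G] {U : Set E} (hU : IsOpen U) {f : ℝ × E → G}
    (hf : ∀ t ∈ Icc (0 : ℝ) 1, ∀ x ∈ U, ContDiffAt ℝ l f (t, x)) :
    ContDiffOn ℝ l (fun x => ∫ t in (0 : ℝ)..1, f (t, x)) U ∧
    ∀ x ∈ U, ∀ C, (∀ t ∈ Icc (0 : ℝ) 1, ‖iteratedFDeriv ℝ l (fun y => f (t, y)) x‖ ≤ C) →
      ‖iteratedFDeriv ℝ l (fun x => ∫ t in (0 : ℝ)..1, f (t, x)) x‖ ≤ C := by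
  induction l generalizing G with
  | zero =>
    have hfc : ∀ t ∈ Icc (0 : ℝ) 1, ∀ x ∈ U, ContinuousAt f (t, x) := fun t ht x hx =>
      (hf t ht x hx).continuousAt
    refine ⟨?_, ?_⟩
    · simp only [Nat.cast_zero, contDiffOn_zero]
      intro x hx
      obtain ⟨r, hr, hrU, C, hC⟩ := exists_bound_near hU hfc hx
      refine ContinuousAt.continuousWithinAt ?_
      refine intervalIntegral.continuousAt_of_dominated_interval (bound := fun _ => C) ?_ ?_
        intervalIntegrable_const ?_
      · filter_upwards [Metric.ball_mem_nhds x hr] with y hy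
        exact (intervalIntegrable_slice hfc (hrU hy)).def'.aestronglyMeasurable
      · filter_upwards [Metric.ball_mem_nhds x hr] with y hy
        refine Filter.Eventually.of_forall fun t ht => hC t ?_ y hy
        rw [uIoc_of_le zero_le_one] at ht
        exact Ioc_subset_Icc_self ht
      · refine Filter.Eventually.of_forall fun t ht => ?_
        rw [uIoc_of_le zero_le_one] at ht
        exact ContinuousAt.comp (f := fun y : E => (t, y)) (hfc t (Ioc_subset_Icc_self ht) x hx)
          (by fun_prop)
    · intro x hx C hC
      simp only [norm_iteratedFDeriv_zero] at hC ⊢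
      refine (intervalIntegral.norm_integral_le_of_norm_le_const (C := C) ?_).trans (by simp)
      intro t ht
      rw [uIoc_of_le zero_le_one] at ht
      exact hC t (Ioc_subset_Icc_self ht)
  | succ l ih =>
    have hfc : ∀ t ∈ Icc (0 : ℝ) 1, ∀ x ∈ U, ContinuousAt f (t, x) := fun t ht x hx =>
      (hf t ht x hx).continuousAt
    set f' : ℝ × E → E →L[ℝ] G := fun p =>
      (fderiv ℝ f p).comp (ContinuousLinearMap.inr ℝ ℝ E) with hf'
    have hf'l : ∀ t ∈ Icc (0 : ℝ) 1, ∀ x ∈ U, ContDiffAt ℝ l f' (t, x) := fun t ht x hx =>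
      ((hf t ht x hx).fderiv_right (m := l) (by norm_cast)).clm_comp contDiffAt_const
    have hf'c : ∀ t ∈ Icc (0 : ℝ) 1, ∀ x ∈ U, ContinuousAt f' (t, x) := fun t ht x hx =>
      (hf'l t ht x hx).continuousAt
    have hd : ∀ t ∈ Icc (0 : ℝ) 1, ∀ x ∈ U, HasFDerivAt (fun y => f (t, y)) (f' (t, x)) x := by
      intro t ht x hx
      have h1 : HasFDerivAt f (fderiv ℝ f (t, x)) (t, x) :=
        ((hf t ht x hx).differentiableAt (by simp)).hasFDerivAt
      have h2 : HasFDerivAt (fun y : E => (t, y)) (ContinuousLinearMap.inr ℝ ℝ E) x :=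
        hasFDerivAt_prodMk_right t x
      exact h1.comp x h2
    have hI : ∀ x ∈ U, HasFDerivAt (fun x => ∫ t in (0 : ℝ)..1, f (t, x))
        (∫ t in (0 : ℝ)..1, f' (t, x)) x := by
      intro x hx
      obtain ⟨r, hr, hrU, C, hC⟩ := exists_bound_near hU hf'c hx
      refine intervalIntegral.hasFDerivAt_integral_of_dominated_of_fderiv_le
        (F' := fun x t => f' (t, x)) (bound := fun _ => C) (Metric.ball_mem_nhds x hr) ?_
        (intervalIntegrable_slice hfc hx)
        (intervalIntegrable_slice hf'c hx).def'.aestronglyMeasurable ?_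
        intervalIntegrable_const ?_
      · filter_upwards [Metric.ball_mem_nhds x hr] with y hy
        exact (intervalIntegrable_slice hfc (hrU hy)).def'.aestronglyMeasurable
      · refine Filter.Eventually.of_forall fun t ht y hy => hC t ?_ y hy
        rw [uIoc_of_le zero_le_one] at ht
        exact Ioc_subset_Icc_self ht
      · refine Filter.Eventually.of_forall fun t ht y hy => ?_
        rw [uIoc_of_le zero_le_one] at ht
        exact hd t (Ioc_subset_Icc_self ht) y (hrU hy)
    obtain ⟨ih1, ih2⟩ := ih hf'l
    refine ⟨?_, ?_⟩
    · rw [show ((l + 1 : ℕ) : WithTop ℕ∞) = (l : WithTop ℕ∞) + 1 by norm_cast,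
        contDiffOn_succ_iff_fderiv_of_isOpen hU]
      refine ⟨fun x hx => (hI x hx).differentiableAt.differentiableWithinAt, by simp, ?_⟩
      exact ih1.congr fun x hx => (hI x hx).fderiv
    · intro x hx C hC
      rw [← norm_iteratedFDeriv_fderiv]
      have e1 : fderiv ℝ (fun x => ∫ t in (0 : ℝ)..1, f (t, x)) =ᶠ[𝓝 x]
          fun x => ∫ t in (0 : ℝ)..1, f' (t, x) := by
        filter_upwards [hU.mem_nhds hx] with y hy using (hI y hy).fderiv
      rw [(e1.iteratedFDeriv ℝ l).eq_of_nhds]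
      refine ih2 x hx C fun t ht => ?_
      have e2 : (fun y => f' (t, y)) =ᶠ[𝓝 x] fderiv ℝ (fun y => f (t, y)) := by
        filter_upwards [hU.mem_nhds hx] with y hy using (hd t ht y hy).fderiv.symm
      rw [(e2.iteratedFDeriv ℝ l).eq_of_nhds, norm_iteratedFDeriv_fderiv]
      exact hC t ht

/-- A mean value inequality for the derivatives of a difference `F 1 - F 0`, in terms of the
derivatives of `∂_t F_t`. -/
theorem contDiffAt_sub_and_norm_le {R : ℕ} {G : Type u} [NormedAddCommGroup G]
    [NormedSpace ℝ G] [CompleteSpace G] {U : Set E} (hU : IsOpen U) {x : E} (hx : x ∈ U)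
    {F : ℝ → E → G} {f : ℝ × E → G}
    (hf : ∀ t ∈ Icc (0 : ℝ) 1, ∀ x ∈ U, ContDiffAt ℝ R f (t, x))
    (hF : ∀ t ∈ Icc (0 : ℝ) 1, ∀ x ∈ U, HasDerivAt (fun s => F s x) (f (t, x)) t) :
    ContDiffAt ℝ R (fun y => F 1 y - F 0 y) x ∧
    ∀ k ≤ R, ∀ C, (∀ t ∈ Icc (0 : ℝ) 1, ‖iteratedFDeriv ℝ k (fun y => f (t, y)) x‖ ≤ C) →
      ‖iteratedFDeriv ℝ k (fun y => F 1 y - F 0 y) x‖ ≤ C := by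
  have heq : (fun y => F 1 y - F 0 y) =ᶠ[𝓝 x] fun y => ∫ t in (0 : ℝ)..1, f (t, y) := by
    filter_upwards [hU.mem_nhds hx] with y hy
    refine (intervalIntegral.integral_eq_sub_of_hasDerivAt (fun t ht => hF t ?_ y hy) ?_).symm
    · rwa [uIcc_of_le zero_le_one] at ht
    · exact intervalIntegrable_slice (fun t ht x hx => (hf t ht x hx).continuousAt) hy
  refine ⟨?_, fun k hk C hC => ?_⟩
  · exact (((contDiffOn_integral_and_norm_le R hU hf).1).contDiffAt
      (hU.mem_nhds hx)).congr_of_eventuallyEq heq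
  · rw [(heq.iteratedFDeriv ℝ k).eq_of_nhds]
    exact (contDiffOn_integral_and_norm_le k hU fun t ht x hx =>
      (hf t ht x hx).of_le (by exact_mod_cast hk)).2 x hx C hC

lemma growthAt_zero {R : ℕ} {A l : ℝ} (hA : 0 ≤ A) (hl : 0 ≤ l) {F G : Type*}
    [NormedAddCommGroup F] [NormedSpace ℝ F]
    [NormedAddCommGroup G] [NormedSpace ℝ G] {x : F} : GrowthAt R A l (fun _ : F => (0 : G)) x := by
  refine ⟨contDiffAt_const, fun k _ => ?_⟩
  rw [iteratedFDeriv_fun_zero]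
  simp only [Pi.zero_apply, norm_zero]
  positivity

lemma GrowthAt.prodMk {R : ℕ} {A l : ℝ} {F G H : Type*} [NormedAddCommGroup F] [NormedSpace ℝ F]
    [NormedAddCommGroup G] [NormedSpace ℝ G] [NormedAddCommGroup H] [NormedSpace ℝ H] {x : F}
    {f : F → G} {g : F → H} (hf : GrowthAt R A l f x) (hg : GrowthAt R A l g x) :
    GrowthAt R A l (fun y => (f y, g y)) x := by
  refine (hf.derivGrowthAt.prodMk hg.derivGrowthAt).growthAt ?_
  exact max_le hf.norm_le hg.norm_le

/-- If `Φ(z, 0) = 0`, then `Φ(z, b)` is of the size of `b`, also for derivatives. -/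
theorem GrowthAt.comp_of_vanishing {R : ℕ} {A C M l : ℝ} (hl : 1 ≤ l) (hC : 1 ≤ C)
    {Z B : Type*} {G : Type u} [NormedAddCommGroup Z] [NormedSpace ℝ Z]
    [NormedAddCommGroup B] [NormedSpace ℝ B] [NormedAddCommGroup G] [NormedSpace ℝ G]
    [CompleteSpace G] {Φ : Z × B → G} {Ω : Set (Z × B)} (hΩ : IsOpen Ω)
    (hstar : ∀ z b, (z, b) ∈ Ω → ∀ t ∈ Icc (0 : ℝ) 1, (z, t • b) ∈ Ω)
    (hΦ : ContDiffOn ℝ ∞ Φ Ω) (hΦ0 : ∀ z, (z, (0 : B)) ∈ Ω → Φ (z, 0) = 0)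
    {ζ : E → Z} {b : E → B} {x : E} (hx : (ζ x, b x) ∈ Ω)
    (hM : ∀ t ∈ Icc (0 : ℝ) 1, GrowthAt R M l (fderiv ℝ Φ) (ζ x, t • b x))
    (hζ : DerivGrowthAt R C l ζ x) (hbC : DerivGrowthAt R C l b x) (hb : GrowthAt R A l b x) :
    GrowthAt R (2 ^ R * (faaConst R C * M) * A) l (fun y => Φ (ζ y, b y)) x := by
  have hl0 : 0 ≤ l := by linarith
  have hA : 0 ≤ A := (norm_nonneg _).trans hb.norm_le
  obtain ⟨U, hU, hUo, hxU⟩ := eventually_nhds_iff.1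
    ((hζ.1.eventually (by simp)).and ((hb.1.eventually (by simp)).and
      ((hζ.1.continuousAt.prodMk hb.1.continuousAt).eventually (hΩ.mem_nhds hx))))
  have hΦ' : ContDiffOn ℝ ∞ (fderiv ℝ Φ) Ω := hΦ.fderiv_of_isOpen hΩ (by simp)
  have hmv := contDiffAt_sub_and_norm_le (R := R) hUo hxU (F := fun t y => Φ (ζ y, t • b y))
    (f := fun p => fderiv ℝ Φ (ζ p.2, p.1 • b p.2) (0, b p.2)) ?_ ?_
  · have heq : (fun y => Φ (ζ y, b y)) =ᶠ[𝓝 x]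
        fun y => Φ (ζ y, (1 : ℝ) • b y) - Φ (ζ y, (0 : ℝ) • b y) := by
      filter_upwards [hUo.mem_nhds hxU] with y hy
      have h0 := hstar _ _ (hU y hy).2.2 0 (by simp)
      rw [zero_smul] at h0
      rw [zero_smul, one_smul, hΦ0 _ h0, sub_zero]
    refine GrowthAt.congr ⟨hmv.1, fun k hk => hmv.2 k hk _ fun t ht => ?_⟩ heq
    have h1 : GrowthAt R (faaConst R C * M) l (fun y => fderiv ℝ Φ (ζ y, t • b y)) x :=
      GrowthAt.comp (f := fun y => (ζ y, t • b y)) hl hC (hM t ht) (hζ.prodMk (hbC.const_smul ht))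
    have h2 : GrowthAt R A l (fun y => ((0 : Z), b y)) x := (growthAt_zero hA hl0).prodMk hb
    exact (GrowthAt.bilinear (ContinuousLinearMap.id ℝ (Z × B →L[ℝ] G))
      ContinuousLinearMap.norm_id_le hl h1 h2).2 k hk
  · intro t ht y hy
    obtain ⟨h1, h2, h3⟩ := hU y hy
    have hb' : ContDiffAt ℝ R (fun p : ℝ × E => b p.2) (t, y) :=
      ContDiffAt.comp (g := b) (f := Prod.snd) (t, y) h2 contDiffAt_snd
    have hζ' : ContDiffAt ℝ R (fun p : ℝ × E => ζ p.2) (t, y) :=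
      ContDiffAt.comp (g := ζ) (f := Prod.snd) (t, y) h1 contDiffAt_snd
    have hin : ContDiffAt ℝ R (fun p : ℝ × E => (ζ p.2, p.1 • b p.2)) (t, y) :=
      hζ'.prodMk (contDiffAt_fst.smul hb')
    refine ContDiffAt.clm_apply ?_ (contDiffAt_const.prodMk hb')
    exact ContDiffAt.comp (g := fderiv ℝ Φ) (f := fun p : ℝ × E => (ζ p.2, p.1 • b p.2)) (t, y)
      ((hΦ'.contDiffAt (hΩ.mem_nhds (hstar _ _ h3 t ht))).of_le (by exact_mod_cast le_top)) hin
  · intro t ht y hy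
    obtain ⟨h1, h2, h3⟩ := hU y hy
    have hd : HasFDerivAt Φ (fderiv ℝ Φ (ζ y, t • b y)) (ζ y, t • b y) :=
      ((hΦ.contDiffAt (hΩ.mem_nhds (hstar _ _ h3 t ht))).differentiableAt (by simp)).hasFDerivAt
    have hin : HasDerivAt (fun s : ℝ => (ζ y, s • b y)) (0, b y) t := by
      refine (hasDerivAt_const t (ζ y)).prodMk ?_
      simpa using (hasDerivAt_id t).smul_const (b y)
    exact hd.comp_hasDerivAt t hin

end Parametric

/-! ### The Landau inequality -/

section Landau

variable {E F : Type*} [NormedAddCommGroup E] [NormedSpace ℝ E] [NormedAddCommGroup F]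
  [NormedSpace ℝ F]

/-- **Landau's inequality**: a bounded function with Lipschitz derivative has a derivative
controlled by the geometric mean of the two bounds. -/
lemma sq_norm_fderiv_le {f : E → F} {A B : ℝ} (hf : Differentiable ℝ f) (hA : ∀ x, ‖f x‖ ≤ A)
    (hB0 : 0 ≤ B) (hB : ∀ x y, ‖fderiv ℝ f y - fderiv ℝ f x‖ ≤ B * ‖y - x‖) (x : E) :
    ‖fderiv ℝ f x‖ ^ 2 ≤ 3 ^ 2 * (A * B) := by
  have hA0 : 0 ≤ A := (norm_nonneg _).trans (hA x)
  set d := ‖fderiv ℝ f x‖ with hd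
  have hd0 : 0 ≤ d := norm_nonneg _
  have key : ∀ h : ℝ, 0 < h → d * h ≤ 2 * A + B * h ^ 2 := by
    intro h hh
    have : d ≤ (2 * A + B * h ^ 2) / h := by
      refine ContinuousLinearMap.opNorm_le_of_unit_norm (𝕜 := ℝ) (by positivity) fun u hu => ?_
      have hmv := (convex_closedBall x h).norm_image_sub_le_of_norm_hasFDerivWithin_le
        (f := fun y => f y - fderiv ℝ f x y) (f' := fun y => fderiv ℝ f y - fderiv ℝ f x)
        (C := B * h) (x := x) (y := x + h • u) (fun y _ =>
          ((hf y).hasFDerivAt.sub (fderiv ℝ f x).hasFDerivAt).hasFDerivWithinAt)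
        (fun y hy => (hB x y).trans (by
          rw [mem_closedBall_iff_norm] at hy
          gcongr)) (Metric.mem_closedBall_self hh.le) (by
          simp [norm_smul, hu, abs_of_pos hh])
      have e1 : f (x + h • u) - fderiv ℝ f x (x + h • u) - (f x - fderiv ℝ f x x)
          = f (x + h • u) - f x - h • fderiv ℝ f x u := by
        rw [map_add, map_smul]; abel
      have e2 : ‖x + h • u - x‖ = h := by simp [norm_smul, hu, abs_of_pos hh]
      rw [e1, e2] at hmv
      have h3 : ‖h • fderiv ℝ f x u‖ ≤ 2 * A + B * h ^ 2 := by
        calc ‖h • fderiv ℝ f x u‖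
            = ‖(f (x + h • u) - f x) - (f (x + h • u) - f x - h • fderiv ℝ f x u)‖ := by
              congr 1; abel
          _ ≤ ‖f (x + h • u) - f x‖ + ‖f (x + h • u) - f x - h • fderiv ℝ f x u‖ := norm_sub_le _ _
          _ ≤ (A + A) + B * h * h := by
              gcongr
              exact (norm_sub_le _ _).trans (add_le_add (hA _) (hA _))
          _ = _ := by ring
      rw [norm_smul, Real.norm_of_nonneg hh.le] at h3
      rw [le_div_iff₀ hh]
      linarith
    rwa [le_div_iff₀ hh] at this
  rcases hd0.eq_or_lt with h0 | h0
  · rw [← h0, zero_pow two_ne_zero]; positivity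
  rcases hB0.eq_or_lt with h1 | h1
  · exfalso
    have := key ((2 * A + 1) / d) (by positivity)
    rw [← h1, mul_div_cancel₀ _ h0.ne'] at this
    linarith
  · have := key (d / (2 * B)) (by positivity)
    have e : B * (d / (2 * B)) ^ 2 = d ^ 2 / (4 * B) := by field_simp; ring
    have e' : d * (d / (2 * B)) = 2 * (d ^ 2 / (4 * B)) := by field_simp; ring
    rw [e, e'] at this
    have h2 : d ^ 2 / (4 * B) ≤ 2 * A := by linarith
    rw [div_le_iff₀ (by positivity)] at h2
    nlinarith [mul_nonneg hA0 hB0]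

set_option synthInstance.maxHeartbeats 200000 in
/-- Landau's inequality for three consecutive derivatives. -/
lemma sq_norm_iteratedFDeriv_le {f : E → F} {k : ℕ} {A B : ℝ} (hf : ContDiff ℝ (k + 2 : ℕ) f)
    (hA : ∀ x, ‖iteratedFDeriv ℝ k f x‖ ≤ A) (hB : ∀ x, ‖iteratedFDeriv ℝ (k + 2) f x‖ ≤ B)
    (x : E) : ‖iteratedFDeriv ℝ (k + 1) f x‖ ^ 2 ≤ 3 ^ 2 * (A * B) := by
  have hB0 : 0 ≤ B := (norm_nonneg _).trans (hB x)
  have hd : Differentiable ℝ (iteratedFDeriv ℝ k f) :=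
    hf.differentiable_iteratedFDeriv (by exact_mod_cast (by omega : k < k + 2))
  have hd' : Differentiable ℝ (iteratedFDeriv ℝ (k + 1) f) :=
    hf.differentiable_iteratedFDeriv (by exact_mod_cast (by omega : k + 1 < k + 2))
  have h := sq_norm_fderiv_le hd hA hB0 (fun y z => ?_) x
  · rwa [norm_fderiv_iteratedFDeriv] at h
  · have hmv := (convex_univ (𝕜 := ℝ) (E := E)).norm_image_sub_le_of_norm_fderiv_le
      (f := iteratedFDeriv ℝ (k + 1) f) (C := B) (x := y) (y := z) (fun w _ => hd' w)
      (fun w _ => by rw [norm_fderiv_iteratedFDeriv]; exact hB w) (mem_univ _) (mem_univ _)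
    refine le_trans (le_of_eq ?_) hmv
    rw [fderiv_iteratedFDeriv]
    simp only [Function.comp_apply]
    rw [← dist_eq_norm, LinearIsometryEquiv.dist_map, dist_eq_norm]

end Landau

/-! ### Estimates for compositions in one chart -/

section LocalModel

universe u

variable {E : Type u} [NormedAddCommGroup E] [NormedSpace ℝ E] [FiniteDimensional ℝ E]

/-- What the estimates use about the exponential map in a chart: `X (x, v)` stands for the
exponential of the vector `v` at `x`, and `G ((x, v), b) + v` for the vector at `x` with the same
exponential as the vector `b` at `X (x, v)`. -/
structure IsLocalModel (x₀ : E) (r : ℝ) (O : Set E) (X : E × E → E) (G : (E × E) × E → E) :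
    Prop where
  pos : 0 < r
  mapsTo : ∀ x ∈ Metric.ball x₀ r, ∀ v ∈ Metric.ball (0 : E) r, X (x, v) ∈ O
  smooth_X : ContDiffOn ℝ ∞ X (Metric.ball x₀ r ×ˢ Metric.ball 0 r)
  smooth_G : ContDiffOn ℝ ∞ G ((Metric.ball x₀ r ×ˢ Metric.ball 0 r) ×ˢ Metric.ball 0 r)
  X_zero : ∀ x ∈ Metric.ball x₀ r, X (x, 0) = x
  G_zero_right : ∀ x ∈ Metric.ball x₀ r, ∀ v ∈ Metric.ball (0 : E) r, G ((x, v), 0) = 0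
  G_zero_left : ∀ x ∈ Metric.ball x₀ r, ∀ b ∈ Metric.ball (0 : E) r, G ((x, 0), b) = b

namespace IsLocalModel

variable {x₀ : E} {r : ℝ} {O : Set E} {X : E × E → E} {G : (E × E) × E → E}

/-- The partial derivative of `G ((x, v), b)` with respect to `v`. -/
noncomputable def dG₁ (G : (E × E) × E → E) (p : (E × E) × E) : E →L[ℝ] E :=
  (fderiv ℝ G p).comp
    ((ContinuousLinearMap.inl ℝ (E × E) E).comp (ContinuousLinearMap.inr ℝ E E))

/-- The partial derivative of `G ((x, v), b)` with respect to `b`. -/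
noncomputable def dG₂ (G : (E × E) × E → E) (p : (E × E) × E) : E →L[ℝ] E :=
  (fderiv ℝ G p).comp (ContinuousLinearMap.inr ℝ (E × E) E)

/-- The partial derivative of `X (x, v)` with respect to `v`. -/
noncomputable def dX (X : E × E → E) (p : E × E) : E →L[ℝ] E :=
  (fderiv ℝ X p).comp (ContinuousLinearMap.inr ℝ E E)

lemma isOpen_domX : IsOpen (Metric.ball x₀ r ×ˢ Metric.ball (0 : E) r) :=
  Metric.isOpen_ball.prod Metric.isOpen_ball

lemma isOpen_domG :
    IsOpen ((Metric.ball x₀ r ×ˢ Metric.ball (0 : E) r) ×ˢ Metric.ball (0 : E) r) :=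
  isOpen_domX.prod Metric.isOpen_ball

lemma smul_mem_ball {b : E} (hb : b ∈ Metric.ball (0 : E) r) {t : ℝ} (ht : t ∈ Icc (0 : ℝ) 1) :
    t • b ∈ Metric.ball (0 : E) r := by
  rw [mem_ball_zero_iff] at hb ⊢
  rw [norm_smul, Real.norm_of_nonneg ht.1]
  exact (mul_le_of_le_one_left (norm_nonneg _) ht.2).trans_lt hb

lemma smul_mem_closedBall {b : E} (hb : b ∈ Metric.closedBall (0 : E) r) {t : ℝ}
    (ht : t ∈ Icc (0 : ℝ) 1) : t • b ∈ Metric.closedBall (0 : E) r := by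
  rw [mem_closedBall_zero_iff] at hb ⊢
  rw [norm_smul, Real.norm_of_nonneg ht.1]
  exact (mul_le_of_le_one_left (norm_nonneg _) ht.2).trans hb

lemma isCompact_domX :
    IsCompact (Metric.closedBall x₀ (r / 2) ×ˢ Metric.closedBall (0 : E) (r / 2)) :=
  have : ProperSpace E := FiniteDimensional.proper ℝ E
  (isCompact_closedBall _ _).prod (isCompact_closedBall _ _)

lemma isCompact_domG : IsCompact ((Metric.closedBall x₀ (r / 2) ×ˢ
    Metric.closedBall (0 : E) (r / 2)) ×ˢ Metric.closedBall (0 : E) (r / 2)) :=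
  have : ProperSpace E := FiniteDimensional.proper ℝ E
  isCompact_domX.prod (isCompact_closedBall _ _)

variable (hm : IsLocalModel x₀ r O X G)
include hm

lemma closedBall_subset (y : E) : Metric.closedBall y (r / 2) ⊆ Metric.ball y r :=
  Metric.closedBall_subset_ball (by linarith [hm.pos])

lemma domX_subset : Metric.closedBall x₀ (r / 2) ×ˢ Metric.closedBall (0 : E) (r / 2) ⊆
    Metric.ball x₀ r ×ˢ Metric.ball (0 : E) r :=
  prod_mono (hm.closedBall_subset _) (hm.closedBall_subset _)

lemma domG_subset : (Metric.closedBall x₀ (r / 2) ×ˢ Metric.closedBall (0 : E) (r / 2)) ×ˢ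
    Metric.closedBall (0 : E) (r / 2) ⊆
    (Metric.ball x₀ r ×ˢ Metric.ball (0 : E) r) ×ˢ Metric.ball (0 : E) r :=
  prod_mono hm.domX_subset (hm.closedBall_subset _)

lemma smooth_dG₁ : ContDiffOn ℝ ∞ (dG₁ G)
    ((Metric.ball x₀ r ×ˢ Metric.ball 0 r) ×ˢ Metric.ball 0 r) :=
  (hm.smooth_G.fderiv_of_isOpen isOpen_domG (m := ∞) (by simp)).clm_comp contDiffOn_const

lemma smooth_dG₂ : ContDiffOn ℝ ∞ (dG₂ G)
    ((Metric.ball x₀ r ×ˢ Metric.ball 0 r) ×ˢ Metric.ball 0 r) :=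
  (hm.smooth_G.fderiv_of_isOpen isOpen_domG (m := ∞) (by simp)).clm_comp contDiffOn_const

lemma smooth_dX : ContDiffOn ℝ ∞ (dX X) (Metric.ball x₀ r ×ˢ Metric.ball 0 r) :=
  (hm.smooth_X.fderiv_of_isOpen isOpen_domX (m := ∞) (by simp)).clm_comp contDiffOn_const

lemma hasFDerivAt_G {p : (E × E) × E}
    (hp : p ∈ (Metric.ball x₀ r ×ˢ Metric.ball (0 : E) r) ×ˢ Metric.ball (0 : E) r) :
    HasFDerivAt G (fderiv ℝ G p) p :=
  ((hm.smooth_G.contDiffAt (isOpen_domG.mem_nhds hp)).differentiableAt (by simp)).hasFDerivAt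

lemma hasFDerivAt_G_left {x v b : E} (hx : x ∈ Metric.ball x₀ r) (hv : v ∈ Metric.ball (0 : E) r)
    (hb : b ∈ Metric.ball (0 : E) r) :
    HasFDerivAt (fun v => G ((x, v), b)) (dG₁ G ((x, v), b)) v := by
  have h1 := hm.hasFDerivAt_G (p := ((x, v), b)) ⟨⟨hx, hv⟩, hb⟩
  have h2 : HasFDerivAt (fun v : E => (x, v)) (ContinuousLinearMap.inr ℝ E E) v :=
    hasFDerivAt_prodMk_right x v
  have h3 : HasFDerivAt (fun z : E × E => (z, b)) (ContinuousLinearMap.inl ℝ (E × E) E) (x, v) :=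
    hasFDerivAt_prodMk_left (x, v) b
  exact h1.comp v (h3.comp v h2)

lemma hasFDerivAt_X {x v : E} (hx : x ∈ Metric.ball x₀ r) (hv : v ∈ Metric.ball (0 : E) r) :
    HasFDerivAt (fun v => X (x, v)) (dX X (x, v)) v := by
  have h1 : HasFDerivAt X (fderiv ℝ X (x, v)) (x, v) :=
    ((hm.smooth_X.contDiffAt (isOpen_domX.mem_nhds ⟨hx, hv⟩)).differentiableAt (by simp)).hasFDerivAt
  have h2 : HasFDerivAt (fun v : E => (x, v)) (ContinuousLinearMap.inr ℝ E E) v :=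
    hasFDerivAt_prodMk_right x v
  exact h1.comp v h2

/-- As `G (·, 0)` vanishes, so does its derivative in `v`. -/
lemma dG₁_zero {x v : E} (hx : x ∈ Metric.ball x₀ r) (hv : v ∈ Metric.ball (0 : E) r) :
    dG₁ G ((x, v), 0) = 0 := by
  have h1 := hm.hasFDerivAt_G_left hx hv (Metric.mem_ball_self hm.pos)
  have h2 : (fun v => G ((x, v), 0)) =ᶠ[𝓝 v] fun _ => 0 := by
    filter_upwards [Metric.isOpen_ball.mem_nhds hv] with w hw using hm.G_zero_right x hx w hw
  exact h1.unique ((hasFDerivAt_const (0 : E) v).congr_of_eventuallyEq h2)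

set_option maxHeartbeats 2000000 in
/-- The derivative of `G` in `v` is of the size of `b`. -/
lemma exists_norm_dG₁_le : ∃ C, 1 ≤ C ∧ ∀ x ∈ Metric.closedBall x₀ (r / 2),
    ∀ v ∈ Metric.closedBall (0 : E) (r / 2), ∀ b ∈ Metric.closedBall (0 : E) (r / 2),
    ‖dG₁ G ((x, v), b)‖ ≤ C * ‖b‖ := by
  obtain ⟨M, hM1, hM⟩ := exists_growthAt_of_isCompact isOpen_domG
    (hm.smooth_dG₁.fderiv_of_isOpen isOpen_domG (m := ∞) (by simp)) isCompact_domG hm.domG_subset 0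
  refine ⟨2 ^ 0 * (faaConst 0 1 * M), ?_, fun x hx v hv b hb => ?_⟩
  · have := one_le_faaConst 0 (le_refl (1 : ℝ)); nlinarith
  have h1 : DerivGrowthAt 0 1 1 (fun _ : E => (x, v)) 0 :=
    ⟨contDiffAt_const, fun k h1 h2 => by omega⟩
  have h2 : DerivGrowthAt 0 1 1 (fun _ : E => b) 0 :=
    ⟨contDiffAt_const, fun k h1 h2 => by omega⟩
  have h3 : GrowthAt 0 ‖b‖ 1 (fun _ : E => b) 0 := by
    refine ⟨contDiffAt_const, fun k h2 => ?_⟩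
    obtain rfl : k = 0 := by omega
    simp
  have h4 : ∀ t ∈ Icc (0 : ℝ) 1, GrowthAt 0 M 1 (fderiv ℝ (dG₁ G)) ((x, v), t • b) :=
    fun t ht => hM ((x, v), t • b) ⟨⟨hx, hv⟩, smul_mem_closedBall hb ht⟩ 1 le_rfl
  have h5 := GrowthAt.comp_of_vanishing (E := E) (R := 0) (A := ‖b‖) (C := 1) (M := M) (l := 1)
    (Z := E × E) (B := E) (G := E →L[ℝ] E) (Φ := dG₁ G)
    (Ω := (Metric.ball x₀ r ×ˢ Metric.ball (0 : E) r) ×ˢ Metric.ball (0 : E) r)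
    (ζ := fun _ => (x, v)) (b := fun _ => b) (x := 0)
    le_rfl le_rfl isOpen_domG (fun z b hzb t ht => ⟨hzb.1, smul_mem_ball hzb.2 ht⟩)
    hm.smooth_dG₁ (fun z hz => hm.dG₁_zero hz.1.1 hz.1.2) (hm.domG_subset ⟨⟨hx, hv⟩, hb⟩)
    h4 h1 h2 h3
  exact h5.norm_le

/-- The estimates of order zero: `X (x, v)` is close to `x`, and `G ((x, v), b)` is close to `b`. -/
theorem exists_norm_sub_le : ∃ C, 1 ≤ C ∧ ∀ x ∈ Metric.closedBall x₀ (r / 2),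
    ∀ v ∈ Metric.closedBall (0 : E) (r / 2), ‖X (x, v) - x‖ ≤ C * ‖v‖ ∧
      ∀ b ∈ Metric.closedBall (0 : E) (r / 2), ‖G ((x, v), b) - b‖ ≤ C * (‖v‖ * ‖b‖) := by
  obtain ⟨C, hC1, hC⟩ := hm.exists_norm_dG₁_le
  obtain ⟨M, hM1, hM⟩ := exists_growthAt_of_isCompact isOpen_domX hm.smooth_dX isCompact_domX
    hm.domX_subset 0
  have h00 : (0 : E) ∈ Metric.closedBall (0 : E) (r / 2) :=
    Metric.mem_closedBall_self (by linarith [hm.pos])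
  refine ⟨max C M, le_max_of_le_left hC1, fun x hx v hv => ⟨?_, fun b hb => ?_⟩⟩
  · have h := (convex_closedBall (0 : E) (r / 2)).norm_image_sub_le_of_norm_hasFDerivWithin_le
      (f := fun v => X (x, v)) (f' := fun v => dX X (x, v)) (C := M) (x := 0) (y := v)
      (fun w hw => (hm.hasFDerivAt_X (hm.closedBall_subset _ hx)
        (hm.closedBall_subset _ hw)).hasFDerivWithinAt)
      (fun w hw => (hM (x, w) ⟨hx, hw⟩ 1 le_rfl).norm_le) h00 hv
    rw [hm.X_zero x (hm.closedBall_subset _ hx), sub_zero] at h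
    exact h.trans (by gcongr; exact le_max_right _ _)
  · have h := (convex_closedBall (0 : E) (r / 2)).norm_image_sub_le_of_norm_hasFDerivWithin_le
      (f := fun v => G ((x, v), b)) (f' := fun v => dG₁ G ((x, v), b)) (C := C * ‖b‖) (x := 0)
      (y := v) (fun w hw => (hm.hasFDerivAt_G_left (hm.closedBall_subset _ hx)
        (hm.closedBall_subset _ hw) (hm.closedBall_subset _ hb)).hasFDerivWithinAt)
      (fun w hw => hC x hx w hw b hb) h00 hv
    rw [hm.G_zero_left x (hm.closedBall_subset _ hx) b (hm.closedBall_subset _ hb), sub_zero] at h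
    refine h.trans ?_
    rw [mul_assoc, mul_comm ‖b‖]
    gcongr
    exact le_max_left _ _

/-- The estimates are integrated along the curve `t ↦ (y, t V y)` from `(y, 0)` to `(y, V y)`. -/
lemma growthAt_zeta {R : ℕ} {B l : ℝ} (hB : 1 ≤ B) (hl : 1 ≤ l) {V : E → E} {x : E}
    (hV : DerivGrowthAt R B l V x) {t : ℝ} (ht : t ∈ Icc (0 : ℝ) 1) :
    DerivGrowthAt R B l (fun y => (y, t • V y)) x :=
  ((derivGrowthAt_id hl).mono (by linarith) hB).prodMk (hV.const_smul ht)

set_option maxHeartbeats 2000000 in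
/-- The first tame estimate: derivatives of `w` up to order `R` suffice. -/
theorem exists_growthAt (R : ℕ) {B : ℝ} (hB : 1 ≤ B) :
    ∃ C, 0 ≤ C ∧ ∀ (V W : E → E) (A l : ℝ) (x : E),
    1 ≤ l → A ≤ B → x ∈ Metric.closedBall x₀ (r / 2) → V x ∈ Metric.closedBall (0 : E) (r / 2) →
    DerivGrowthAt R B l V x → GrowthAt R A l W x → GrowthAt R A l W (X (x, V x)) →
    W (X (x, V x)) ∈ Metric.closedBall (0 : E) (r / 2) →
    GrowthAt R (C * A) l (fun y => G ((y, V y), W (X (y, V y))) - W y) x := by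
  obtain ⟨M, hM1, hM⟩ := exists_growthAt_of_isCompact isOpen_domX hm.smooth_X isCompact_domX
    hm.domX_subset R
  obtain ⟨M', hM'1, hM'⟩ := exists_growthAt_of_isCompact isOpen_domG
    (hm.smooth_G.fderiv_of_isOpen isOpen_domG (m := ∞) (by simp)) isCompact_domG hm.domG_subset R
  have hF1 := one_le_faaConst R hB
  set c₁ := faaConst R B * M with hc₁
  have hc₁1 : 1 ≤ c₁ := by nlinarith
  have hF2 := one_le_faaConst R hc₁1
  set c₂ := faaConst R c₁ with hc₂
  have hcB : 1 ≤ c₂ * B := by nlinarith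
  have hcB' : B ≤ c₂ * B := by nlinarith
  have hF3 := one_le_faaConst R hcB
  refine ⟨2 ^ R * (faaConst R (c₂ * B) * M') * c₂ + 1, by positivity,
    fun V W A l x hl hAB hx hVx hV hWx hWY hWb => ?_⟩
  have hA : 0 ≤ A := (norm_nonneg _).trans hWx.norm_le
  have hl0 : 0 ≤ l := by linarith
  have hζ : DerivGrowthAt R B l (fun y => (y, V y)) x := by
    simpa using hm.growthAt_zeta hB hl hV (t := 1) (by simp)
  have hY : GrowthAt R c₁ l (fun y => X (y, V y)) x :=
    GrowthAt.comp (f := fun y => (y, V y)) hl hB (hM (x, V x) ⟨hx, hVx⟩ l hl) hζ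
  have hb : GrowthAt R (c₂ * A) l (fun y => W (X (y, V y))) x :=
    GrowthAt.comp (f := fun y => X (y, V y)) hl hc₁1 hWY hY.derivGrowthAt
  have hM'' : ∀ t ∈ Icc (0 : ℝ) 1,
      GrowthAt R M' l (fderiv ℝ G) ((x, V x), t • W (X (x, V x))) :=
    fun t ht => hM' ((x, V x), t • W (X (x, V x)))
      ⟨⟨hx, hVx⟩, smul_mem_closedBall hWb ht⟩ l hl
  have hG := GrowthAt.comp_of_vanishing (E := E) (R := R) (A := c₂ * A) (C := c₂ * B) (M := M')
    (l := l) (Z := E × E) (B := E) (G := E) (Φ := G)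
    (Ω := (Metric.ball x₀ r ×ˢ Metric.ball (0 : E) r) ×ˢ Metric.ball (0 : E) r)
    (ζ := fun y => (y, V y)) (b := fun y => W (X (y, V y))) (x := x) hl hcB isOpen_domG
    (fun z b hzb t ht => ⟨hzb.1, smul_mem_ball hzb.2 ht⟩)
    hm.smooth_G (fun z hz => hm.G_zero_right _ hz.1.1 _ hz.1.2)
    (hm.domG_subset ⟨⟨hx, hVx⟩, hWb⟩) hM''
    (hζ.mono hl0 hcB') (hb.derivGrowthAt.mono hl0 (by gcongr)) hb
  refine (hG.sub hWx).mono hl0 (le_of_eq ?_)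
  ring

set_option maxHeartbeats 2000000 in
/-- The second tame estimate: it uses one more derivative of `w`, and gains a factor of the size
of `v`. It rests on the derivative of `t ↦ G ((x, t v), w (X (x, t v)))`. -/
theorem exists_norm_iteratedFDeriv_le (R : ℕ) {B : ℝ} (hB : 1 ≤ B) :
    ∃ C, 0 ≤ C ∧ ∀ (V W : E → E) (A N a D l : ℝ) (x : E),
    1 ≤ l → 0 ≤ D → x ∈ Metric.closedBall x₀ (r / 2) →
    V x ∈ Metric.closedBall (0 : E) (r / 2) →
    DerivGrowthAt R B l V x →
    (∀ k, k ≤ R → ‖iteratedFDeriv ℝ k V x‖ ≤ D * l ^ k) →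
    (∀ k, k ≤ R → ‖iteratedFDeriv ℝ k V x‖ ≤ N) →
    (∀ y ∈ O, ContDiffAt ℝ (R + 1 : ℕ) W y ∧ W y ∈ Metric.closedBall (0 : E) (r / 2) ∧
      DerivGrowthAt R B l W y ∧ GrowthAt R A l W y ∧ GrowthAt R A l (fderiv ℝ W) y ∧
      ‖W y‖ ≤ a ∧ ‖fderiv ℝ W y‖ ≤ a) →
    ∀ k ≤ R, ‖iteratedFDeriv ℝ k (fun y => G ((y, V y), W (X (y, V y))) - W y) x‖
      ≤ C * (a * N + A * D * l ^ (R - 1)) := by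
  obtain ⟨M, hM1, hM⟩ := exists_growthAt_of_isCompact isOpen_domX hm.smooth_X isCompact_domX
    hm.domX_subset R
  obtain ⟨M₁, hM₁1, hM₁⟩ := exists_growthAt_of_isCompact isOpen_domX hm.smooth_dX isCompact_domX
    hm.domX_subset R
  obtain ⟨M₂, hM₂1, hM₂⟩ := exists_growthAt_of_isCompact isOpen_domG hm.smooth_dG₂
    isCompact_domG hm.domG_subset R
  obtain ⟨M₃, hM₃1, hM₃⟩ := exists_growthAt_of_isCompact isOpen_domG
    (hm.smooth_dG₁.fderiv_of_isOpen isOpen_domG (m := ∞) (by simp)) isCompact_domG hm.domG_subset R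
  obtain ⟨c₀, hc₀1, hc₀⟩ := hm.exists_norm_dG₁_le
  have hF1 := one_le_faaConst R hB
  set c₁ := faaConst R B * M with hc₁
  have hc₁1 : 1 ≤ c₁ := by nlinarith
  have hF2 := one_le_faaConst R hc₁1
  set c₂ := faaConst R c₁ with hc₂
  have hcB : 1 ≤ c₂ * B := by nlinarith
  have hcB' : B ≤ c₂ * B := by nlinarith
  have hF3 := one_le_faaConst R hcB
  -- the constants for the two terms of the derivative
  set k₁ := 2 ^ R * (faaConst R (c₂ * B) * M₃) * c₂ with hk₁
  set k₂ := 2 ^ R * (faaConst R (c₂ * B) * M₂) * (2 ^ R * c₂ * (faaConst R B * M₁)) with hk₂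
  have hk₁0 : 0 ≤ k₁ := by positivity
  have hk₂0 : 0 ≤ k₂ := by positivity
  refine ⟨(c₀ + M₂ * M₁) + 2 ^ R * (k₁ + k₂), by positivity,
    fun V W A N a D l x hl hD hx hVx hV hVD hVN hW k hk => ?_⟩
  have hl0 : 0 ≤ l := by linarith
  have hxr := hm.closedBall_subset _ hx
  have hVr := hm.closedBall_subset _ hVx
  have hYO : ∀ t ∈ Icc (0 : ℝ) 1, X (x, t • V x) ∈ O := fun t ht =>
    hm.mapsTo _ hxr _ (smul_mem_ball hVr ht)
  have hA : 0 ≤ A := (norm_nonneg _).trans (hW _ (hYO 0 (by simp))).2.2.2.1.norm_le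
  have ha : 0 ≤ a := (norm_nonneg _).trans (hW _ (hYO 0 (by simp))).2.2.2.2.2.1
  have hN : 0 ≤ N := (norm_nonneg _).trans (hVN 0 (Nat.zero_le _))
  obtain ⟨U, hU, hUo, hxU⟩ := eventually_nhds_iff.1
    ((hV.1.eventually (by simp)).and ((hV.1.continuousAt.eventually
      (Metric.isOpen_ball.mem_nhds hVr)).and (Metric.isOpen_ball.mem_nhds hxr)))
  -- the derivative of `t ↦ G ((y, t V y), W (X (y, t V y)))` is `Q (t, y) (V y)`
  set Q : ℝ × E → E →L[ℝ] E := fun p =>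
    dG₁ G ((p.2, p.1 • V p.2), W (X (p.2, p.1 • V p.2))) +
      (dG₂ G ((p.2, p.1 • V p.2), W (X (p.2, p.1 • V p.2)))).comp
        ((fderiv ℝ W (X (p.2, p.1 • V p.2))).comp (dX X (p.2, p.1 • V p.2))) with hQ
  have hmem : ∀ t ∈ Icc (0 : ℝ) 1, ∀ y ∈ U, y ∈ Metric.ball x₀ r ∧ t • V y ∈ Metric.ball (0 : E) r ∧
      X (y, t • V y) ∈ O ∧ W (X (y, t • V y)) ∈ Metric.ball (0 : E) r := by
    intro t ht y hy
    obtain ⟨h1, h2, h3⟩ := hU y hy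
    have h4 := smul_mem_ball h2 ht
    have h5 := hm.mapsTo y h3 _ h4
    exact ⟨h3, h4, h5, hm.closedBall_subset _ (hW _ h5).2.1⟩
  have hmv := contDiffAt_sub_and_norm_le (R := R) hUo hxU
    (F := fun t y => G ((y, t • V y), W (X (y, t • V y))) - W y)
    (f := fun p => Q p (V p.2)) ?_ ?_
  · have heq : (fun y => G ((y, V y), W (X (y, V y))) - W y) =ᶠ[𝓝 x]
        fun y => (G ((y, (1 : ℝ) • V y), W (X (y, (1 : ℝ) • V y))) - W y) -
          (G ((y, (0 : ℝ) • V y), W (X (y, (0 : ℝ) • V y))) - W y) := by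
      filter_upwards [hUo.mem_nhds hxU] with y hy
      obtain ⟨h1, h2, h3, h4⟩ := hmem 0 (by simp) y hy
      rw [zero_smul] at h3 h4
      rw [hm.X_zero y h1] at h4
      rw [zero_smul, one_smul, hm.X_zero y h1, hm.G_zero_left y h1 _ h4, sub_self, sub_zero]
    rw [(heq.iteratedFDeriv ℝ k).eq_of_nhds]
    refine hmv.2 k hk _ fun t ht => ?_
    have hVt := smul_mem_closedBall hVx ht
    obtain ⟨w1, w2, w3, w4, w5, w6, w7⟩ := hW _ (hYO t ht)
    have hζ := hm.growthAt_zeta hB hl hV ht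
    have hY : GrowthAt R c₁ l (fun y => X (y, t • V y)) x :=
      GrowthAt.comp (f := fun y => (y, t • V y)) hl hB (hM (x, t • V x) ⟨hx, hVt⟩ l hl) hζ
    have hb : GrowthAt R (c₂ * A) l (fun y => W (X (y, t • V y))) x :=
      GrowthAt.comp (f := fun y => X (y, t • V y)) hl hc₁1 w4 hY.derivGrowthAt
    have hbB : DerivGrowthAt R (c₂ * B) l (fun y => W (X (y, t • V y))) x := by
      -- the derivative bounds do not see the value of `W` at the point
      have h1 : GrowthAt R B l (fun y => W y - W (X (x, t • V x))) (X (x, t • V x)) := by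
        refine DerivGrowthAt.growthAt ⟨w3.1.sub contDiffAt_const, fun j h1 hj => ?_⟩ ?_
        · have hj' : (j : WithTop ℕ∞) ≤ R := by exact_mod_cast hj
          have h2 := iteratedFDeriv_sub_apply (i := j) (w3.1.of_le hj')
            (contDiffAt_const (c := W (X (x, t • V x))))
          rw [show (fun y => W y - W (X (x, t • V x))) = W - fun _ => W (X (x, t • V x)) from rfl,
            h2, iteratedFDeriv_const_of_ne (by omega), Pi.zero_apply, sub_zero]
          exact w3.2 j h1 hj
        · simp; linarith
      have h2 : GrowthAt R (c₂ * B) l (fun y => W (X (y, t • V y)) - W (X (x, t • V x))) x :=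
        GrowthAt.comp (f := fun y => X (y, t • V y)) hl hc₁1 h1 hY.derivGrowthAt
      refine ⟨hb.1, fun j h1 hj => ?_⟩
      have hj' : (j : WithTop ℕ∞) ≤ R := by exact_mod_cast hj
      have h3 := iteratedFDeriv_sub_apply (i := j) (hb.1.of_le hj')
        (contDiffAt_const (c := W (X (x, t • V x))))
      have h4 := h2.2 j hj
      rw [show (fun y => W (X (y, t • V y)) - W (X (x, t • V x))) =
        (fun y => W (X (y, t • V y))) - fun _ => W (X (x, t • V x)) from rfl,
        h3, iteratedFDeriv_const_of_ne (by omega), Pi.zero_apply, sub_zero] at h4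
      exact h4
    have g1 : GrowthAt R (k₁ * A) l
        (fun y => dG₁ G ((y, t • V y), W (X (y, t • V y)))) x := by
      have hM₃' : ∀ s ∈ Icc (0 : ℝ) 1,
          GrowthAt R M₃ l (fderiv ℝ (dG₁ G)) ((x, t • V x), s • W (X (x, t • V x))) :=
        fun s hs => hM₃ ((x, t • V x), s • W (X (x, t • V x)))
          ⟨⟨hx, hVt⟩, smul_mem_closedBall w2 hs⟩ l hl
      refine (GrowthAt.comp_of_vanishing (E := E) (R := R) (A := c₂ * A) (C := c₂ * B) (M := M₃)
        (l := l) (Z := E × E) (B := E) (G := E →L[ℝ] E) (Φ := dG₁ G)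
        (Ω := (Metric.ball x₀ r ×ˢ Metric.ball (0 : E) r) ×ˢ Metric.ball (0 : E) r)
        (ζ := fun y => (y, t • V y)) (b := fun y => W (X (y, t • V y))) (x := x)
        hl hcB isOpen_domG (fun z b hzb t ht => ⟨hzb.1, smul_mem_ball hzb.2 ht⟩)
        hm.smooth_dG₁ (fun z hz => hm.dG₁_zero hz.1.1 hz.1.2)
        (hm.domG_subset ⟨⟨hx, hVt⟩, w2⟩) hM₃'
        (hζ.mono hl0 hcB') hbB hb).mono hl0 (le_of_eq ?_)
      rw [hk₁]; ring
    have g2 : GrowthAt R (faaConst R (c₂ * B) * M₂) l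
        (fun y => dG₂ G ((y, t • V y), W (X (y, t • V y)))) x :=
      GrowthAt.comp (f := fun y => ((y, t • V y), W (X (y, t • V y)))) hl hcB
        (hM₂ _ ⟨⟨hx, hVt⟩, w2⟩ l hl) ((hζ.mono hl0 hcB').prodMk hbB)
    have g3 : GrowthAt R (c₂ * A) l (fun y => fderiv ℝ W (X (y, t • V y))) x :=
      GrowthAt.comp (f := fun y => X (y, t • V y)) hl hc₁1 w5 hY.derivGrowthAt
    have g4 : GrowthAt R (faaConst R B * M₁) l (fun y => dX X (y, t • V y)) x :=
      GrowthAt.comp (f := fun y => (y, t • V y)) hl hB (hM₁ (x, t • V x) ⟨hx, hVt⟩ l hl) hζ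
    have hcomp : ‖ContinuousLinearMap.compL ℝ E E E‖ ≤ 1 :=
      ContinuousLinearMap.norm_compL_le ℝ E E E
    have g5 := g2.bilinear _ hcomp hl (g3.bilinear _ hcomp hl g4)
    have gQ : GrowthAt R ((k₁ + k₂) * A) l (fun y => Q (t, y)) x := by
      refine (g1.add g5).mono hl0 (le_of_eq ?_)
      rw [hk₂]; ring
    have hQa : ‖Q (t, x)‖ ≤ (c₀ + M₂ * M₁) * a := by
      have q1 := hc₀ x hx _ hVt _ w2
      have q2 := (hM₂ ((x, t • V x), W (X (x, t • V x))) ⟨⟨hx, hVt⟩, w2⟩ 1 le_rfl).norm_le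
      have q3 := (hM₁ (x, t • V x) ⟨hx, hVt⟩ 1 le_rfl).norm_le
      calc ‖Q (t, x)‖ ≤ c₀ * a + M₂ * (a * M₁) := by
            refine (norm_add_le _ _).trans (add_le_add (q1.trans (by gcongr)) ?_)
            refine (ContinuousLinearMap.opNorm_comp_le _ _).trans ?_
            refine mul_le_mul q2 ?_ (norm_nonneg _) (by linarith)
            refine (ContinuousLinearMap.opNorm_comp_le _ _).trans ?_
            exact mul_le_mul w7 q3 (norm_nonneg _) ha
        _ = _ := by ring
    refine (norm_iteratedFDeriv_clm_apply_le hl gQ hQa hV.1 hD hVD hVN hk).trans ?_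
    have p1 : 0 ≤ a * N := by positivity
    have p2 : 0 ≤ A * D * l ^ (R - 1) := by positivity
    have p3 : 0 ≤ c₀ + M₂ * M₁ := by positivity
    have p4 : 0 ≤ 2 ^ R * (k₁ + k₂) := by positivity
    nlinarith [mul_nonneg p3 p2, mul_nonneg p4 p1]
  · intro t ht y hy
    obtain ⟨m1, m2, m3, m4⟩ := hmem t ht y hy
    have hV' : ContDiffAt ℝ R (fun p : ℝ × E => V p.2) (t, y) :=
      ContDiffAt.comp (g := V) (f := Prod.snd) (t, y) (hU y hy).1 contDiffAt_snd
    have hζ' : ContDiffAt ℝ R (fun p : ℝ × E => (p.2, p.1 • V p.2)) (t, y) :=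
      contDiffAt_snd.prodMk (contDiffAt_fst.smul hV')
    have le_top' : (R : WithTop ℕ∞) ≤ ∞ := by exact_mod_cast le_top
    have hY' : ContDiffAt ℝ R (fun p : ℝ × E => X (p.2, p.1 • V p.2)) (t, y) :=
      ContDiffAt.comp (g := X) (f := fun p : ℝ × E => (p.2, p.1 • V p.2)) (t, y)
        ((hm.smooth_X.contDiffAt (isOpen_domX.mem_nhds ⟨m1, m2⟩)).of_le le_top') hζ'
    have hdX' : ContDiffAt ℝ R (fun p : ℝ × E => dX X (p.2, p.1 • V p.2)) (t, y) :=
      ContDiffAt.comp (g := dX X) (f := fun p : ℝ × E => (p.2, p.1 • V p.2)) (t, y)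
        ((hm.smooth_dX.contDiffAt (isOpen_domX.mem_nhds ⟨m1, m2⟩)).of_le le_top') hζ'
    have hW1 := (hW _ m3).1
    have hb' : ContDiffAt ℝ R (fun p : ℝ × E => W (X (p.2, p.1 • V p.2))) (t, y) :=
      ContDiffAt.comp (g := W) (f := fun p : ℝ × E => X (p.2, p.1 • V p.2)) (t, y)
        (hW1.of_le (by exact_mod_cast Nat.le_succ R)) hY'
    have hdW' : ContDiffAt ℝ R (fun p : ℝ × E => fderiv ℝ W (X (p.2, p.1 • V p.2))) (t, y) :=
      ContDiffAt.comp (g := fderiv ℝ W) (f := fun p : ℝ × E => X (p.2, p.1 • V p.2)) (t, y)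
        (hW1.fderiv_right (by norm_cast)) hY'
    have hin := hζ'.prodMk hb'
    have hdG₁' : ContDiffAt ℝ R
        (fun p : ℝ × E => dG₁ G ((p.2, p.1 • V p.2), W (X (p.2, p.1 • V p.2)))) (t, y) :=
      ContDiffAt.comp (g := dG₁ G)
        (f := fun p : ℝ × E => ((p.2, p.1 • V p.2), W (X (p.2, p.1 • V p.2)))) (t, y)
        ((hm.smooth_dG₁.contDiffAt (isOpen_domG.mem_nhds ⟨⟨m1, m2⟩, m4⟩)).of_le le_top') hin
    have hdG₂' : ContDiffAt ℝ R
        (fun p : ℝ × E => dG₂ G ((p.2, p.1 • V p.2), W (X (p.2, p.1 • V p.2)))) (t, y) :=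
      ContDiffAt.comp (g := dG₂ G)
        (f := fun p : ℝ × E => ((p.2, p.1 • V p.2), W (X (p.2, p.1 • V p.2)))) (t, y)
        ((hm.smooth_dG₂.contDiffAt (isOpen_domG.mem_nhds ⟨⟨m1, m2⟩, m4⟩)).of_le le_top') hin
    exact (hdG₁'.add (hdG₂'.clm_comp (hdW'.clm_comp hdX'))).clm_apply hV'
  · intro t ht y hy
    obtain ⟨m1, m2, m3, m4⟩ := hmem t ht y hy
    have d1 : HasDerivAt (fun s : ℝ => s • V y) (V y) t := by
      simpa using (hasDerivAt_id t).smul_const (V y)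
    have d2 : HasDerivAt (fun s : ℝ => X (y, s • V y)) (dX X (y, t • V y) (V y)) t :=
      HasFDerivAt.comp_hasDerivAt (l := fun v => X (y, v)) (f := fun s : ℝ => s • V y) t
        (hm.hasFDerivAt_X m1 m2) d1
    have d3 : HasDerivAt (fun s : ℝ => W (X (y, s • V y)))
        (fderiv ℝ W (X (y, t • V y)) (dX X (y, t • V y) (V y))) t :=
      ((hW _ m3).1.differentiableAt (by simp)).hasFDerivAt.comp_hasDerivAt t d2
    have d4 := (hm.hasFDerivAt_G (p := ((y, t • V y), W (X (y, t • V y))))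
      ⟨⟨m1, m2⟩, m4⟩).comp_hasDerivAt t
        (((hasDerivAt_const t y).prodMk d1).prodMk d3)
    refine (d4.sub_const (W y)).congr_deriv ?_
    simp only [hQ, dG₁, dG₂, add_apply, ContinuousLinearMap.comp_apply,
      ContinuousLinearMap.inl_apply, ContinuousLinearMap.inr_apply]
    rw [← map_add]
    simp

end IsLocalModel

end LocalModel

/-! ### Vector fields in charts -/

section Charts

variable {n : ℕ} {M : Type*} [TopologicalSpace M] [ChartedSpace (EuclideanSpace ℝ (Fin n)) M]

local notation "𝔼" => EuclideanSpace ℝ (Fin n)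

variable {e h : OpenPartialHomeomorph M (EuclideanSpace ℝ (Fin n))}

lemma pushChart_of_mem {x : 𝔼} (hx : x ∈ e.target) (v : VField n M) :
    pushChart e v x = mfderiv (𝓡 n) 𝓘(ℝ, 𝔼) e (e.symm x) (v (e.symm x)) := if_pos hx

lemma pushChart_apply {m : M} (hm : m ∈ e.source) (v : VField n M) :
    pushChart e v (e m) = mfderiv (𝓡 n) 𝓘(ℝ, 𝔼) e m (v m) := by
  rw [pushChart_of_mem (e.map_source hm)]
  have h := e.left_inv hm
  generalize e.symm (e m) = m' at h
  subst h
  rfl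

lemma pushChart_add (v w : VField n M) : pushChart e (v + w) = pushChart e v + pushChart e w := by
  ext1 x
  by_cases hx : x ∈ e.target
  · rw [Pi.add_apply]
    simp only [pushChart_of_mem hx, Pi.add_apply]
    exact map_add _ _ _
  · simp [pushChart, hx]

lemma pushChart_smul (f : M → ℝ) (v : VField n M) :
    pushChart e (fun m => f m • v m) = fun x => f (e.symm x) • pushChart e v x := by
  ext1 x
  by_cases hx : x ∈ e.target
  · simp only [pushChart_of_mem hx]
    exact map_smul _ _ _
  · simp [pushChart, hx]

lemma pushChart_sum {κ : Type*} (s : Finset κ) (v : κ → VField n M) :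
    pushChart e (∑ j ∈ s, v j) = ∑ j ∈ s, pushChart e (v j) := by
  classical
  induction s using Finset.induction_on with
  | empty =>
    ext1 x
    by_cases hx : x ∈ e.target
    · simp only [Finset.sum_empty, pushChart_of_mem hx]
      exact map_zero _
    · simp [pushChart, hx]
  | insert j s hj ih => rw [Finset.sum_insert hj, Finset.sum_insert hj, pushChart_add, ih]

variable [IsManifold (𝓡 n) ∞ M]

lemma mdifferentiable_of_mem_maximalAtlas (he : e ∈ IsManifold.maximalAtlas (𝓡 n) ∞ M) :
    e.MDifferentiable (𝓡 n) (𝓡 n) :=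
  ⟨(contMDiffOn_of_mem_maximalAtlas he).mdifferentiableOn (by simp),
    (contMDiffOn_symm_of_mem_maximalAtlas he).mdifferentiableOn (by simp)⟩

/-- A change of charts. -/
def chartChange (e h : OpenPartialHomeomorph M (EuclideanSpace ℝ (Fin n))) :
    OpenPartialHomeomorph (EuclideanSpace ℝ (Fin n)) (EuclideanSpace ℝ (Fin n)) :=
  e.symm.trans h

lemma mem_chartChange_source {x : 𝔼} :
    x ∈ (chartChange e h).source ↔ x ∈ e.target ∧ e.symm x ∈ h.source := by
  simp [chartChange]

lemma contDiffOn_chartChange (he : e ∈ IsManifold.maximalAtlas (𝓡 n) ∞ M)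
    (hh : h ∈ IsManifold.maximalAtlas (𝓡 n) ∞ M) :
    ContDiffOn ℝ ∞ (chartChange e h) (chartChange e h).source := by
  rw [← contMDiffOn_iff_contDiffOn]
  have h1 := contMDiffOn_of_mem_maximalAtlas hh
  have h2 := contMDiffOn_symm_of_mem_maximalAtlas he
  exact h1.comp (h2.mono fun x hx => (mem_chartChange_source.1 hx).1)
    fun x hx => (mem_chartChange_source.1 hx).2

lemma contDiffAt_chartChange (he : e ∈ IsManifold.maximalAtlas (𝓡 n) ∞ M)
    (hh : h ∈ IsManifold.maximalAtlas (𝓡 n) ∞ M) {x : 𝔼} (hx : x ∈ (chartChange e h).source) :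
    ContDiffAt ℝ ∞ (chartChange e h) x :=
  (contDiffOn_chartChange he hh).contDiffAt ((chartChange e h).open_source.mem_nhds hx)

/-- The transformation rule of vector fields under a change of charts. -/
lemma pushChart_eq_chartChange (he : e ∈ IsManifold.maximalAtlas (𝓡 n) ∞ M)
    (hh : h ∈ IsManifold.maximalAtlas (𝓡 n) ∞ M) {x : 𝔼} (hx : x ∈ (chartChange e h).source)
    (v : VField n M) :
    pushChart h v (chartChange e h x) = fderiv ℝ (chartChange e h) x (pushChart e v x) := by
  obtain ⟨hx1, hx2⟩ := mem_chartChange_source.1 hx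
  have hd : fderiv ℝ (chartChange e h) x =
      (mfderiv (𝓡 n) 𝓘(ℝ, 𝔼) h (e.symm x)).comp (mfderiv 𝓘(ℝ, 𝔼) (𝓡 n) e.symm x) := by
    rw [← mfderiv_eq_fderiv]
    exact mfderiv_comp x ((mdifferentiable_of_mem_maximalAtlas hh).mdifferentiableAt hx2)
      ((mdifferentiable_of_mem_maximalAtlas he).mdifferentiableAt_symm hx1)
  have h2 : (chartChange e h x : 𝔼) = h (e.symm x) := rfl
  rw [h2, pushChart_apply hx2, hd, pushChart_of_mem hx1]
  have h3 := (mdifferentiable_of_mem_maximalAtlas he).symm_comp_deriv (e.map_target hx1)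
  have h4 : mfderiv 𝓘(ℝ, 𝔼) (𝓡 n) e.symm x
      (mfderiv (𝓡 n) 𝓘(ℝ, 𝔼) e (e.symm x) (v (e.symm x))) = v (e.symm x) := by
    have := DFunLike.congr_fun h3 (v (e.symm x))
    rw [ContinuousLinearMap.comp_apply] at this
    rw [e.right_inv hx1] at this
    exact this
  exact congrArg (mfderiv (𝓡 n) 𝓘(ℝ, 𝔼) h (e.symm x)) h4.symm

lemma mfderiv_symm_pushChart (he : e ∈ IsManifold.maximalAtlas (𝓡 n) ∞ M) {m : M}
    (hm : m ∈ e.source) (v : VField n M) :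
    mfderiv 𝓘(ℝ, 𝔼) (𝓡 n) e.symm (e m) (pushChart e v (e m)) = v m := by
  rw [pushChart_apply hm]
  exact DFunLike.congr_fun ((mdifferentiable_of_mem_maximalAtlas he).symm_comp_deriv hm) (v m)

lemma IsGamma.contDiffOn_pushChart {k : ℕ} {v : VField n M} (hv : IsGamma k v)
    (he : e ∈ IsManifold.maximalAtlas (𝓡 n) ∞ M) :
    ContDiffOn ℝ k (pushChart e v) e.target := by
  have h1 : ContMDiffOn (𝓡 n).tangent (𝓡 n).tangent k
      (tangentMapWithin (𝓡 n) (𝓡 n) e e.source)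
      (TotalSpace.proj ⁻¹' e.source) :=
    (contMDiffOn_of_mem_maximalAtlas he).contMDiffOn_tangentMapWithin
      (by exact_mod_cast le_top) e.open_source.uniqueMDiffOn
  have h2 : ContMDiffOn 𝓘(ℝ, 𝔼) (𝓡 n).tangent k
      (fun x => (⟨e.symm x, v (e.symm x)⟩ : TangentBundle (𝓡 n) M)) e.target :=
    ContMDiff.comp_contMDiffOn (g := fun m => (⟨m, v m⟩ : TangentBundle (𝓡 n) M)) hv
      ((contMDiffOn_symm_of_mem_maximalAtlas he).of_le (by exact_mod_cast le_top))
  have h3 := (contMDiff_snd_tangentBundle_modelSpace (𝕜 := ℝ) 𝔼 (𝓡 n) (n := (k : WithTop ℕ∞))).comp_contMDiffOn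
    (h1.comp h2 fun x hx => e.map_target hx)
  rw [← contMDiffOn_iff_contDiffOn]
  refine h3.congr fun x hx => ?_
  rw [pushChart_of_mem hx]
  have := tangentMapWithin_eq_tangentMap (I := 𝓡 n) (I' := 𝓡 n) (f := e) (s := e.source)
    (p := ⟨e.symm x, v (e.symm x)⟩)
    (e.open_source.uniqueMDiffOn _ (e.map_target hx))
    ((mdifferentiable_of_mem_maximalAtlas he).mdifferentiableAt (e.map_target hx))
  exact (congrArg (fun p : TangentBundle (𝓡 n) 𝔼 => (p.2 : 𝔼)) this).symm

/-- Regularity of a vector field can be tested in a chart. -/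
lemma contMDiffAt_of_pushChart {k : ℕ} {v : VField n M}
    (he : e ∈ IsManifold.maximalAtlas (𝓡 n) ∞ M) {m : M} (hm : m ∈ e.source)
    (hv : ContDiffAt ℝ k (pushChart e v) (e m)) :
    ContMDiffAt (𝓡 n) (𝓡 n).tangent k (fun m => (⟨m, v m⟩ : TangentBundle (𝓡 n) M)) m := by
  have h0 : ContMDiffAt (𝓡 n) (𝓡 n).tangent k
      (fun x : 𝔼 => (⟨x, pushChart e v x⟩ : TangentBundle (𝓡 n) 𝔼)) (e m) :=
    contMDiffAt_vectorSpace_iff_contDiffAt.2 hv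
  have h1 : ContMDiffOn (𝓡 n).tangent (𝓡 n).tangent k
      (tangentMapWithin (𝓡 n) (𝓡 n) e.symm e.target)
      (TotalSpace.proj ⁻¹' e.target) :=
    (contMDiffOn_symm_of_mem_maximalAtlas he).contMDiffOn_tangentMapWithin
      (by exact_mod_cast le_top) e.open_target.uniqueMDiffOn
  have h2 : ContMDiffAt (𝓡 n) (𝓡 n) k e m :=
    (contMDiffAt_of_mem_maximalAtlas he hm).of_le (by exact_mod_cast le_top)
  have hn : TotalSpace.proj ⁻¹' e.target ∈ 𝓝 (⟨e m, pushChart e v (e m)⟩ : TangentBundle (𝓡 n) 𝔼) :=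
    (e.open_target.preimage (FiberBundle.continuous_proj _ _)).mem_nhds (e.map_source hm)
  have h3 := (h1.contMDiffAt hn).comp m (h0.comp m h2)
  refine h3.congr_of_eventuallyEq ?_
  filter_upwards [e.open_source.mem_nhds hm] with m' hm'
  have := tangentMapWithin_eq_tangentMap (I := 𝓡 n) (I' := 𝓡 n) (f := e.symm) (s := e.target)
    (p := ⟨e m', pushChart e v (e m')⟩)
    (e.open_target.uniqueMDiffOn _ (e.map_source hm'))
    ((mdifferentiable_of_mem_maximalAtlas he).mdifferentiableAt_symm (e.map_source hm'))
  simp only [Function.comp_apply]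
  rw [this]
  have h4 := mfderiv_symm_pushChart he hm' v
  have h5 := e.left_inv hm'
  simp only [tangentMap]
  generalize mfderiv (𝓡 n) (𝓡 n) e.symm (e m') (pushChart e v (e m')) = z at h4
  revert z
  rw [h5]
  rintro z rfl
  rfl

end Charts

/-! ### The norms of vector fields -/

section Norms

variable {n : ℕ} {M : Type*} [TopologicalSpace M] [ChartedSpace (EuclideanSpace ℝ (Fin n)) M]
  [IsManifold (𝓡 n) ∞ M] [T2Space M] [CompactSpace M] {ι : Type*} [Fintype ι]
  {h : ι → OpenPartialHomeomorph M (EuclideanSpace ℝ (Fin n))}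
  {φ : SmoothPartitionOfUnity ι (𝓡 n) M univ}

local notation "𝔼" => EuclideanSpace ℝ (Fin n)

lemma isCompact_image_tsupport (hφ : φ.IsSubordinate (fun i => (h i).source)) (i : ι) :
    IsCompact (h i '' tsupport (φ i)) :=
  (isClosed_tsupport _).isCompact.image_of_continuousOn ((h i).continuousOn.mono (hφ i))

lemma image_tsupport_subset (hφ : φ.IsSubordinate (fun i => (h i).source)) (i : ι) :
    h i '' tsupport (φ i) ⊆ (h i).target := by
  rintro _ ⟨m, hm, rfl⟩
  exact (h i).map_source (hφ i hm)

lemma pushChart_smul_of_notMem {i : ι} {x : 𝔼} (hx : x ∉ h i '' tsupport (φ i)) (v : VField n M) :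
    pushChart (h i) (fun m => φ i m • v m) x = 0 := by
  rw [pushChart_smul]
  by_cases hxt : x ∈ (h i).target
  · have : (h i).symm x ∉ tsupport (φ i) := fun hm => hx ⟨_, hm, (h i).right_inv hxt⟩
    simp [image_eq_zero_of_notMem_tsupport this]
  · simp [pushChart, hxt]

lemma eventually_notMem_image_tsupport (hφ : φ.IsSubordinate (fun i => (h i).source)) {i : ι}
    {x : 𝔼} (hx : x ∉ h i '' tsupport (φ i)) : ∀ᶠ y in 𝓝 x, y ∉ h i '' tsupport (φ i) :=
  (isCompact_image_tsupport hφ i).isClosed.isOpen_compl.mem_nhds hx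

lemma contDiffOn_comp_symm {e : OpenPartialHomeomorph M 𝔼}
    (he : e ∈ IsManifold.maximalAtlas (𝓡 n) ∞ M) {f : M → ℝ} (hf : ContMDiff (𝓡 n) 𝓘(ℝ) ∞ f) :
    ContDiffOn ℝ ∞ (fun x => f (e.symm x)) e.target := by
  rw [← contMDiffOn_iff_contDiffOn]
  exact hf.comp_contMDiffOn (contMDiffOn_symm_of_mem_maximalAtlas he)

lemma contDiff_pushChart_smul (hh : ∀ i, h i ∈ IsManifold.maximalAtlas (𝓡 n) ∞ M)
    (hφ : φ.IsSubordinate (fun i => (h i).source)) {k : ℕ} {v : VField n M} (hv : IsGamma k v)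
    (i : ι) : ContDiff ℝ k (pushChart (h i) (fun m => φ i m • v m)) := by
  rw [contDiff_iff_contDiffAt]
  intro x
  by_cases hx : x ∈ h i '' tsupport (φ i)
  · have hx' := image_tsupport_subset hφ i hx
    rw [pushChart_smul]
    refine ContDiffAt.smul (((contDiffOn_comp_symm (hh i) (φ i).contMDiff).contDiffAt
      ((h i).open_target.mem_nhds hx')).of_le (by exact_mod_cast le_top)) ?_
    exact (hv.contDiffOn_pushChart (hh i)).contDiffAt ((h i).open_target.mem_nhds hx')
  · refine contDiffAt_const (c := 0) |>.congr_of_eventuallyEq ?_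
    filter_upwards [eventually_notMem_image_tsupport hφ hx] with y hy
    exact pushChart_smul_of_notMem hy v

lemma hasCompactSupport_pushChart_smul (hφ : φ.IsSubordinate (fun i => (h i).source))
    (v : VField n M) (i : ι) :
    HasCompactSupport (pushChart (h i) (fun m => φ i m • v m)) :=
  HasCompactSupport.intro (isCompact_image_tsupport hφ i) fun _ hx =>
    pushChart_smul_of_notMem hx v

lemma norm_iteratedFDeriv_le_iSup (hh : ∀ i, h i ∈ IsManifold.maximalAtlas (𝓡 n) ∞ M)
    (hφ : φ.IsSubordinate (fun i => (h i).source)) {k l : ℕ} {v : VField n M} (hv : IsGamma k v)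
    (hl : l ≤ k) (i : ι) (x : 𝔼) :
    ‖iteratedFDeriv ℝ l (pushChart (h i) (fun m => φ i m • v m)) x‖ ≤
      ⨆ x, ‖iteratedFDeriv ℝ l (pushChart (h i) (fun m => φ i m • v m)) x‖ := by
  have h1 := ((hasCompactSupport_pushChart_smul hφ v i).iteratedFDeriv (𝕜 := ℝ) l)
  obtain ⟨C, hC⟩ := h1.exists_bound_of_continuous
    ((contDiff_pushChart_smul hh hφ hv i).continuous_iteratedFDeriv (by exact_mod_cast hl))
  exact le_ciSup (f := fun x => ‖iteratedFDeriv ℝ l (pushChart (h i) (fun m => φ i m • v m)) x‖)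
    ⟨C, by rintro _ ⟨y, rfl⟩; exact hC y⟩ x

lemma seminormC_nonneg (l : ℕ) (v : VField n M) : 0 ≤ seminormC h φ l v :=
  Finset.sum_nonneg fun _ _ => Real.iSup_nonneg fun _ => norm_nonneg _

lemma seminormC_le_normC {l R : ℕ} (hl : l ≤ R) (v : VField n M) :
    seminormC h φ l v ≤ normC h φ R v :=
  Finset.le_sup' (fun l => seminormC h φ l v) (Finset.mem_range.2 (by omega))

lemma normC_nonneg (R : ℕ) (v : VField n M) : 0 ≤ normC h φ R v :=
  (seminormC_nonneg R v).trans (seminormC_le_normC le_rfl v)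

lemma normC_le_iff {R : ℕ} {v : VField n M} {a : ℝ} :
    normC h φ R v ≤ a ↔ ∀ l ≤ R, seminormC h φ l v ≤ a := by
  simp [normC, Finset.sup'_le_iff]

lemma normC_mono (v : VField n M) : Monotone fun R => normC h φ R v := fun _ _ hab =>
  normC_le_iff.2 fun _ hl => seminormC_le_normC (hl.trans hab) v

lemma exists_normC_eq (R : ℕ) (v : VField n M) : ∃ l ≤ R, normC h φ R v = seminormC h φ l v := by
  obtain ⟨l, hl, h⟩ := Finset.exists_mem_eq_sup' (Finset.nonempty_range_add_one (n := R))
    (fun l => seminormC h φ l v)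
  exact ⟨l, Nat.lt_succ_iff.1 (Finset.mem_range.1 hl), h⟩

lemma norm_iteratedFDeriv_le_normC (hh : ∀ i, h i ∈ IsManifold.maximalAtlas (𝓡 n) ∞ M)
    (hφ : φ.IsSubordinate (fun i => (h i).source)) {k l : ℕ} {v : VField n M} (hv : IsGamma k v)
    (hl : l ≤ k) (i : ι) (x : 𝔼) :
    ‖iteratedFDeriv ℝ l (pushChart (h i) (fun m => φ i m • v m)) x‖ ≤ normC h φ k v := by
  refine (norm_iteratedFDeriv_le_iSup hh hφ hv hl i x).trans
    (le_trans ?_ (seminormC_le_normC hl v))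
  exact Finset.single_le_sum (f := fun i => ⨆ x, ‖iteratedFDeriv ℝ l
    (pushChart (h i) (fun m => φ i m • v m)) x‖)
    (fun _ _ => Real.iSup_nonneg fun _ => norm_nonneg _) (Finset.mem_univ i)

lemma sq_seminormC_le (hh : ∀ i, h i ∈ IsManifold.maximalAtlas (𝓡 n) ∞ M)
    (hφ : φ.IsSubordinate (fun i => (h i).source)) {k : ℕ} {v : VField n M}
    (hv : IsGamma (k + 2) v) :
    seminormC h φ (k + 1) v ^ 2 ≤ 3 ^ 2 * (seminormC h φ k v * seminormC h φ (k + 2) v) := by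
  have h1 := Finset.sum_sq_le_sum_mul_sum_of_sq_le_mul Finset.univ
    (r := fun i => ⨆ x, ‖iteratedFDeriv ℝ (k + 1) (pushChart (h i) (fun m => φ i m • v m)) x‖)
    (f := fun i => 3 ^ 2 * ⨆ x, ‖iteratedFDeriv ℝ k (pushChart (h i) (fun m => φ i m • v m)) x‖)
    (g := fun i => ⨆ x, ‖iteratedFDeriv ℝ (k + 2) (pushChart (h i) (fun m => φ i m • v m)) x‖)
    (fun i _ => mul_nonneg (by norm_num) (Real.iSup_nonneg fun _ => norm_nonneg _))
    (fun i _ => Real.iSup_nonneg fun _ => norm_nonneg _) (fun i _ => ?_)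
  · rw [← Finset.mul_sum, mul_assoc] at h1
    exact h1
  · have hA := norm_iteratedFDeriv_le_iSup hh hφ hv (l := k) (by omega) i
    have hB := norm_iteratedFDeriv_le_iSup hh hφ hv (l := k + 2) le_rfl i
    have hx := fun x => Real.le_sqrt_of_sq_le
      (sq_norm_iteratedFDeriv_le (contDiff_pushChart_smul hh hφ hv i) hA hB x)
    have h2 := ciSup_le hx
    have h3 := pow_le_pow_left₀ (Real.iSup_nonneg fun _ => norm_nonneg _) h2 2
    refine h3.trans (le_of_eq ?_)
    rw [Real.sq_sqrt, mul_assoc]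
    exact mul_nonneg (by norm_num) (mul_nonneg (Real.iSup_nonneg fun _ => norm_nonneg _)
      (Real.iSup_nonneg fun _ => norm_nonneg _))

/-- The norms of a vector field form a logarithmically convex sequence, up to a constant. -/
lemma sq_normC_le (hh : ∀ i, h i ∈ IsManifold.maximalAtlas (𝓡 n) ∞ M)
    (hφ : φ.IsSubordinate (fun i => (h i).source)) {k : ℕ} {v : VField n M}
    (hv : IsGamma (k + 2) v) :
    normC h φ (k + 1) v ^ 2 ≤ 3 ^ 2 * (normC h φ k v * normC h φ (k + 2) v) := by
  obtain ⟨l, hl, hle⟩ := exists_normC_eq (h := h) (φ := φ) (k + 1) v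
  have h0 := fun R => normC_nonneg (h := h) (φ := φ) R v
  rw [hle]
  rcases l with _ | j
  · have h1 := seminormC_le_normC (h := h) (φ := φ) (Nat.zero_le k) v
    have h2 := seminormC_le_normC (h := h) (φ := φ) (Nat.zero_le (k + 2)) v
    have h3 := seminormC_nonneg (h := h) (φ := φ) 0 v
    nlinarith [mul_le_mul h1 h2 h3 (h0 k), mul_nonneg (h0 k) (h0 (k + 2))]
  · have hv' : IsGamma (j + 2) v := hv.of_le (by exact_mod_cast (by omega))
    refine (sq_seminormC_le hh hφ hv').trans ?_
    gcongr
    · exact seminormC_nonneg _ _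
    · exact h0 _
    · exact seminormC_le_normC (by omega) v
    · exact seminormC_le_normC (by omega) v

lemma IsGamma.mono {k l : ℕ} (hkl : k ≤ l) {v : VField n M} (hv : IsGamma l v) : IsGamma k v :=
  ContMDiff.of_le hv (by exact_mod_cast hkl)

/-- The partition of unity decomposes a vector field. -/
lemma sum_smul_eq (v : VField n M) : (∑ j, fun m => φ j m • v m) = v := by
  ext1 m
  rw [Finset.sum_apply, ← Finset.sum_smul]
  have := φ.sum_eq_one (mem_univ m)
  rw [finsum_eq_sum_of_fintype] at this
  rw [this, one_smul]

/-- In any chart, the derivatives of a vector field are locally bounded by its norm. -/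
lemma exists_growthAt_pushChart_nhds (hh : ∀ i, h i ∈ IsManifold.maximalAtlas (𝓡 n) ∞ M)
    (hφ : φ.IsSubordinate (fun i => (h i).source)) {e : OpenPartialHomeomorph M 𝔼}
    (he : e ∈ IsManifold.maximalAtlas (𝓡 n) ∞ M) (R : ℕ) {x₀ : 𝔼} (hx₀ : x₀ ∈ e.target) :
    ∃ U ∈ 𝓝 x₀, ∃ C, 1 ≤ C ∧ ∀ v : VField n M, IsGamma R v → ∀ x ∈ U,
      GrowthAt R (C * normC h φ R v) 1 (pushChart e v) x := by
  have key : ∀ j, ∃ U ∈ 𝓝 x₀, ∃ C : ℝ, 0 ≤ C ∧ ∀ v : VField n M, IsGamma R v → ∀ x ∈ U,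
      GrowthAt R (C * normC h φ R v) 1 (pushChart e (fun m => φ j m • v m)) x := by
    intro j
    by_cases hj : e.symm x₀ ∈ tsupport (φ j)
    · have hs : x₀ ∈ (chartChange e (h j)).source := mem_chartChange_source.2 ⟨hx₀, hφ j hj⟩
      obtain ⟨K, hKx, hKs, hK⟩ : ∃ K ∈ 𝓝 x₀, K ⊆ (chartChange e (h j)).source ∧ IsCompact K :=
        local_compact_nhds ((chartChange e (h j)).open_source.mem_nhds hs)
      obtain ⟨A, hA1, hA⟩ := exists_growthAt_of_isCompact (chartChange e (h j)).open_source
        (contDiffOn_chartChange he (hh j)) hK hKs R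
      -- the derivative of the inverse change of charts, as a function on the chart `e`
      have hD : ContDiffOn ℝ ∞ (fun x => fderiv ℝ (chartChange (h j) e) (chartChange e (h j) x))
          (chartChange e (h j)).source := by
        refine ((contDiffOn_chartChange (hh j) he).fderiv_of_isOpen (m := ∞)
          (chartChange (h j) e).open_source (by simp)).comp (contDiffOn_chartChange he (hh j)) ?_
        intro x hx
        obtain ⟨h1, h2⟩ := mem_chartChange_source.1 hx
        have h3 : chartChange e (h j) x = h j (e.symm x) := rfl
        rw [mem_chartChange_source, h3, (h j).left_inv h2]
        exact ⟨(h j).map_source h2, e.map_target h1⟩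
      obtain ⟨B, hB1, hB⟩ := exists_growthAt_of_isCompact (chartChange e (h j)).open_source
        hD hK hKs R
      refine ⟨interior K, interior_mem_nhds.2 hKx, 2 ^ R * B * faaConst R A, ?_, fun v hv x hx => ?_⟩
      · have := one_le_faaConst R hA1
        positivity
      have hxK := interior_subset hx
      have h1 : GrowthAt R (normC h φ R v) 1 (pushChart (h j) (fun m => φ j m • v m))
          (chartChange e (h j) x) :=
        ⟨(contDiff_pushChart_smul hh hφ hv j).contDiffAt, fun k hk => by
          rw [one_pow, mul_one]
          exact norm_iteratedFDeriv_le_normC hh hφ hv hk j _⟩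
      have h2 := h1.comp le_rfl hA1 (hA x hxK 1 le_rfl).derivGrowthAt
      have h3 := GrowthAt.bilinear (ContinuousLinearMap.id ℝ (𝔼 →L[ℝ] 𝔼))
        ContinuousLinearMap.norm_id_le le_rfl (hB x hxK 1 le_rfl) h2
      refine (h3.congr ?_).mono zero_le_one (by linarith)
      filter_upwards [isOpen_interior.mem_nhds hx] with y hy
      have hys := hKs (interior_subset hy)
      obtain ⟨h4, h5⟩ := mem_chartChange_source.1 hys
      have h6 : chartChange e (h j) y = h j (e.symm y) := rfl
      have hys' : chartChange e (h j) y ∈ (chartChange (h j) e).source := by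
        rw [mem_chartChange_source, h6, (h j).left_inv h5]
        exact ⟨(h j).map_source h5, e.map_target h4⟩
      have h7 := pushChart_eq_chartChange (hh j) he hys' (fun m => φ j m • v m)
      have h8 : chartChange (h j) e (chartChange e (h j) y) = y := by
        change e ((h j).symm (h j (e.symm y))) = y
        rw [(h j).left_inv h5, e.right_inv h4]
      rw [h8] at h7
      exact h7
    · have h1 : ∀ᶠ x in 𝓝 x₀, φ j (e.symm x) = 0 := by
        have h2 : ∀ᶠ x in 𝓝 x₀, e.symm x ∉ tsupport (φ j) :=
          (e.continuousAt_symm hx₀).eventually ((isClosed_tsupport _).isOpen_compl.mem_nhds hj)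
        filter_upwards [h2] with x hx using image_eq_zero_of_notMem_tsupport hx
      refine ⟨_, eventually_eventually_nhds.2 h1, 0, le_rfl, fun v hv x hx => ?_⟩
      refine ((growthAt_zero le_rfl zero_le_one).mono zero_le_one (by simp)).congr
        (f := fun _ => (0 : 𝔼)) ?_
      rw [pushChart_smul]
      filter_upwards [hx] with y hy
      simp [hy]
  choose U hU C hC hUC using key
  refine ⟨⋂ j, U j, Filter.iInter_mem.2 hU, 1 + ∑ j, C j, ?_, fun v hv x hx => ?_⟩
  · have := Finset.sum_nonneg fun j (_ : j ∈ Finset.univ) => hC j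
    linarith
  have hsum : ∀ s : Finset ι, GrowthAt R ((∑ j ∈ s, C j) * normC h φ R v) 1
      (∑ j ∈ s, pushChart e (fun m => φ j m • v m)) x := by
    classical
    intro s
    induction s using Finset.induction_on with
    | empty =>
      simp only [Finset.sum_empty, zero_mul]
      exact growthAt_zero le_rfl zero_le_one
    | insert j s hj ih =>
      rw [Finset.sum_insert hj, Finset.sum_insert hj, add_mul]
      exact GrowthAt.add (hUC j v hv x (mem_iInter.1 hx j)) ih
  have h1 := hsum Finset.univ
  rw [← pushChart_sum, sum_smul_eq] at h1
  refine h1.mono zero_le_one ?_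
  have := normC_nonneg (h := h) (φ := φ) R v
  nlinarith

/-- The global form of `exists_growthAt_pushChart_nhds`, by compactness. -/
lemma exists_growthAt_pushChart (hh : ∀ i, h i ∈ IsManifold.maximalAtlas (𝓡 n) ∞ M)
    (hφ : φ.IsSubordinate (fun i => (h i).source)) {e : OpenPartialHomeomorph M 𝔼}
    (he : e ∈ IsManifold.maximalAtlas (𝓡 n) ∞ M) (R : ℕ) {K : Set 𝔼} (hK : IsCompact K)
    (hKe : K ⊆ e.target) :
    ∃ C, 1 ≤ C ∧ ∀ v : VField n M, IsGamma R v → ∀ x ∈ K,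
      GrowthAt R (C * normC h φ R v) 1 (pushChart e v) x := by
  refine hK.induction_on (p := fun K => ∃ C, 1 ≤ C ∧ ∀ v : VField n M, IsGamma R v → ∀ x ∈ K,
      GrowthAt R (C * normC h φ R v) 1 (pushChart e v) x) ⟨1, le_rfl, by simp⟩ ?_ ?_ ?_
  · rintro s t hst ⟨C, hC1, hC⟩
    exact ⟨C, hC1, fun v hv x hx => hC v hv x (hst hx)⟩
  · rintro s t ⟨C, hC1, hC⟩ ⟨D, hD1, hD⟩
    refine ⟨max C D, hC1.trans (le_max_left _ _), fun v hv x hx => ?_⟩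
    have h0 := normC_nonneg (h := h) (φ := φ) R v
    rcases hx with hx | hx
    · exact (hC v hv x hx).mono zero_le_one (by gcongr; exact le_max_left _ _)
    · exact (hD v hv x hx).mono zero_le_one (by gcongr; exact le_max_right _ _)
  · intro x hx
    obtain ⟨U, hU, C, hC1, hC⟩ := exists_growthAt_pushChart_nhds hh hφ he R (hKe hx)
    exact ⟨U, mem_nhdsWithin_of_mem_nhds hU, C, hC1, hC⟩

/-- Local bounds in the charts give a bound for the norm. The constant has to be uniform for a class
of vector fields, so the statement is about a set `𝒮` of pairs of a vector field and a bound. -/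
lemma exists_normC_le (hh : ∀ i, h i ∈ IsManifold.maximalAtlas (𝓡 n) ∞ M)
    (hφ : φ.IsSubordinate (fun i => (h i).source)) (R : ℕ) (𝒮 : Set (VField n M × ℝ))
    (hP : ∀ p ∈ 𝒮, 0 ≤ p.2)
    (hloc : ∀ i, ∀ x₀ ∈ h i '' tsupport (φ i), ∃ U ∈ 𝓝 x₀, ∃ C : ℝ, 0 ≤ C ∧ ∀ p ∈ 𝒮, ∀ x ∈ U,
      GrowthAt R (C * p.2) 1 (pushChart (h i) p.1) x) :
    ∃ C : ℝ, 0 < C ∧ ∀ p ∈ 𝒮, IsGamma R p.1 ∧ normC h φ R p.1 ≤ C * p.2 := by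
  have key : ∀ i, ∃ C : ℝ, 0 ≤ C ∧ ∀ p ∈ 𝒮, ∀ x ∈ h i '' tsupport (φ i),
      GrowthAt R (C * p.2) 1 (pushChart (h i) p.1) x := by
    intro i
    refine (isCompact_image_tsupport hφ i).induction_on (p := fun K => ∃ C : ℝ, 0 ≤ C ∧ ∀ p ∈ 𝒮,
      ∀ x ∈ K, GrowthAt R (C * p.2) 1 (pushChart (h i) p.1) x) ⟨0, le_rfl, by simp⟩ ?_ ?_ ?_
    · rintro s t hst ⟨C, hC1, hC⟩
      exact ⟨C, hC1, fun v hv x hx => hC v hv x (hst hx)⟩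
    · rintro s t ⟨C, hC1, hC⟩ ⟨D, hD1, hD⟩
      refine ⟨max C D, hC1.trans (le_max_left _ _), fun p hp x hx => ?_⟩
      have h0 := hP p hp
      rcases hx with hx | hx
      · exact (hC p hp x hx).mono zero_le_one (by gcongr; exact le_max_left _ _)
      · exact (hD p hp x hx).mono zero_le_one (by gcongr; exact le_max_right _ _)
    · intro x hx
      obtain ⟨U, hU, C, hC1, hC⟩ := hloc i x hx
      exact ⟨U, mem_nhdsWithin_of_mem_nhds hU, C, hC1, hC⟩
  choose C hC0 hC using key
  have hB : ∀ i, ∃ B, 1 ≤ B ∧ ∀ x ∈ h i '' tsupport (φ i), ∀ l, 1 ≤ l →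
      GrowthAt R B l (fun x => φ i ((h i).symm x)) x := fun i =>
    exists_growthAt_of_isCompact (h i).open_target (contDiffOn_comp_symm (hh i) (φ i).contMDiff)
      (isCompact_image_tsupport hφ i) (image_tsupport_subset hφ i) R
  choose B hB1 hB using hB
  have h1 : ∀ p ∈ 𝒮, ∀ i x, ∀ l ≤ R,
      ‖iteratedFDeriv ℝ l (pushChart (h i) (fun m => φ i m • p.1 m)) x‖ ≤
        2 ^ R * B i * (C i * p.2) := by
    intro p hp i x l hl
    by_cases hx : x ∈ h i '' tsupport (φ i)
    · have h2 := GrowthAt.bilinear (ContinuousLinearMap.lsmul ℝ ℝ : ℝ →L[ℝ] 𝔼 →L[ℝ] 𝔼)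
        ContinuousLinearMap.opNorm_lsmul_le le_rfl (hB i x hx 1 le_rfl) (hC i p hp x hx)
      have h3 := h2.2 l hl
      rw [one_pow, mul_one] at h3
      rw [pushChart_smul]
      exact h3
    · have h2 : pushChart (h i) (fun m => φ i m • p.1 m) =ᶠ[𝓝 x] fun _ => 0 := by
        filter_upwards [eventually_notMem_image_tsupport hφ hx] with y hy
        exact pushChart_smul_of_notMem hy _
      have h3 := (growthAt_zero (F := 𝔼) (G := 𝔼) (R := R) (A := 2 ^ R * B i * (C i * p.2)) (l := 1) (x := x)
        (mul_nonneg (mul_nonneg (by positivity) (by linarith [hB1 i]))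
        (mul_nonneg (hC0 i) (hP p hp))) zero_le_one).congr h2
      have := h3.2 l hl
      rwa [one_pow, mul_one] at this
  refine ⟨1 + ∑ i, 2 ^ R * B i * C i, ?_, fun p hp => ⟨fun m => ?_, normC_le_iff.2 fun l hl => ?_⟩⟩
  · have := Finset.sum_nonneg fun j (_ : j ∈ Finset.univ) =>
      mul_nonneg (mul_nonneg (by positivity : (0 : ℝ) ≤ 2 ^ R) (zero_le_one.trans (hB1 j))) (hC0 j)
    linarith
  · obtain ⟨i, hi⟩ := φ.exists_pos_of_mem (mem_univ m)
    have hm : m ∈ tsupport (φ i) := subset_tsupport _ hi.ne'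
    exact contMDiffAt_of_pushChart (hh i) (hφ i hm) (hC i p hp _ ⟨m, hm, rfl⟩).1
  · have h2 : seminormC h φ l p.1 ≤ ∑ i, 2 ^ R * B i * (C i * p.2) :=
      Finset.sum_le_sum fun i _ => ciSup_le fun x => h1 p hp i x l hl
    refine h2.trans ?_
    have h3 := hP p hp
    rw [add_mul, one_mul, Finset.sum_mul]
    have h4 : ∑ i, 2 ^ R * B i * (C i * p.2) = ∑ i, 2 ^ R * B i * C i * p.2 :=
      Finset.sum_congr rfl fun i _ => by ring
    linarith

lemma IsGamma.add {k : ℕ} {v w : VField n M} (hv : IsGamma k v) (hw : IsGamma k w) :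
    IsGamma k (v + w) := ContMDiff.add_section hv hw

lemma normC_add_le (hh : ∀ i, h i ∈ IsManifold.maximalAtlas (𝓡 n) ∞ M)
    (hφ : φ.IsSubordinate (fun i => (h i).source)) {k : ℕ} {v w : VField n M} (hv : IsGamma k v)
    (hw : IsGamma k w) : normC h φ k (v + w) ≤ normC h φ k v + normC h φ k w := by
  refine normC_le_iff.2 fun l hl => ?_
  refine le_trans ?_ (add_le_add (seminormC_le_normC hl v) (seminormC_le_normC hl w))
  rw [seminormC, seminormC, seminormC, ← Finset.sum_add_distrib]
  refine Finset.sum_le_sum fun i _ => ciSup_le fun x => ?_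
  have h1 : pushChart (h i) (fun m => φ i m • (v + w) m) =
      pushChart (h i) (fun m => φ i m • v m) + pushChart (h i) (fun m => φ i m • w m) := by
    rw [← pushChart_add]
    congr 1
    ext1 m
    exact smul_add _ _ _
  have hl' : ((l : ℕ) : WithTop ℕ∞) ≤ k := by exact_mod_cast hl
  rw [h1, iteratedFDeriv_add ((contDiff_pushChart_smul hh hφ hv i).of_le hl')
    ((contDiff_pushChart_smul hh hφ hw i).of_le hl'), Pi.add_apply]
  exact (norm_add_le _ _).trans (add_le_add (norm_iteratedFDeriv_le_iSup hh hφ hv hl i x)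
    (norm_iteratedFDeriv_le_iSup hh hφ hw hl i x))

/-- The bounds of `exists_growthAt_pushChart` for all orders up to `R` at once. -/
lemma exists_norm_iteratedFDeriv_pushChart_le
    (hh : ∀ i, h i ∈ IsManifold.maximalAtlas (𝓡 n) ∞ M)
    (hφ : φ.IsSubordinate (fun i => (h i).source)) {e : OpenPartialHomeomorph M 𝔼}
    (he : e ∈ IsManifold.maximalAtlas (𝓡 n) ∞ M) (R : ℕ) {K : Set 𝔼} (hK : IsCompact K)
    (hKe : K ⊆ e.target) :
    ∃ C, 1 ≤ C ∧ ∀ k ≤ R, ∀ v : VField n M, IsGamma k v → ∀ x ∈ K,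
      ContDiffAt ℝ k (pushChart e v) x ∧
      ‖iteratedFDeriv ℝ k (pushChart e v) x‖ ≤ C * normC h φ k v := by
  have h1 := fun k => exists_growthAt_pushChart hh hφ he k hK hKe
  choose C hC1 hC using h1
  have h2 : ∀ k ≤ R, C k ≤ ∑ j ∈ Finset.range (R + 1), C j := fun k hk =>
    Finset.single_le_sum (f := C) (fun j _ => zero_le_one.trans (hC1 j))
      (Finset.mem_range.2 (by omega))
  refine ⟨∑ j ∈ Finset.range (R + 1), C j, (hC1 0).trans (h2 0 (Nat.zero_le R)),
    fun k hk v hv x hx => ⟨(hC k v hv x hx).1, ?_⟩⟩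
  have h3 := (hC k v hv x hx).2 k le_rfl
  rw [one_pow, mul_one] at h3
  exact h3.trans (mul_le_mul_of_nonneg_right (h2 k hk) (normC_nonneg k v))

end Norms

/-! ### Smooth dependence of solutions on the initial value -/

section Flow

variable {X : Type*} [TopologicalSpace X] [CompactSpace X]

universe u

section Nemytskii

variable {F G : Type u} [NormedAddCommGroup F] [NormedSpace ℝ F] [NormedAddCommGroup G]
  [NormedSpace ℝ G]

/-- The composition of continuous functions with a given continuous function. -/
def postComp (X : Type*) [TopologicalSpace X] (f : F → G) (hf : Continuous f) (α : C(X, F)) :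
    C(X, G) :=
  ⟨fun t => f (α t), hf.comp α.continuous⟩

/-- Pointwise application of continuous families of linear maps. -/
noncomputable def pointwiseApply (X : Type*) [TopologicalSpace X] [CompactSpace X] (F G : Type u)
    [NormedAddCommGroup F] [NormedSpace ℝ F] [NormedAddCommGroup G] [NormedSpace ℝ G] :
    C(X, F →L[ℝ] G) →L[ℝ] C(X, F) →L[ℝ] C(X, G) :=
  LinearMap.mkContinuous₂ (LinearMap.mk₂ ℝ
    (fun (A : C(X, F →L[ℝ] G)) (β : C(X, F)) => (⟨fun t => A t (β t), by fun_prop⟩ : C(X, G)))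
    (fun A B β => by ext t; simp) (fun c A β => by ext t; simp)
    (fun A β γ => by ext t; simp) (fun c A β => by ext t; simp)) 1 (fun A β => by
      rw [one_mul]
      refine (ContinuousMap.norm_le _ (by positivity)).2 fun t => ?_
      exact ((A t).le_opNorm _).trans (by gcongr <;> exact ContinuousMap.norm_coe_le_norm _ _))

lemma hasFDerivAt_postComp {f : F → G} (hf : ContDiff ℝ 1 f) (α : C(X, F)) :
    HasFDerivAt (postComp X f hf.continuous)
      (pointwiseApply X F G (postComp X (fderiv ℝ f) (hf.continuous_fderiv one_ne_zero) α)) α := by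
  refine HasFDerivAt.of_isLittleO (Asymptotics.isLittleO_iff.2 fun c hc => ?_)
  have h1 := (isCompact_range α.continuous).uniformContinuousAt_of_continuousAt (fderiv ℝ f)
    (fun a _ => (hf.continuous_fderiv one_ne_zero).continuousAt) (Metric.dist_mem_uniformity hc)
  obtain ⟨d, hd, hd'⟩ := Metric.mem_uniformity_dist.1 h1
  filter_upwards [Metric.ball_mem_nhds α hd] with β hβ
  refine (ContinuousMap.norm_le _ (by positivity)).2 fun t => ?_
  have hβt : β t ∈ Metric.ball (α t) d := (ContinuousMap.dist_apply_le_dist t).trans_lt hβ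
  have h2 := (convex_ball (α t) d).norm_image_sub_le_of_norm_hasFDerivWithin_le' (f := f)
    (f' := fderiv ℝ f) (φ := fderiv ℝ f (α t)) (C := c)
    (fun y _ => (hf.differentiable one_ne_zero y).hasFDerivAt.hasFDerivWithinAt)
    (fun y hy => by
      have h3 : dist (α t) y < d := by rw [dist_comm]; exact hy
      have := @hd' (α t) y h3 ⟨t, rfl⟩
      rw [← dist_eq_norm, dist_comm]
      exact le_of_lt this) (Metric.mem_ball_self hd) hβt
  refine h2.trans ?_
  gcongr
  exact ContinuousMap.norm_coe_le_norm (β - α) t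

lemma contDiff_postComp_nat (m : ℕ) : ∀ {G : Type u} [NormedAddCommGroup G] [NormedSpace ℝ G]
    {f : F → G} (hf : ContDiff ℝ ∞ f), ContDiff ℝ m (postComp X f hf.continuous) := by
  induction m with
  | zero =>
    intro G _ _ f hf
    have h1 : ContDiff ℝ 1 f := hf.of_le (by exact_mod_cast le_top)
    exact contDiff_zero.2 (continuous_iff_continuousAt.2 fun α =>
      (hasFDerivAt_postComp h1 α).continuousAt)
  | succ m ih =>
    intro G _ _ f hf
    have h1 : ContDiff ℝ 1 f := hf.of_le (by exact_mod_cast le_top)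
    have h2 : ContDiff ℝ ∞ (fderiv ℝ f) := hf.fderiv_right (by simp)
    refine contDiff_succ_iff_hasFDerivAt.2 ⟨fun α => pointwiseApply X F G
      (postComp X (fderiv ℝ f) h2.continuous α), ?_, hasFDerivAt_postComp h1⟩
    exact (pointwiseApply X F G).contDiff.comp (ih h2)

/-- Composition with a smooth function is a smooth operation on continuous functions. -/
lemma contDiff_postComp {f : F → G} (hf : ContDiff ℝ ∞ f) :
    ContDiff ℝ ∞ (postComp X f hf.continuous) :=
  contDiff_infty.2 fun m => contDiff_postComp_nat m hf

end Nemytskii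

variable {F : Type u} [NormedAddCommGroup F] [NormedSpace ℝ F] [CompleteSpace F]

/-- The time interval on which the solutions are constructed. -/
abbrev TimeInterval : Set ℝ := Icc (-1) 2

/-- The primitive vanishing at `0`, as an operator on continuous functions. -/
noncomputable def primitive (F : Type u) [NormedAddCommGroup F] [NormedSpace ℝ F] :
    C(TimeInterval, F) →L[ℝ] C(TimeInterval, F) :=
  LinearMap.mkContinuous
    { toFun := fun α => ⟨fun t => ∫ s in (0 : ℝ)..t, IccExtend (by norm_num) α s,
        (intervalIntegral.continuous_primitive (fun a b =>
          (α.continuous.Icc_extend' (h := by norm_num)).intervalIntegrable a b) 0).comp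
          continuous_subtype_val⟩
      map_add' := fun α β => by
        ext t
        exact intervalIntegral.integral_add
          ((α.continuous.Icc_extend' (h := by norm_num)).intervalIntegrable _ _)
          ((β.continuous.Icc_extend' (h := by norm_num)).intervalIntegrable _ _)
      map_smul' := fun c α => by
        ext t
        exact intervalIntegral.integral_smul c _ } 2 (fun α => by
      refine (ContinuousMap.norm_le _ (by positivity)).2 fun t => ?_
      have h1 := intervalIntegral.norm_integral_le_of_norm_le_const (a := 0) (b := (t : ℝ))
        (C := ‖α‖) (f := IccExtend (by norm_num) α)
        (fun s _ => ContinuousMap.norm_coe_le_norm α _)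
      refine h1.trans ?_
      rw [mul_comm]
      gcongr
      rw [sub_zero, abs_le]
      exact ⟨by linarith [t.2.1], t.2.2⟩)

/-- Constant functions. -/
noncomputable def constFun (F : Type u) [NormedAddCommGroup F] [NormedSpace ℝ F] :
    F →L[ℝ] C(TimeInterval, F) :=
  LinearMap.mkContinuous
    { toFun := fun z => ContinuousMap.const _ z
      map_add' := fun _ _ => rfl
      map_smul' := fun _ _ => rfl } 1 (fun z => by
      rw [one_mul]
      exact (ContinuousMap.norm_le _ (by positivity)).2 fun t => le_rfl)

lemma constFun_apply (z : F) (t : TimeInterval) : constFun F z t = z := rfl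

/-- Near an equilibrium `z₀` of the autonomous equation `z' = f z` at which the derivative of `f`
has square zero, the solutions exist on `[-1, 2]` and depend smoothly on the initial value. They are
obtained from the inverse function theorem for `α ↦ α - ∫ f ∘ α` on the continuous functions. -/
theorem exists_flow {f : F → F} (hf : ContDiff ℝ ∞ f) {z₀ : F} (hz₀ : f z₀ = 0)
    (hsq : ∀ z, fderiv ℝ f z₀ (fderiv ℝ f z₀ z) = 0) {W : Set F} (hW : W ∈ 𝓝 z₀) :
    ∃ A : F → ℝ → F,
      HasFDerivAt (fun z => A z 1) (ContinuousLinearMap.id ℝ F + fderiv ℝ f z₀) z₀ ∧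
      ∀ᶠ z in 𝓝 z₀, A z 0 = z ∧ (∀ t ∈ TimeInterval, HasDerivAt (A z) (f (A z t)) t) ∧
        (∀ t ∈ TimeInterval, A z t ∈ W) ∧ ContDiffAt ℝ ∞ (fun z => A z 1) z ∧
        (f z = 0 → ∀ t ∈ TimeInterval, A z t = z) := by
  set Ψ : C(TimeInterval, F) → C(TimeInterval, F) := fun α =>
    α - primitive F (postComp TimeInterval f hf.continuous α) with hΨ
  have hf1 : ContDiff ℝ 1 f := hf.of_le (by exact_mod_cast le_top)
  have hΨs : ContDiff ℝ ∞ Ψ :=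
    contDiff_id.sub ((primitive F).contDiff.comp (contDiff_postComp hf))
  have hconst : ∀ z, f z = 0 → Ψ (constFun F z) = constFun F z := by
    intro z hz
    have h1 : postComp TimeInterval f hf.continuous (constFun F z) = 0 := by
      ext t; exact hz
    simp only [hΨ, h1, map_zero, sub_zero]
  set N : C(TimeInterval, F) →L[ℝ] C(TimeInterval, F) := (primitive F).comp
    (pointwiseApply TimeInterval F F (postComp TimeInterval (fderiv ℝ f)
      (hf1.continuous_fderiv one_ne_zero) (constFun F z₀))) with hN
  have hΨd : HasFDerivAt Ψ (ContinuousLinearMap.id ℝ _ - N) (constFun F z₀) :=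
    (hasFDerivAt_id _).sub ((primitive F).hasFDerivAt.comp _ (hasFDerivAt_postComp hf1 _))
  have hNapp : ∀ β t, N β t = ∫ s in (0 : ℝ)..t,
      fderiv ℝ f z₀ (IccExtend (by norm_num) β s) := fun β t => rfl
  -- `N² = 0`, so that `1 - N` has the inverse `1 + N`
  have hNN : ∀ β, N (N β) = 0 := by
    intro β
    ext t
    rw [hNapp]
    have h1 : ∀ s, fderiv ℝ f z₀ (IccExtend (by norm_num : (-1 : ℝ) ≤ 2) (N β) s) = 0 := by
      intro s
      have h2 : IccExtend (by norm_num : (-1 : ℝ) ≤ 2) (N β) s =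
        N β (projIcc (-1) 2 (by norm_num) s) := rfl
      rw [h2, hNapp, ← ContinuousLinearMap.intervalIntegral_comp_comm]
      · simp [hsq]
      · exact ((fderiv ℝ f z₀).continuous.comp
          (β.continuous.Icc_extend' (h := by norm_num))).intervalIntegrable _ _
    simp [h1]
  let Ne : C(TimeInterval, F) ≃L[ℝ] C(TimeInterval, F) :=
    ContinuousLinearEquiv.equivOfInverse (ContinuousLinearMap.id ℝ _ - N)
      (ContinuousLinearMap.id ℝ _ + N)
      (fun β => by simp [hNN]) (fun β => by simp [hNN])
  have hΨd' : HasFDerivAt Ψ (Ne : C(TimeInterval, F) →L[ℝ] C(TimeInterval, F)) (constFun F z₀) :=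
    hΨd
  let T := hΨs.contDiffAt.toOpenPartialHomeomorph Ψ hΨd' (by simp)
  have hT : ∀ α, T α = Ψ α := fun α => rfl
  have hsrc : constFun F z₀ ∈ T.source :=
    ContDiffAt.mem_toOpenPartialHomeomorph_source hΨs.contDiffAt hΨd' (by simp)
  have hTz₀ : T (constFun F z₀) = constFun F z₀ := hconst z₀ hz₀
  have htgt : constFun F z₀ ∈ T.target := by
    have := T.map_source hsrc
    rwa [hTz₀] at this
  have hTs : T.symm (constFun F z₀) = constFun F z₀ := by
    have := T.left_inv hsrc
    rwa [hTz₀] at this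
  -- the derivative of `Ψ` stays invertible near the constant solution
  have hinv : ∀ᶠ α in 𝓝 (constFun F z₀), ∃ L : C(TimeInterval, F) ≃L[ℝ] C(TimeInterval, F),
      HasFDerivAt Ψ (L : C(TimeInterval, F) →L[ℝ] C(TimeInterval, F)) α := by
    have h1 : ContinuousAt (fderiv ℝ Ψ) (constFun F z₀) :=
      (hΨs.continuous_fderiv (by simp)).continuousAt
    have h2 := h1.eventually (by
      rw [hΨd'.fderiv]
      exact ContinuousLinearEquiv.nhds Ne)
    filter_upwards [h2] with α hα
    obtain ⟨L, hL⟩ := hα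
    exact ⟨L, by rw [hL]; exact (hΨs.differentiable (by simp) α).hasFDerivAt⟩
  have hsymm : Filter.Tendsto (fun z => T.symm (constFun F z)) (𝓝 z₀) (𝓝 (constFun F z₀)) := by
    have h1 := (T.continuousAt_symm htgt).comp (f := constFun F)
      (constFun F).continuous.continuousAt
    have h2 : Filter.Tendsto (fun z => T.symm (constFun F z)) (𝓝 z₀)
      (𝓝 (T.symm (constFun F z₀))) := h1
    rwa [hTs] at h2
  have hcz : Filter.Tendsto (constFun F) (𝓝 z₀) (𝓝 (constFun F z₀)) :=
    (constFun F).continuous.continuousAt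
  obtain ⟨d, hd, hdW⟩ := Metric.mem_nhds_iff.1 hW
  -- the primitive is differentiable at the end points of the time interval, too
  set A : F → ℝ → F := fun z t => z + ∫ s in (0 : ℝ)..t,
    f (IccExtend (by norm_num : (-1 : ℝ) ≤ 2) (T.symm (constFun F z)) s) with hA
  have hAt : ∀ z, constFun F z ∈ T.target → ∀ t (ht : t ∈ TimeInterval),
      A z t = T.symm (constFun F z) ⟨t, ht⟩ := by
    intro z hz t ht
    have h1 : Ψ (T.symm (constFun F z)) = constFun F z := T.right_inv hz
    have h2 := DFunLike.congr_fun h1 ⟨t, ht⟩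
    have h3 : T.symm (constFun F z) ⟨t, ht⟩ - ∫ s in (0 : ℝ)..t,
      f (IccExtend (by norm_num : (-1 : ℝ) ≤ 2) (T.symm (constFun F z)) s) = z := h2
    rw [hA]
    simp only
    nth_rewrite 1 [← h3]
    abel
  have h1I : (1 : ℝ) ∈ TimeInterval := ⟨by norm_num, by norm_num⟩
  let ev : C(TimeInterval, F) →L[ℝ] F := ContinuousMap.evalCLM ℝ (⟨1, h1I⟩ : TimeInterval)
  have hev : ∀ z, constFun F z ∈ T.target →
      (fun z => A z 1) =ᶠ[𝓝 z] fun z => ev (T.symm (constFun F z)) := by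
    intro z hz
    filter_upwards [(constFun F).continuous.continuousAt.eventually
      (T.open_target.mem_nhds hz)] with w hw
    exact hAt w hw 1 h1I
  refine ⟨A, ?_, ?_⟩
  · have h1 : HasFDerivAt T.symm (Ne.symm : C(TimeInterval, F) →L[ℝ] C(TimeInterval, F))
        (constFun F z₀) := by
      refine T.hasFDerivAt_symm htgt ?_
      rw [hTs]
      exact hΨd'
    have h2 := (ev.hasFDerivAt.comp z₀ (h1.comp z₀ (constFun F).hasFDerivAt)).congr_of_eventuallyEq
      (hev z₀ htgt)
    refine h2.congr_fderiv ?_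
    ext z
    have h3 : (∫ _s in (0 : ℝ)..1, fderiv ℝ f z₀ z) = fderiv ℝ f z₀ z := by simp
    change (constFun F z + N (constFun F z)) ⟨1, h1I⟩ = z + fderiv ℝ f z₀ z
    rw [ContinuousMap.add_apply, hNapp, constFun_apply]
    congr 1
  · filter_upwards [hcz.eventually (T.open_target.mem_nhds htgt),
      hcz.eventually (T.open_source.mem_nhds hsrc), hsymm.eventually hinv,
      hsymm.eventually (Metric.ball_mem_nhds _ hd), Metric.ball_mem_nhds z₀ hd]
      with z hz1 hz2 hz3 hz4 hz5
    refine ⟨by simp [hA], fun t ht => ?_, fun t ht => hdW ?_, ?_, fun hfz t ht => ?_⟩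
    · have hc : Continuous fun s =>
          f (IccExtend (by norm_num : (-1 : ℝ) ≤ 2) (T.symm (constFun F z)) s) :=
        hf.continuous.comp ((T.symm (constFun F z)).continuous.Icc_extend' (h := by norm_num))
      have h1 := (intervalIntegral.integral_hasDerivAt_right (hc.intervalIntegrable 0 t)
        (hc.stronglyMeasurableAtFilter _ _) hc.continuousAt).const_add z
      rw [hAt z hz1 t ht]
      rwa [IccExtend_of_mem _ _ ht] at h1
    · rw [hAt z hz1 t ht]
      exact (ContinuousMap.dist_apply_le_dist (f := T.symm (constFun F z)) (g := constFun F z₀)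
        ⟨t, ht⟩).trans_lt hz4
    · obtain ⟨L, hL⟩ := hz3
      have h1 : ContDiffAt ℝ ∞ T.symm (constFun F z) := T.contDiffAt_symm hz1 hL hΨs.contDiffAt
      refine ContDiffAt.congr_of_eventuallyEq ?_ (hev z hz1)
      exact ev.contDiff.contDiffAt.comp z (h1.comp z (constFun F).contDiff.contDiffAt)
    · rw [hAt z hz1 t ht]
      have h1 : T.symm (constFun F z) = constFun F z := by
        have := T.left_inv hz2
        rwa [hT, hconst z hfz] at this
      rw [h1]
      rfl

end Flow

/-! ### The geodesic equation in charts -/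

section EulerLagrange

variable {E E' : Type*} [NormedAddCommGroup E] [NormedSpace ℝ E] [NormedAddCommGroup E']
  [NormedSpace ℝ E']

/-- The Euler–Lagrange expression of the energy `½ ∫ G (c, c', c')`, for a curve with position `x`,
velocity `p` and acceleration `q`, evaluated at `z`. -/
noncomputable def eulerLagrange (G : E → E →L[ℝ] E →L[ℝ] ℝ) (x p q z : E) : ℝ :=
  G x q z + fderiv ℝ G x p p z - 1 / 2 * fderiv ℝ G x z p p

/-- Euler–Lagrange expressions do not depend on the coordinates. -/
lemma eulerLagrange_comp {G : E → E →L[ℝ] E →L[ℝ] ℝ} {G' : E' → E' →L[ℝ] E' →L[ℝ] ℝ}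
    {F : E → E'} {x : E} (hF : ContDiffAt ℝ 2 F x) (hG' : DifferentiableAt ℝ G' (F x))
    (hG : DifferentiableAt ℝ G x) (hsymm : ∀ a b, G' (F x) a b = G' (F x) b a)
    (h : ∀ᶠ y in 𝓝 x, ∀ a b, G y a b = G' (F y) (fderiv ℝ F y a) (fderiv ℝ F y b)) (p q z : E) :
    eulerLagrange G x p q z = eulerLagrange G' (F x) (fderiv ℝ F x p)
      (fderiv ℝ F x q + fderiv ℝ (fderiv ℝ F) x p p) (fderiv ℝ F x z) := by
  have hF1 : HasFDerivAt F (fderiv ℝ F x) x := (hF.differentiableAt (by simp)).hasFDerivAt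
  have hF2 : HasFDerivAt (fderiv ℝ F) (fderiv ℝ (fderiv ℝ F) x) x :=
    ((hF.fderiv_right (m := 1) (by norm_num)).differentiableAt (by simp)).hasFDerivAt
  have hF2s : ∀ a b, fderiv ℝ (fderiv ℝ F) x a b = fderiv ℝ (fderiv ℝ F) x b a := fun a b =>
    hF.isSymmSndFDerivAt (by simp) a b
  have hd : ∀ u a b, fderiv ℝ G x u a b =
      fderiv ℝ G' (F x) (fderiv ℝ F x u) (fderiv ℝ F x a) (fderiv ℝ F x b)
      + G' (F x) (fderiv ℝ (fderiv ℝ F) x u a) (fderiv ℝ F x b)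
      + G' (F x) (fderiv ℝ F x a) (fderiv ℝ (fderiv ℝ F) x u b) := by
    intro u a b
    have h1 : HasFDerivAt (fun y => G y a b) _ x :=
      (hG.hasFDerivAt.clm_apply (hasFDerivAt_const a x)).clm_apply (hasFDerivAt_const b x)
    have h2 : HasFDerivAt (fun y => G' (F y) (fderiv ℝ F y a) (fderiv ℝ F y b)) _ x :=
      (((hG'.hasFDerivAt.comp x hF1).clm_apply (hF2.clm_apply (hasFDerivAt_const a x))).clm_apply
        (hF2.clm_apply (hasFDerivAt_const b x)))
    have h3 := h1.unique (h2.congr_of_eventuallyEq (h.mono fun y hy => hy a b))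
    have h4 := DFunLike.congr_fun h3 u
    simp only [add_apply,
      ContinuousLinearMap.comp_apply, ContinuousLinearMap.flip_apply,
      zero_apply, map_zero, zero_add] at h4
    rw [h4, Function.comp_apply]
    ring
  have h0 := h.self_of_nhds
  simp only [eulerLagrange, hd, h0, map_add, add_apply, hF2s z p,
    hsymm (fderiv ℝ (fderiv ℝ F) x p z) (fderiv ℝ F x p)]
  ring

/-- The covector `z ↦ DG(x)[p](p, z) - ½ DG(x)[z](p, p)`. -/
noncomputable def forceForm (G : E → E →L[ℝ] E →L[ℝ] ℝ) (x p : E) : E →L[ℝ] ℝ :=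
  fderiv ℝ G x p p - (1 / 2 : ℝ) • (((fderiv ℝ G x).flip p).flip p)

/-- The acceleration for which the Euler–Lagrange expression vanishes. -/
noncomputable def eulerLagrangeAccel (G : E → E →L[ℝ] E →L[ℝ] ℝ) (x p : E) : E :=
  -(G x).inverse (forceForm G x p)

lemma eulerLagrange_eq (G : E → E →L[ℝ] E →L[ℝ] ℝ) (x p q z : E) :
    eulerLagrange G x p q z = G x q z + forceForm G x p z := by
  have h : forceForm G x p z = fderiv ℝ G x p p z - 1 / 2 * fderiv ℝ G x z p p := rfl
  rw [eulerLagrange, h, add_sub_assoc]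

lemma eq_eulerLagrangeAccel_iff {G : E → E →L[ℝ] E →L[ℝ] ℝ} {x : E} (hx : (G x).IsInvertible)
    {p q : E} :
    q = eulerLagrangeAccel G x p ↔ ∀ z, eulerLagrange G x p q z = 0 := by
  obtain ⟨L, hL⟩ := hx
  simp only [eulerLagrange_eq, eulerLagrangeAccel, ← hL, ContinuousLinearMap.inverse_equiv]
  constructor
  · rintro rfl z
    simp
  · intro h
    have h1 : L q + forceForm G x p = 0 := by
      ext z; exact h z
    rw [← map_neg, ← eq_neg_of_add_eq_zero_left h1]
    simp

lemma contDiffOn_eulerLagrangeAccel [FiniteDimensional ℝ E] {G : E → E →L[ℝ] E →L[ℝ] ℝ}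
    {U : Set E} (hU : IsOpen U) (hG : ContDiffOn ℝ ∞ G U) (hinv : ∀ x ∈ U, (G x).IsInvertible) :
    ContDiffOn ℝ ∞ (fun z : E × E => eulerLagrangeAccel G z.1 z.2) (U ×ˢ univ) := by
  have : CompleteSpace E := FiniteDimensional.complete ℝ E
  have h1 : ContDiffOn ℝ ∞ (fun z : E × E => G z.1) (U ×ˢ univ) :=
    hG.comp contDiffOn_fst fun z hz => hz.1
  have h2 : ContDiffOn ℝ ∞ (fun z : E × E => (G z.1).inverse) (U ×ˢ univ) := by
    intro z hz
    exact ((hinv z.1 hz.1).contDiffAt_map_inverse).comp_contDiffWithinAt z (h1 z hz)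
  have h3 : ContDiffOn ℝ ∞ (fun z : E × E => fderiv ℝ G z.1) (U ×ˢ univ) :=
    ContDiffOn.comp (g := fderiv ℝ G) (hG.fderiv_of_isOpen hU (m := ∞) (by simp))
      contDiffOn_fst fun z hz => hz.1
  have h4 : ContDiffOn ℝ ∞ (fun z : E × E => forceForm G z.1 z.2) (U ×ˢ univ) := by
    refine contDiffOn_clm_apply.2 fun a => ?_
    have h5 : ContDiffOn ℝ ∞ (fun z : E × E => fderiv ℝ G z.1 z.2 z.2 a -
        (1 / 2 : ℝ) * fderiv ℝ G z.1 a z.2 z.2) (U ×ˢ univ) :=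
      (((h3.clm_apply contDiffOn_snd).clm_apply contDiffOn_snd).clm_apply contDiffOn_const).sub
        (contDiffOn_const.mul
          (((h3.clm_apply contDiffOn_const).clm_apply contDiffOn_snd).clm_apply contDiffOn_snd))
    exact h5
  exact (h2.clm_apply h4).neg

end EulerLagrange

section ChartMetric

variable {n : ℕ} {M : Type*} [TopologicalSpace M] [ChartedSpace (EuclideanSpace ℝ (Fin n)) M]
  [IsManifold (𝓡 n) ∞ M] (g : SmoothMetric n M)

local notation "𝔼" => EuclideanSpace ℝ (Fin n)

variable {e e' : OpenPartialHomeomorph M (EuclideanSpace ℝ (Fin n))}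

/-- The derivative of the inverse of a chart, as a map on the model space: the tangent spaces of `M`
are, by definition, copies of the model space. -/
noncomputable def symmDeriv (e : OpenPartialHomeomorph M (EuclideanSpace ℝ (Fin n)))
    (x : EuclideanSpace ℝ (Fin n)) :
    EuclideanSpace ℝ (Fin n) →L[ℝ] EuclideanSpace ℝ (Fin n) :=
  mfderiv 𝓘(ℝ, 𝔼) (𝓡 n) e.symm x

/-- The metric in a chart. -/
noncomputable def chartMetric (e : OpenPartialHomeomorph M (EuclideanSpace ℝ (Fin n)))
    (x : EuclideanSpace ℝ (Fin n)) :
    EuclideanSpace ℝ (Fin n) →L[ℝ] EuclideanSpace ℝ (Fin n) →L[ℝ] ℝ :=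
  let B : 𝔼 →L[ℝ] 𝔼 →L[ℝ] ℝ := g.inner (e.symm x)
  B.bilinearComp (symmDeriv e x) (symmDeriv e x)

lemma chartMetric_apply (x a b : 𝔼) :
    chartMetric g e x a b = g.inner (e.symm x)
      (mfderiv 𝓘(ℝ, 𝔼) (𝓡 n) e.symm x a) (mfderiv 𝓘(ℝ, 𝔼) (𝓡 n) e.symm x b) := rfl

lemma chartMetric_symm (x a b : 𝔼) : chartMetric g e x a b = chartMetric g e x b a := by
  rw [chartMetric_apply, chartMetric_apply]
  exact g.symm (e.symm x) (symmDeriv e x a) (symmDeriv e x b)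

lemma symmDeriv_injective (he : e ∈ IsManifold.maximalAtlas (𝓡 n) ∞ M) {x : 𝔼}
    (hx : x ∈ e.target) : Function.Injective (symmDeriv e x) :=
  ((mdifferentiable_of_mem_maximalAtlas he).symm.mfderiv_injective hx)

lemma chartMetric_pos (he : e ∈ IsManifold.maximalAtlas (𝓡 n) ∞ M) {x : 𝔼}
    (hx : x ∈ e.target) {a : 𝔼} (ha : a ≠ 0) : 0 < chartMetric g e x a a := by
  rw [chartMetric_apply]
  refine g.pos (e.symm x) (symmDeriv e x a) fun h0 => ha ?_
  have : symmDeriv e x a = symmDeriv e x 0 := by rw [map_zero]; exact h0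
  exact symmDeriv_injective he hx this

lemma contMDiffOn_symm_const (he : e ∈ IsManifold.maximalAtlas (𝓡 n) ∞ M) (a : 𝔼) :
    ContMDiffOn 𝓘(ℝ, 𝔼) (𝓡 n).tangent ∞ (fun x : 𝔼 =>
      (⟨e.symm x, symmDeriv e x a⟩ : TangentBundle (𝓡 n) M)) e.target := by
  have h0 : ContMDiff (𝓡 n) (𝓡 n).tangent ∞ (fun x : 𝔼 => (⟨x, a⟩ : TangentBundle (𝓡 n) 𝔼)) :=
    contMDiff_vectorSpace_iff_contDiff.2 contDiff_const
  have h1 : ContMDiffOn (𝓡 n).tangent (𝓡 n).tangent ∞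
      (tangentMapWithin (𝓡 n) (𝓡 n) e.symm e.target)
      (TotalSpace.proj ⁻¹' e.target) :=
    (contMDiffOn_symm_of_mem_maximalAtlas he).contMDiffOn_tangentMapWithin
      (by simp) e.open_target.uniqueMDiffOn
  refine (h1.comp h0.contMDiffOn fun x hx => hx).congr fun x hx => ?_
  have := tangentMapWithin_eq_tangentMap (I := 𝓡 n) (I' := 𝓡 n) (f := e.symm) (s := e.target)
    (p := ⟨x, a⟩) (e.open_target.uniqueMDiffOn _ hx)
    ((mdifferentiable_of_mem_maximalAtlas he).mdifferentiableAt_symm hx)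
  exact this.symm

lemma contDiffOn_chartMetric (he : e ∈ IsManifold.maximalAtlas (𝓡 n) ∞ M) :
    ContDiffOn ℝ ∞ (chartMetric g e) e.target := by
  refine contDiffOn_clm_apply.2 fun a => contDiffOn_clm_apply.2 fun b => ?_
  let : RiemannianBundle (fun m : M => TangentSpace (𝓡 n) m) := ⟨g.toRiemannianMetric⟩
  have h1 := ContMDiffOn.inner_bundle (contMDiffOn_symm_const he a) (contMDiffOn_symm_const he b)
  rw [← contMDiffOn_iff_contDiffOn]
  exact h1

lemma chartMetric_chartChange (he : e ∈ IsManifold.maximalAtlas (𝓡 n) ∞ M)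
    (he' : e' ∈ IsManifold.maximalAtlas (𝓡 n) ∞ M) {x : 𝔼} (hx : x ∈ (chartChange e e').source)
    (a b : 𝔼) :
    chartMetric g e x a b = chartMetric g e' (chartChange e e' x)
      (fderiv ℝ (chartChange e e') x a) (fderiv ℝ (chartChange e e') x b) := by
  obtain ⟨hx1, hx2⟩ := mem_chartChange_source.1 hx
  have hd : fderiv ℝ (chartChange e e') x =
      (mfderiv (𝓡 n) 𝓘(ℝ, 𝔼) e' (e.symm x)).comp (mfderiv 𝓘(ℝ, 𝔼) (𝓡 n) e.symm x) := by
    rw [← mfderiv_eq_fderiv]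
    exact mfderiv_comp x ((mdifferentiable_of_mem_maximalAtlas he').mdifferentiableAt hx2)
      ((mdifferentiable_of_mem_maximalAtlas he).mdifferentiableAt_symm hx1)
  have h1 : ∀ a, symmDeriv e' (chartChange e e' x) (fderiv ℝ (chartChange e e') x a) =
      symmDeriv e x a := by
    intro a
    rw [hd]
    exact DFunLike.congr_fun ((mdifferentiable_of_mem_maximalAtlas he').symm_comp_deriv hx2)
      (symmDeriv e x a)
  have h2 : e'.symm (chartChange e e' x) = e.symm x := e'.left_inv hx2
  have h3 : ∀ (m m' : M) (u v : 𝔼), m = m' → (g.inner m : 𝔼 →L[ℝ] 𝔼 →L[ℝ] ℝ) u v =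
      (g.inner m' : 𝔼 →L[ℝ] 𝔼 →L[ℝ] ℝ) u v := by
    rintro m _ u v rfl; rfl
  change (g.inner (e.symm x) : 𝔼 →L[ℝ] 𝔼 →L[ℝ] ℝ) (symmDeriv e x a) (symmDeriv e x b) =
    (g.inner (e'.symm (chartChange e e' x)) : 𝔼 →L[ℝ] 𝔼 →L[ℝ] ℝ)
      (symmDeriv e' (chartChange e e' x) (fderiv ℝ (chartChange e e') x a))
      (symmDeriv e' (chartChange e e' x) (fderiv ℝ (chartChange e e') x b))
  rw [h1, h1]
  exact h3 _ _ _ _ h2.symm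

lemma isInvertible_chartMetric (he : e ∈ IsManifold.maximalAtlas (𝓡 n) ∞ M) {x : 𝔼}
    (hx : x ∈ e.target) : (chartMetric g e x).IsInvertible := by
  have hinj : Function.Injective (chartMetric g e x : 𝔼 →ₗ[ℝ] 𝔼 →L[ℝ] ℝ) := by
    rw [← LinearMap.ker_eq_bot, LinearMap.ker_eq_bot']
    intro a ha
    by_contra h0
    have h1 := chartMetric_pos g he hx h0
    have h2 : chartMetric g e x a = 0 := ha
    rw [h2] at h1
    simp at h1
  have hfin : Module.finrank ℝ 𝔼 = Module.finrank ℝ (𝔼 →L[ℝ] ℝ) := by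
    rw [← (LinearMap.toContinuousLinearMap (𝕜 := ℝ) (E := 𝔼) (F' := ℝ)).finrank_eq]
    exact (Subspace.dual_finrank_eq (K := ℝ) (V := 𝔼)).symm
  refine ⟨(LinearMap.linearEquivOfInjective _ hinj hfin).toContinuousLinearEquiv, ?_⟩
  ext a b
  rfl

/-- The acceleration of a geodesic with position `x` and velocity `p` in a chart. -/
noncomputable def geodesicAccel (e : OpenPartialHomeomorph M (EuclideanSpace ℝ (Fin n)))
    (x p : EuclideanSpace ℝ (Fin n)) : EuclideanSpace ℝ (Fin n) :=
  eulerLagrangeAccel (chartMetric g e) x p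

lemma eq_geodesicAccel_iff (he : e ∈ IsManifold.maximalAtlas (𝓡 n) ∞ M) {x : 𝔼}
    (hx : x ∈ e.target) {p q : 𝔼} :
    q = geodesicAccel g e x p ↔ ∀ z, eulerLagrange (chartMetric g e) x p q z = 0 :=
  eq_eulerLagrangeAccel_iff (isInvertible_chartMetric g he hx)

lemma contDiffOn_geodesicAccel (he : e ∈ IsManifold.maximalAtlas (𝓡 n) ∞ M) :
    ContDiffOn ℝ ∞ (fun z : 𝔼 × 𝔼 => geodesicAccel g e z.1 z.2) (e.target ×ˢ univ) :=
  contDiffOn_eulerLagrangeAccel e.open_target (contDiffOn_chartMetric g he)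
    fun _ hx => isInvertible_chartMetric g he hx

lemma sum_smul_single (p : 𝔼) : ∑ i, p i • EuclideanSpace.single i (1 : ℝ) = p := by
  ext j
  simp [Pi.single_apply]

lemma metricMatrix_apply (x : 𝔼) (i j : Fin n) : metricMatrix g e x i j =
    chartMetric g e x (EuclideanSpace.single i 1) (EuclideanSpace.single j 1) := rfl

lemma dMetric_eq (he : e ∈ IsManifold.maximalAtlas (𝓡 n) ∞ M) {x : 𝔼} (hx : x ∈ e.target)
    (l i j : Fin n) : dMetric g e x l i j = fderiv ℝ (chartMetric g e) x
      (EuclideanSpace.single l 1) (EuclideanSpace.single i 1) (EuclideanSpace.single j 1) := by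
  have hG : DifferentiableAt ℝ (chartMetric g e) x :=
    ((contDiffOn_chartMetric g he).contDiffAt (e.open_target.mem_nhds hx)).differentiableAt
      (by simp)
  have h1 := (hG.hasFDerivAt.clm_apply (hasFDerivAt_const (EuclideanSpace.single i (1 : ℝ) : 𝔼) x)).clm_apply
    (hasFDerivAt_const (EuclideanSpace.single j (1 : ℝ) : 𝔼) x)
  have h2 : fderiv ℝ (fun y => metricMatrix g e y i j) x = _ := h1.fderiv
  rw [dMetric, h2]
  simp

lemma isUnit_det_metricMatrix (he : e ∈ IsManifold.maximalAtlas (𝓡 n) ∞ M) {x : 𝔼}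
    (hx : x ∈ e.target) : IsUnit (metricMatrix g e x).det := by
  rw [isUnit_iff_ne_zero]
  intro h0
  obtain ⟨v, hv, hv0⟩ := Matrix.exists_mulVec_eq_zero_iff.2 h0
  have hv' : (WithLp.toLp 2 v : 𝔼) ≠ 0 := by
    intro h
    apply hv
    ext i
    exact congrArg (fun z : 𝔼 => z i) h
  have h1 := chartMetric_pos g he hx hv'
  have h2 : chartMetric g e x (WithLp.toLp 2 v) (WithLp.toLp 2 v) =
      ∑ i, v i * (Matrix.mulVec (metricMatrix g e x) v) i := by
    conv_lhs => rw [← sum_smul_single (WithLp.toLp 2 v : 𝔼)]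
    simp only [map_sum, map_smul, sum_apply, smul_apply,
      smul_eq_mul, Matrix.mulVec, dotProduct, metricMatrix_apply, Finset.mul_sum]
    rw [Finset.sum_comm]
    exact Finset.sum_congr rfl fun i _ => Finset.sum_congr rfl fun j _ => by ring
  rw [h2, hv0] at h1
  simp at h1

/-- In coordinates, the Euler–Lagrange expression is that of the geodesic equation with its index
lowered. -/
lemma eulerLagrange_single (he : e ∈ IsManifold.maximalAtlas (𝓡 n) ∞ M) {x : 𝔼}
    (hx : x ∈ e.target) (p q : 𝔼) (l : Fin n) :
    eulerLagrange (chartMetric g e) x p q (EuclideanSpace.single l 1) =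
      ∑ k, metricMatrix g e x l k * q k + (1 / 2 : ℝ) * ∑ i, ∑ j,
        (dMetric g e x i j l + dMetric g e x j i l - dMetric g e x l i j) * (p i * p j) := by
  have h1 : chartMetric g e x q (EuclideanSpace.single l 1) = ∑ k, metricMatrix g e x l k * q k := by
    conv_lhs => rw [chartMetric_symm, ← sum_smul_single q]
    simp [map_sum, metricMatrix_apply, mul_comm]
  have h2 : fderiv ℝ (chartMetric g e) x p p (EuclideanSpace.single l 1) =
      ∑ i, ∑ j, dMetric g e x i j l * (p i * p j) := by
    conv_lhs => rw [← sum_smul_single p]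
    simp only [map_sum, map_smul, sum_apply, smul_apply,
      smul_eq_mul, dMetric_eq g he hx, Finset.mul_sum]
    rw [Finset.sum_comm]
    exact Finset.sum_congr rfl fun i _ => Finset.sum_congr rfl fun j _ => by ring
  have h3 : fderiv ℝ (chartMetric g e) x (EuclideanSpace.single l 1) p p =
      ∑ i, ∑ j, dMetric g e x l i j * (p i * p j) := by
    conv_lhs => rw [← sum_smul_single p]
    simp only [map_sum, map_smul, sum_apply, smul_apply,
      smul_eq_mul, dMetric_eq g he hx, Finset.mul_sum]
    rw [Finset.sum_comm]
    exact Finset.sum_congr rfl fun i _ => Finset.sum_congr rfl fun j _ => by ring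
  have h4 : ∑ i, ∑ j, dMetric g e x j i l * (p i * p j) =
      ∑ i, ∑ j, dMetric g e x i j l * (p i * p j) := by
    rw [Finset.sum_comm]
    exact Finset.sum_congr rfl fun i _ => Finset.sum_congr rfl fun j _ => by ring
  rw [eulerLagrange, h1, h2, h3]
  simp only [add_mul, sub_mul, Finset.sum_add_distrib, Finset.sum_sub_distrib, h4]
  ring

/-- The equation with Christoffel symbols is the Euler–Lagrange equation. -/
lemma christoffel_iff (he : e ∈ IsManifold.maximalAtlas (𝓡 n) ∞ M) {x : 𝔼} (hx : x ∈ e.target)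
    {p q : 𝔼} :
    (∀ k, q k + ∑ i, ∑ j, christoffel g e x k i j * p i * p j = 0) ↔
      q = geodesicAccel g e x p := by
  have hdet := isUnit_det_metricMatrix g he hx
  set u : Fin n → ℝ := fun l => eulerLagrange (chartMetric g e) x p q (EuclideanSpace.single l 1)
    with hu
  have h1 : ∀ k, q k + ∑ i, ∑ j, christoffel g e x k i j * p i * p j =
      Matrix.mulVec (metricMatrix g e x)⁻¹ u k := by
    intro k
    have h2 : u = Matrix.mulVec (metricMatrix g e x) (fun k => q k) + fun l => (1 / 2 : ℝ) *
        ∑ i, ∑ j, (dMetric g e x i j l + dMetric g e x j i l - dMetric g e x l i j)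
          * (p i * p j) := by
      ext l
      rw [hu]
      simp only [eulerLagrange_single g he hx]
      rfl
    rw [h2, Matrix.mulVec_add, Matrix.mulVec_mulVec, Matrix.nonsing_inv_mul _ hdet,
      Matrix.one_mulVec, Pi.add_apply]
    congr 1
    simp only [christoffel, Matrix.mulVec, dotProduct, Finset.mul_sum, Finset.sum_mul]
    rw [Finset.sum_comm' (t' := Finset.univ) (s' := fun _ => Finset.univ) (by simp)]
    conv_rhs => rw [Finset.sum_comm]
    rw [Finset.sum_comm]
    refine Finset.sum_congr rfl fun i _ => ?_
    rw [Finset.sum_comm]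
    conv_rhs => rw [Finset.sum_comm]
    conv_lhs => rw [Finset.sum_comm]
    exact Finset.sum_congr rfl fun j _ => Finset.sum_congr rfl fun l _ => by ring
  rw [eq_geodesicAccel_iff g he hx]
  simp only [h1]
  constructor
  · intro h z
    have h3 : Matrix.mulVec (metricMatrix g e x)⁻¹ u = 0 := funext h
    have h4 : u = 0 := by
      have := congrArg (Matrix.mulVec (metricMatrix g e x)) h3
      rwa [Matrix.mulVec_mulVec, Matrix.mul_nonsing_inv _ hdet, Matrix.one_mulVec,
        Matrix.mulVec_zero] at this
    rw [eulerLagrange_eq, ← add_apply]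
    conv_lhs => rw [← sum_smul_single z]
    rw [map_sum]
    refine Finset.sum_eq_zero fun l _ => ?_
    rw [map_smul, add_apply, ← eulerLagrange_eq]
    have : u l = 0 := congrFun h4 l
    rw [hu] at this
    simp only at this
    rw [this, smul_zero]
  · intro h k
    have : u = 0 := funext fun l => h _
    rw [this, Matrix.mulVec_zero]
    rfl

/-- The behaviour of the geodesic acceleration under a change of charts. -/
lemma geodesicAccel_chartChange (he : e ∈ IsManifold.maximalAtlas (𝓡 n) ∞ M)
    (he' : e' ∈ IsManifold.maximalAtlas (𝓡 n) ∞ M) {x : 𝔼} (hx : x ∈ (chartChange e e').source)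
    (p : 𝔼) :
    geodesicAccel g e' (chartChange e e' x) (fderiv ℝ (chartChange e e') x p) =
      fderiv ℝ (chartChange e e') x (geodesicAccel g e x p) +
        fderiv ℝ (fderiv ℝ (chartChange e e')) x p p := by
  obtain ⟨hx1, hx2⟩ := mem_chartChange_source.1 hx
  have hy : chartChange e e' x ∈ e'.target := e'.map_source hx2
  symm
  rw [eq_geodesicAccel_iff g he' hy]
  intro z
  have hs : x ∈ (chartChange e e').source := hx
  have hdiff : ∀ {e : OpenPartialHomeomorph M 𝔼}, e ∈ IsManifold.maximalAtlas (𝓡 n) ∞ M →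
      ∀ {x}, x ∈ e.target → DifferentiableAt ℝ (chartMetric g e) x := fun he x hx =>
    ((contDiffOn_chartMetric g he).contDiffAt
      (OpenPartialHomeomorph.open_target _ |>.mem_nhds hx)).differentiableAt (by simp)
  -- the derivative of the change of charts is onto, with the derivative of its inverse as section
  have hsurj : fderiv ℝ (chartChange e e') x
      (fderiv ℝ (chartChange e' e) (chartChange e e' x) z) = z := by
    have h1 : x = chartChange e' e (chartChange e e' x) := by
      change x = e.symm.symm (e'.symm (e' (e.symm x)))
      rw [e'.left_inv hx2]
      exact (e.right_inv hx1).symm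
    have hys : chartChange e e' x ∈ (chartChange e' e).source := by
      refine mem_chartChange_source.2 ⟨hy, ?_⟩
      have h5 : e'.symm (chartChange e e' x) = e.symm x := e'.left_inv hx2
      rw [h5]
      exact e.map_target hx1
    have h2 : HasFDerivAt (chartChange e e') (fderiv ℝ (chartChange e e') x)
        (chartChange e' e (chartChange e e' x)) := by
      rw [← h1]
      exact ((contDiffAt_chartChange he he' hx).differentiableAt (by simp)).hasFDerivAt
    have h3 := h2.comp _
      ((contDiffAt_chartChange he' he hys).differentiableAt (by simp)).hasFDerivAt
    have h4 : chartChange e e' ∘ chartChange e' e =ᶠ[𝓝 (chartChange e e' x)] id := by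
      filter_upwards [(chartChange e' e).open_source.mem_nhds hys] with y hy
      obtain ⟨h5, h6⟩ := mem_chartChange_source.1 hy
      change e' (e.symm (e (e'.symm y))) = y
      rw [e.left_inv h6, e'.right_inv h5]
    have h5 := h3.unique ((hasFDerivAt_id _).congr_of_eventuallyEq h4)
    exact DFunLike.congr_fun h5 z
  have h1 := eulerLagrange_comp (G := chartMetric g e) (G' := chartMetric g e')
    (F := chartChange e e') (x := x)
    ((contDiffAt_chartChange he he' hx).of_le (by norm_cast))
    (hdiff he' hy) (hdiff he hx1) (fun a b => chartMetric_symm g _ a b)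
    (by
      filter_upwards [(chartChange e e').open_source.mem_nhds hx] with y hy a b
      exact chartMetric_chartChange g he he' hy a b) p (geodesicAccel g e x p)
    (fderiv ℝ (chartChange e' e) (chartChange e e' x) z)
  rw [hsurj] at h1
  rw [← h1]
  exact (eq_geodesicAccel_iff g he hx1).1 rfl _

end ChartMetric

/-! ### Geodesics and the exponential map in charts -/

section Geodesics

variable {n : ℕ} {M : Type*} [TopologicalSpace M] [ChartedSpace (EuclideanSpace ℝ (Fin n)) M]
  [IsManifold (𝓡 n) ∞ M] {g : SmoothMetric n M}

local notation "𝔼" => EuclideanSpace ℝ (Fin n)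

variable {e : OpenPartialHomeomorph M (EuclideanSpace ℝ (Fin n))}

/-- A solution of the geodesic equation in one chart is a geodesic. -/
lemma isGeodesicOn_of_chart (he : e ∈ IsManifold.maximalAtlas (𝓡 n) ∞ M) {s : Set ℝ}
    (hs : IsOpen s) {c p : ℝ → 𝔼} (hce : ∀ t ∈ s, c t ∈ e.target)
    (hc : ∀ t ∈ s, HasDerivAt c (p t) t)
    (hp : ∀ t ∈ s, HasDerivAt p (geodesicAccel g e (c t) (p t)) t) :
    IsGeodesicOn g (fun t => e.symm (c t)) s := by
  have hcc : ContinuousOn c s := fun t ht => (hc t ht).continuousAt.continuousWithinAt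
  have hpc : ContinuousOn p s := fun t ht => (hp t ht).continuousAt.continuousWithinAt
  have hp1 : ContDiffOn ℝ 1 p s := by
    rw [show (1 : WithTop ℕ∞) = 0 + 1 from rfl, contDiffOn_succ_iff_deriv_of_isOpen hs]
    refine ⟨fun t ht => (hp t ht).differentiableAt.differentiableWithinAt, by simp, ?_⟩
    rw [contDiffOn_zero]
    refine ((contDiffOn_geodesicAccel g he).continuousOn.comp (hcc.prodMk hpc)
      fun t ht => ⟨hce t ht, mem_univ _⟩).congr fun t ht => (hp t ht).deriv
  have hc2 : ContDiffOn ℝ 2 c s := by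
    rw [show (2 : WithTop ℕ∞) = 1 + 1 by norm_num, contDiffOn_succ_iff_deriv_of_isOpen hs]
    exact ⟨fun t ht => (hc t ht).differentiableAt.differentiableWithinAt, by simp,
      hp1.congr fun t ht => (hc t ht).deriv⟩
  refine ⟨?_, fun t ht e' he' hte' => ?_⟩
  · exact ((contMDiffOn_symm_of_mem_maximalAtlas he).of_le (by norm_cast)).comp
      (contMDiffOn_iff_contDiffOn.2 hc2) hce
  · have hx : c t ∈ (chartChange e e').source := mem_chartChange_source.2 ⟨hce t ht, hte'⟩
    have hF := contDiffAt_chartChange he he' hx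
    have hd : ∀ᶠ τ in 𝓝 t, deriv (fun τ => e' (e.symm (c τ))) τ =
        fderiv ℝ (chartChange e e') (c τ) (p τ) := by
      have h1 : ∀ᶠ τ in 𝓝 t, c τ ∈ (chartChange e e').source :=
        (hc t ht).continuousAt.eventually ((chartChange e e').open_source.mem_nhds hx)
      filter_upwards [h1, hs.mem_nhds ht] with τ hτ hτs
      exact (((contDiffAt_chartChange he he' hτ).differentiableAt
        (by simp)).hasFDerivAt.comp_hasDerivAt τ (hc τ hτs)).deriv
    have hd2 : deriv (deriv (fun τ => e' (e.symm (c τ)))) t =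
        fderiv ℝ (chartChange e e') (c t) (geodesicAccel g e (c t) (p t)) +
          fderiv ℝ (fderiv ℝ (chartChange e e')) (c t) (p t) (p t) := by
      rw [Filter.EventuallyEq.deriv_eq hd]
      have h1 : HasFDerivAt (fderiv ℝ (chartChange e e'))
          (fderiv ℝ (fderiv ℝ (chartChange e e')) (c t)) (c t) :=
        ((hF.fderiv_right (m := 1) (by norm_cast)).differentiableAt (by simp)).hasFDerivAt
      rw [add_comm]
      exact ((h1.comp_hasDerivAt t (hc t ht)).clm_apply (hp t ht)).deriv
    have hy : e' (e.symm (c t)) ∈ e'.target := e'.map_source hte'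
    refine (christoffel_iff g he' hy).2 ?_
    rw [hd2, hd.self_of_nhds]
    exact (geodesicAccel_chartChange g he he' hx (p t)).symm

lemma IsGeodesicOn.eventually_hasDerivAt {γ : ℝ → M} {s : Set ℝ} (hγ : IsGeodesicOn g γ s)
    (hs : IsOpen s) (he : e ∈ IsManifold.maximalAtlas (𝓡 n) ∞ M) {t₀ : ℝ} (ht₀ : t₀ ∈ s)
    (h₀ : γ t₀ ∈ e.source) :
    ∀ᶠ t in 𝓝 t₀, e (γ t) ∈ e.target ∧
      HasDerivAt (fun t => e (γ t)) (deriv (fun t => e (γ t)) t) t ∧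
      HasDerivAt (deriv (fun t => e (γ t)))
        (geodesicAccel g e (e (γ t)) (deriv (fun t => e (γ t)) t)) t := by
  have hc : ContinuousAt γ t₀ := (hγ.1.continuousOn).continuousAt (hs.mem_nhds ht₀)
  have h1 : ∀ᶠ t in 𝓝 t₀, γ t ∈ e.source := hc.eventually (e.open_source.mem_nhds h₀)
  filter_upwards [h1, hs.mem_nhds ht₀] with t ht hts
  have h2 : ContDiffAt ℝ 2 (fun t => e (γ t)) t := by
    rw [← contMDiffAt_iff_contDiffAt]
    exact ((contMDiffAt_of_mem_maximalAtlas he ht).of_le (by norm_cast)).comp t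
      (hγ.1.contMDiffAt (hs.mem_nhds hts))
  refine ⟨e.map_source ht, (h2.differentiableAt (by simp)).hasDerivAt, ?_⟩
  have h3 : DifferentiableAt ℝ (deriv (fun t => e (γ t))) t :=
    ((h2.fderiv_right (m := 1) (by norm_num)).differentiableAt (by simp)).clm_apply
      (differentiableAt_const (1 : ℝ))
  have h4 := (christoffel_iff g he (e.map_source ht)).1 (hγ.2 t hts e he ht)
  rw [← h4]
  exact h3.hasDerivAt

/-- Local uniqueness of geodesics, from that of solutions of differential equations. -/
lemma IsGeodesicOn.eventuallyEq {γ₁ γ₂ : ℝ → M} {s : Set ℝ} (h₁ : IsGeodesicOn g γ₁ s)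
    (h₂ : IsGeodesicOn g γ₂ s)
    (hs : IsOpen s) (he : e ∈ IsManifold.maximalAtlas (𝓡 n) ∞ M) {t₀ : ℝ} (ht₀ : t₀ ∈ s)
    (h₀ : γ₁ t₀ ∈ e.source) (heq : γ₁ t₀ = γ₂ t₀)
    (hdeq : deriv (fun t => e (γ₁ t)) t₀ = deriv (fun t => e (γ₂ t)) t₀) :
    γ₁ =ᶠ[𝓝 t₀] γ₂ := by
  have h₀' : γ₂ t₀ ∈ e.source := heq ▸ h₀
  have d₁ := h₁.eventually_hasDerivAt hs he ht₀ h₀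
  have d₂ := h₂.eventually_hasDerivAt hs he ht₀ h₀'
  have hf : ContDiffAt ℝ 1 (fun z : 𝔼 × 𝔼 => (z.2, geodesicAccel g e z.1 z.2))
      (e (γ₁ t₀), deriv (fun t => e (γ₁ t)) t₀) := by
    refine contDiffAt_snd.prodMk (((contDiffOn_geodesicAccel g he).contDiffAt ?_).of_le
      (by norm_cast))
    exact (e.open_target.prod isOpen_univ).mem_nhds ⟨e.map_source h₀, mem_univ _⟩
  obtain ⟨K, U, hU, hK⟩ := hf.exists_lipschitzOnWith
  have c₁ : ContinuousAt (fun t => (e (γ₁ t), deriv (fun t => e (γ₁ t)) t)) t₀ :=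
    d₁.self_of_nhds.2.1.continuousAt.prodMk d₁.self_of_nhds.2.2.continuousAt
  have c₂ : ContinuousAt (fun t => (e (γ₂ t), deriv (fun t => e (γ₂ t)) t)) t₀ :=
    d₂.self_of_nhds.2.1.continuousAt.prodMk d₂.self_of_nhds.2.2.continuousAt
  have hpt : (e (γ₁ t₀), deriv (fun t => e (γ₁ t)) t₀) =
      (e (γ₂ t₀), deriv (fun t => e (γ₂ t)) t₀) := by rw [hdeq, heq]
  have hU₂ : U ∈ 𝓝 (e (γ₂ t₀), deriv (fun t => e (γ₂ t)) t₀) := hpt ▸ hU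
  have key := ODE_solution_unique_of_eventually (K := K)
    (v := fun _ z => (z.2, geodesicAccel g e z.1 z.2)) (s := fun _ => U) (t₀ := t₀)
    (f := fun t => (e (γ₁ t), deriv (fun t => e (γ₁ t)) t))
    (g := fun t => (e (γ₂ t), deriv (fun t => e (γ₂ t)) t))
    (Filter.Eventually.of_forall fun _ => hK)
    (by
      filter_upwards [d₁, c₁.eventually hU] with t h1 h2
      exact ⟨h1.2.1.prodMk h1.2.2, h2⟩)
    (by
      filter_upwards [d₂, c₂.eventually hU₂] with t h1 h2
      exact ⟨h1.2.1.prodMk h1.2.2, h2⟩) hpt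
  have k₁ := (h₁.1.continuousOn.continuousAt (hs.mem_nhds ht₀)).eventually
    (e.open_source.mem_nhds h₀)
  have k₂ := (h₂.1.continuousOn.continuousAt (hs.mem_nhds ht₀)).eventually
    (e.open_source.mem_nhds h₀')
  filter_upwards [key, k₁, k₂] with t h1 h2 h3
  exact e.injOn h2 h3 (congrArg Prod.fst h1)

/-- The coordinates of the velocity of a curve. -/
lemma deriv_chart_eq (he : e ∈ IsManifold.maximalAtlas (𝓡 n) ∞ M) {γ : ℝ → M} {t : ℝ}
    (hγ : MDifferentiableAt 𝓘(ℝ, ℝ) (𝓡 n) γ t) (ht : γ t ∈ e.source) :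
    deriv (fun τ => e (γ τ)) t =
      (tangentMap (𝓡 n) (𝓡 n) e ⟨γ t, mfderiv 𝓘(ℝ, ℝ) (𝓡 n) γ t (1 : ℝ)⟩).2 := by
  have h1 := mfderiv_comp (I'' := 𝓡 n) t
    ((mdifferentiable_of_mem_maximalAtlas he).mdifferentiableAt ht) hγ
  have h2 : mfderiv 𝓘(ℝ, ℝ) (𝓡 n) (e ∘ γ) t = fderiv ℝ (e ∘ γ) t := mfderiv_eq_fderiv
  rw [h2] at h1
  rw [← fderiv_apply_one_eq_deriv]
  exact DFunLike.congr_fun h1 (1 : ℝ)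

variable [T2Space M]

/-- Geodesics are determined by their initial velocity. -/
lemma IsGeodesicFrom.apply_one_eq {m : M} {ξ : TangentSpace (𝓡 n) m} {γ₁ γ₂ : ℝ → M}
    (h₁ : IsGeodesicFrom g m ξ γ₁) (h₂ : IsGeodesicFrom g m ξ γ₂) : γ₁ 1 = γ₂ 1 := by
  obtain ⟨⟨ε₁, hε₁, g₁⟩, i₁⟩ := h₁
  obtain ⟨⟨ε₂, hε₂, g₂⟩, i₂⟩ := h₂
  set ε := min ε₁ ε₂ with hε
  have hε0 : 0 < ε := lt_min hε₁ hε₂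
  set s := Ioo (-ε) (1 + ε) with hs
  have hso : IsOpen s := isOpen_Ioo
  have hsub : ∀ {ε' : ℝ}, ε ≤ ε' → s ⊆ Ioo (-ε') (1 + ε') := fun h =>
    Ioo_subset_Ioo (by linarith) (by linarith)
  have G₁ : IsGeodesicOn g γ₁ s := ⟨g₁.1.mono (hsub (min_le_left _ _)),
    fun t ht => g₁.2 t (hsub (min_le_left _ _) ht)⟩
  have G₂ : IsGeodesicOn g γ₂ s := ⟨g₂.1.mono (hsub (min_le_right _ _)),
    fun t ht => g₂.2 t (hsub (min_le_right _ _) ht)⟩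
  have hIs : Icc (0 : ℝ) 1 ⊆ s := fun t ht => ⟨by linarith [ht.1], by linarith [ht.2]⟩
  have hmd : ∀ {γ : ℝ → M}, IsGeodesicOn g γ s → ∀ t ∈ s,
      MDifferentiableAt 𝓘(ℝ, ℝ) (𝓡 n) γ t := fun hγ t ht =>
    (hγ.1.contMDiffAt (hso.mem_nhds ht)).mdifferentiableAt (by simp)
  have hch : ∀ m : M, chartAt 𝔼 m ∈ IsManifold.maximalAtlas (𝓡 n) ∞ M := fun m =>
    IsManifold.chart_mem_maximalAtlas m
  -- the set where the geodesics agree with all derivatives is open and closed in `[0, 1]`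
  set u : Set ℝ := {t | γ₁ =ᶠ[𝓝 t] γ₂} with hu
  have huo : IsOpen u := isOpen_setOfPred_eventually_nhds
  have key : Icc (0 : ℝ) 1 ⊆ u := by
    refine isPreconnected_Icc.subset_of_closure_inter_subset huo ⟨0, by simp, ?_⟩ ?_
    · have h0 : (0 : ℝ) ∈ s := hIs (by simp)
      have hi := i₁.trans i₂.symm
      have h0e : γ₁ 0 = γ₂ 0 := congrArg TotalSpace.proj hi
      have hsrc : γ₁ 0 ∈ (chartAt 𝔼 (γ₁ 0)).source := mem_chart_source _ _
      refine G₁.eventuallyEq G₂ hso (hch (γ₁ 0)) h0 hsrc h0e ?_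
      rw [deriv_chart_eq (hch _) (hmd G₁ 0 h0) hsrc,
        deriv_chart_eq (hch _) (hmd G₂ 0 h0) (h0e ▸ hsrc)]
      exact congrArg (fun z => ((tangentMap (𝓡 n) (𝓡 n) (chartAt 𝔼 (γ₁ 0)) z).2 : 𝔼)) hi
    · rintro t ⟨htu, ht⟩
      have hts := hIs ht
      have hfr : ∃ᶠ τ in 𝓝 t, τ ∈ u := mem_closure_iff_frequently.1 htu
      have c₁ := G₁.1.continuousOn.continuousAt (hso.mem_nhds hts)
      have c₂ := G₂.1.continuousOn.continuousAt (hso.mem_nhds hts)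
      have heq : γ₁ t = γ₂ t := by
        by_contra hne
        obtain ⟨U, V, hU, hV, h1, h2, h3⟩ := t2_separation hne
        obtain ⟨τ, hτ, h4, h5⟩ := (hfr.and_eventually ((c₁.eventually (hU.mem_nhds h1)).and
          (c₂.eventually (hV.mem_nhds h2)))).exists
        have h6 : γ₁ τ = γ₂ τ := hτ.self_of_nhds
        exact (disjoint_left.1 h3) h4 (h6 ▸ h5)
      have hsrc : γ₁ t ∈ (chartAt 𝔼 (γ₁ t)).source := mem_chart_source _ _
      refine G₁.eventuallyEq G₂ hso (hch (γ₁ t)) hts hsrc heq ?_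
      have d₁ := (G₁.eventually_hasDerivAt hso (hch (γ₁ t)) hts hsrc).self_of_nhds
      have d₂ := (G₂.eventually_hasDerivAt hso (hch (γ₁ t)) hts (heq ▸ hsrc)).self_of_nhds
      by_contra hne
      obtain ⟨U, V, hU, hV, h1, h2, h3⟩ := t2_separation hne
      obtain ⟨τ, hτ, h4, h5⟩ := (hfr.and_eventually
        ((d₁.2.2.continuousAt.eventually (hU.mem_nhds h1)).and
          (d₂.2.2.continuousAt.eventually (hV.mem_nhds h2)))).exists
      have hτ' : γ₁ =ᶠ[𝓝 τ] γ₂ := hτ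
      have h6 : deriv (fun t' => (chartAt 𝔼 (γ₁ t)) (γ₁ t')) τ =
          deriv (fun t' => (chartAt 𝔼 (γ₁ t)) (γ₂ t')) τ :=
        Filter.EventuallyEq.deriv_eq (hτ'.mono fun x hx => congrArg (chartAt 𝔼 (γ₁ t)) hx)
      exact (disjoint_left.1 h3) h4 (h6 ▸ h5)
  exact (key (by simp : (1 : ℝ) ∈ Icc (0 : ℝ) 1)).self_of_nhds

/-- The choice of a geodesic in the definition of `rexp` does not matter. -/
lemma IsGeodesicFrom.rexp_eq {m : M} {ξ : TangentSpace (𝓡 n) m} {γ : ℝ → M}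
    (h : IsGeodesicFrom g m ξ γ) : rexp g m ξ = γ 1 := by
  have H : ∃ γ : ℝ → M, IsGeodesicFrom g m ξ γ := ⟨γ, h⟩
  rw [rexp, dif_pos H]
  exact H.choose_spec.apply_one_eq h

/-- The right-hand side of the geodesic equation is quadratic in the velocity, so it vanishes to
second order at the zero velocity. -/
lemma geodesicAccel_smul (x p : 𝔼) (t : ℝ) :
    geodesicAccel g e x (t • p) = t ^ 2 • geodesicAccel g e x p := by
  have h : forceForm (chartMetric g e) x (t • p) = t ^ 2 • forceForm (chartMetric g e) x p := by
    ext z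
    simp only [forceForm, map_smul, sub_apply, smul_apply, smul_eq_mul,
      ContinuousLinearMap.flip_apply]
    ring
  rw [geodesicAccel, geodesicAccel, eulerLagrangeAccel, eulerLagrangeAccel, h, map_smul, smul_neg]

/-- The exponential map in a chart, near the zero vector at a given point. -/
theorem exists_rexp_chart (g : SmoothMetric n M) (he : e ∈ IsManifold.maximalAtlas (𝓡 n) ∞ M)
    {x₀ : 𝔼} (hx₀ : x₀ ∈ e.target) : ∃ X : 𝔼 × 𝔼 → 𝔼,
    HasFDerivAt X (ContinuousLinearMap.fst ℝ 𝔼 𝔼 + ContinuousLinearMap.snd ℝ 𝔼 𝔼) (x₀, 0) ∧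
    ∀ᶠ z in 𝓝 (x₀, (0 : 𝔼)), ContDiffAt ℝ ∞ X z ∧ z.1 ∈ e.target ∧ X z ∈ e.target ∧
      (z.2 = 0 → X z = z.1) ∧
      rexp g (e.symm z.1) (mfderiv 𝓘(ℝ, 𝔼) (𝓡 n) e.symm z.1 z.2) = e.symm (X z) := by
  obtain ⟨d, hd, hde⟩ := Metric.isOpen_iff.1 e.open_target x₀ hx₀
  -- cut off the geodesic equation outside the chart
  let χ : ContDiffBump x₀ := ⟨d / 4, d / 2, by linarith, by linarith⟩
  set a : 𝔼 × 𝔼 → 𝔼 := fun z => χ z.1 • geodesicAccel g e z.1 z.2 with ha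
  have has : ContDiff ℝ ∞ a := by
    rw [contDiff_iff_contDiffAt]
    intro z
    by_cases hz : z.1 ∈ e.target
    · refine ContDiffAt.smul (χ.contDiffAt.comp z contDiffAt_fst) ?_
      exact (contDiffOn_geodesicAccel g he).contDiffAt
        ((e.open_target.prod isOpen_univ).mem_nhds ⟨hz, mem_univ _⟩)
    · have h1 : z.1 ∈ (tsupport χ)ᶜ := by
        rw [χ.tsupport_eq]
        intro h2
        refine hz (hde (Metric.closedBall_subset_ball ?_ h2))
        change d / 2 < d
        linarith
      refine (contDiffAt_const (c := 0)).congr_of_eventuallyEq ?_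
      filter_upwards [continuous_fst.continuousAt.eventually
        ((isClosed_tsupport χ).isOpen_compl.mem_nhds h1)] with y hy
      have : χ y.1 = 0 := image_eq_zero_of_notMem_tsupport hy
      simp [ha, this]
  have ha0 : ∀ x, a (x, 0) = 0 := by
    intro x
    have := geodesicAccel_smul (g := g) (e := e) x 0 0
    simp only [smul_zero, ne_eq, OfNat.ofNat_ne_zero, not_false_eq_true, zero_pow, zero_smul] at this
    simp [ha, this]
  -- `a` is constant in the directions `(ξ, 0)` and quadratic in the directions `(0, η)`
  have had : fderiv ℝ a (x₀, 0) = 0 := by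
    have h1 : HasFDerivAt a (fderiv ℝ a (x₀, 0)) (x₀, 0) :=
      (has.differentiable (by simp) _).hasFDerivAt
    have h2 : ∀ ξ, fderiv ℝ a (x₀, 0) (ξ, 0) = 0 := by
      intro ξ
      have h3 : HasFDerivAt (fun x => a (x, (0 : 𝔼))) _ x₀ :=
        HasFDerivAt.comp (g := a) (f := fun x => (x, (0 : 𝔼))) x₀ h1
          (hasFDerivAt_prodMk_left x₀ (0 : 𝔼))
      have h4 : HasFDerivAt (fun x => a (x, (0 : 𝔼))) (0 : 𝔼 →L[ℝ] 𝔼) x₀ := by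
        simp only [ha0]
        exact hasFDerivAt_const _ _
      exact DFunLike.congr_fun (h3.unique h4) ξ
    have h5 : ∀ η, fderiv ℝ a (x₀, 0) (0, η) = 0 := by
      intro η
      have h6 : HasDerivAt (fun t : ℝ => ((x₀, t • η) : 𝔼 × 𝔼)) (0, η) 0 := by
        have := (hasDerivAt_id (0 : ℝ)).smul_const η
        simp only [id, one_smul] at this
        exact (hasDerivAt_const (0 : ℝ) x₀).prodMk this
      have h1' : HasFDerivAt a (fderiv ℝ a (x₀, 0)) (x₀, (0 : ℝ) • η) := by rwa [zero_smul]
      have h7 := h1'.comp_hasDerivAt (0 : ℝ) h6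
      have h8 : HasDerivAt (a ∘ fun t : ℝ => ((x₀, t • η) : 𝔼 × 𝔼)) 0 0 := by
        have h9 : (a ∘ fun t : ℝ => ((x₀, t • η) : 𝔼 × 𝔼)) = fun t => t ^ 2 • a (x₀, η) := by
          ext1 t
          simp only [ha, Function.comp_apply, geodesicAccel_smul]
          rw [smul_comm]
        rw [h9]
        have := (hasDerivAt_pow 2 (0 : ℝ)).smul_const (a (x₀, η))
        simpa using this
      exact h7.unique h8
    refine ContinuousLinearMap.ext fun z => ?_
    have : z = (z.1, 0) + (0, z.2) := by simp
    rw [this, map_add, h2, h5]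
    simp
  set f : 𝔼 × 𝔼 → 𝔼 × 𝔼 := fun z => (z.2, a z) with hf
  have hfs : ContDiff ℝ ∞ f := contDiff_snd.prodMk has
  have hfd : fderiv ℝ f (x₀, 0) = (ContinuousLinearMap.snd ℝ 𝔼 𝔼).prod 0 := by
    have h1 : HasFDerivAt a (0 : 𝔼 × 𝔼 →L[ℝ] 𝔼) (x₀, 0) := by
      rw [← had]; exact (has.differentiable (by simp) _).hasFDerivAt
    exact (hasFDerivAt_snd.prodMk h1).fderiv
  have hW : Metric.ball x₀ (d / 4) ×ˢ (univ : Set 𝔼) ∈ 𝓝 (x₀, (0 : 𝔼)) :=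
    prod_mem_nhds (Metric.ball_mem_nhds _ (by linarith)) Filter.univ_mem
  obtain ⟨A, hA1, hA2⟩ := exists_flow hfs (z₀ := (x₀, 0)) (by simp [hf, ha0])
    (fun z => by rw [hfd]; simp) hW
  have hball : Metric.ball x₀ (d / 4) ⊆ e.target :=
    (Metric.ball_subset_ball (by linarith)).trans hde
  refine ⟨fun z => (A z 1).1, ?_, ?_⟩
  · have h1 := (ContinuousLinearMap.fst ℝ 𝔼 𝔼).hasFDerivAt.comp _ hA1
    refine h1.congr_fderiv ?_
    rw [hfd]
    refine ContinuousLinearMap.ext fun z => ?_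
    simp
  · filter_upwards [hA2] with z hz
    obtain ⟨h0, hder, hmem, hsm, hconst⟩ := hz
    have h0I : (0 : ℝ) ∈ TimeInterval := ⟨by norm_num, by norm_num⟩
    have h1I : (1 : ℝ) ∈ TimeInterval := ⟨by norm_num, by norm_num⟩
    have hz1 : z.1 ∈ e.target := by
      have := hball (hmem 0 h0I).1
      rwa [h0] at this
    refine ⟨contDiffAt_fst.comp z hsm, hz1, hball (hmem 1 h1I).1, fun hz2 => ?_, ?_⟩
    · have hfz : f z = 0 := by
        have : z = (z.1, 0) := Prod.ext rfl hz2
        rw [this]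
        simp [hf, ha0]
      rw [hconst hfz 1 h1I]
    · refine IsGeodesicFrom.rexp_eq (γ := fun t => e.symm (A z t).1) ⟨⟨1, one_pos, ?_⟩, ?_⟩
      · have hsub : ∀ t ∈ Ioo (-1 : ℝ) (1 + 1), t ∈ TimeInterval := fun t ht =>
          ⟨ht.1.le, by linarith [ht.2]⟩
        refine isGeodesicOn_of_chart he isOpen_Ioo (c := fun t => (A z t).1)
          (p := fun t => (A z t).2) (fun t ht => hball (hmem t (hsub t ht)).1)
          (fun t ht => ?_) (fun t ht => ?_)
        · exact (hder t (hsub t ht)).fst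
        · have h1 : HasDerivAt (fun t => (A z t).2) (f (A z t)).2 t := (hder t (hsub t ht)).snd
          have h2 : χ (A z t).1 = 1 := χ.one_of_mem_closedBall
            (Metric.ball_subset_closedBall (hmem t (hsub t ht)).1)
          have h3 : (f (A z t)).2 = geodesicAccel g e (A z t).1 (A z t).2 := by
            simp [hf, ha, h2]
          rwa [h3] at h1
      · have hc : HasDerivAt (fun t => (A z t).1) (A z 0).2 0 := (hder 0 h0I).fst
        have hmc : HasMFDerivAt 𝓘(ℝ, ℝ) (𝓡 n) (fun t => (A z t).1) 0
            (ContinuousLinearMap.toSpanSingleton ℝ (A z 0).2) :=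
          hc.hasFDerivAt.hasMFDerivAt
        have hme : HasMFDerivAt (𝓡 n) (𝓡 n) e.symm (A z 0).1 (symmDeriv e (A z 0).1) :=
          ((mdifferentiable_of_mem_maximalAtlas he).mdifferentiableAt_symm
            (hball (hmem 0 h0I).1)).hasMFDerivAt
        have h1 := (hme.comp (0 : ℝ) hmc).mfderiv
        have h2 : mfderiv 𝓘(ℝ, ℝ) (𝓡 n) (fun t => e.symm (A z t).1) 0 (1 : ℝ) =
            symmDeriv e (A z 0).1 (A z 0).2 := by
          refine (DFunLike.congr_fun h1 (1 : ℝ)).trans ?_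
          change symmDeriv e (A z 0).1 ((1 : ℝ) • (A z 0).2) = _
          rw [one_smul]
        have h3 : ∀ y w : 𝔼, y = z.1 → w = z.2 →
            (⟨e.symm y, symmDeriv e y w⟩ : TangentBundle (𝓡 n) M) =
              ⟨e.symm z.1, symmDeriv e z.1 z.2⟩ := by
          rintro _ _ rfl rfl; rfl
        have h4 : (⟨e.symm (A z 0).1, mfderiv 𝓘(ℝ, ℝ) (𝓡 n) (fun t => e.symm (A z t).1) 0 (1 : ℝ)⟩ :
            TangentBundle (𝓡 n) M) = ⟨e.symm (A z 0).1, symmDeriv e (A z 0).1 (A z 0).2⟩ :=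
          congrArg (fun w => (⟨e.symm (A z 0).1, w⟩ : TangentBundle (𝓡 n) M)) h2
        exact h4.trans (h3 _ _ (congrArg Prod.fst h0) (congrArg Prod.snd h0))

end Geodesics

/-! ### The logarithm and `s₁` in charts -/

section ExpModel

variable {n : ℕ} {M : Type*} [TopologicalSpace M] [ChartedSpace (EuclideanSpace ℝ (Fin n)) M]
  [IsManifold (𝓡 n) ∞ M] {g : SmoothMetric n M}

local notation "𝔼" => EuclideanSpace ℝ (Fin n)

variable {e : OpenPartialHomeomorph M (EuclideanSpace ℝ (Fin n))}

lemma symmDeriv_surjective (he : e ∈ IsManifold.maximalAtlas (𝓡 n) ∞ M) {x : 𝔼}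
    (hx : x ∈ e.target) : Function.Surjective (symmDeriv e x) :=
  (LinearMap.injective_iff_surjective (f := (symmDeriv e x : 𝔼 →ₗ[ℝ] 𝔼))).1
    (symmDeriv_injective he hx)

lemma symmDeriv_pushChart (he : e ∈ IsManifold.maximalAtlas (𝓡 n) ∞ M) {x : 𝔼}
    (hx : x ∈ e.target) (v : VField n M) :
    symmDeriv e x (pushChart e v x) = v (e.symm x) := by
  have h1 := (mdifferentiable_of_mem_maximalAtlas he).symm_comp_deriv (e.map_target hx)
  have h2 := DFunLike.congr_fun h1 (v (e.symm x))
  have h3 : symmDeriv e (e (e.symm x)) (mfderiv (𝓡 n) 𝓘(ℝ, 𝔼) e (e.symm x) (v (e.symm x))) =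
    v (e.symm x) := h2
  rw [e.right_inv hx] at h3
  rw [pushChart_of_mem hx]
  exact h3

/-- A continuous family of positive definite quadratic forms is locally comparable to the square of
the norm. -/
lemma exists_bounds_of_homogeneous {E : Type*} [NormedAddCommGroup E] [NormedSpace ℝ E]
    [FiniteDimensional ℝ E] {Q : E × E → ℝ} {U : Set E} (hU : IsOpen U)
    (hQ : ContinuousOn Q (U ×ˢ univ)) (hpos : ∀ x ∈ U, ∀ a, a ≠ 0 → 0 < Q (x, a))
    (hhom : ∀ x a (t : ℝ), Q (x, t • a) = t ^ 2 * Q (x, a)) {x₀ : E} (hx₀ : x₀ ∈ U) :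
    ∃ C : ℝ, 1 ≤ C ∧ ∀ᶠ x in 𝓝 x₀, ∀ a, ‖a‖ ^ 2 ≤ C * Q (x, a) ∧ Q (x, a) ≤ C * ‖a‖ ^ 2 := by
  have : ProperSpace E := FiniteDimensional.proper ℝ E
  obtain ⟨K, hKx, hKe, hK⟩ : ∃ K ∈ 𝓝 x₀, K ⊆ U ∧ IsCompact K :=
    local_compact_nhds (hU.mem_nhds hx₀)
  have hKS : IsCompact (K ×ˢ Metric.sphere (0 : E) 1) := hK.prod (isCompact_sphere _ _)
  have hsub : K ×ˢ Metric.sphere (0 : E) 1 ⊆ U ×ˢ univ := prod_mono hKe (subset_univ _)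
  have hpos' : ∀ z ∈ K ×ˢ Metric.sphere (0 : E) 1, 0 < Q z := by
    rintro ⟨x, u⟩ ⟨hz1, hz2⟩
    refine hpos x (hKe hz1) u fun h0 => ?_
    rw [mem_sphere_zero_iff_norm, h0, norm_zero] at hz2
    norm_num at hz2
  obtain ⟨C₁, hC₁⟩ := hKS.exists_bound_of_continuousOn (hQ.mono hsub)
  obtain ⟨C₂, hC₂⟩ := hKS.exists_bound_of_continuousOn
    ((hQ.mono hsub).inv₀ fun z hz => (hpos' z hz).ne')
  refine ⟨max 1 (max C₁ C₂), le_max_left _ _, ?_⟩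
  filter_upwards [hKx] with x hx a
  by_cases ha : a = 0
  · have := hhom x 0 0
    simp only [smul_zero, ne_eq, OfNat.ofNat_ne_zero, not_false_eq_true, zero_pow, zero_mul] at this
    simp [ha, this]
  have hna : 0 < ‖a‖ := norm_pos_iff.2 ha
  set u := ‖a‖⁻¹ • a with hu
  have hau : a = ‖a‖ • u := by rw [hu, smul_smul, mul_inv_cancel₀ hna.ne', one_smul]
  have hus : (x, u) ∈ K ×ˢ Metric.sphere (0 : E) 1 := by
    refine ⟨hx, ?_⟩
    rw [mem_sphere_zero_iff_norm, hu, norm_smul, norm_inv, norm_norm, inv_mul_cancel₀ hna.ne']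
  have h1 := hC₁ _ hus
  have h2 : ‖(Q (x, u))⁻¹‖ ≤ C₂ := hC₂ _ hus
  have h3 := hpos' _ hus
  have h4 : Q (x, a) = ‖a‖ ^ 2 * Q (x, u) := by
    conv_lhs => rw [hau]
    exact hhom _ _ _
  rw [Real.norm_of_nonneg h3.le] at h1
  rw [Real.norm_of_nonneg (inv_nonneg.2 h3.le)] at h2
  have h5 : 1 ≤ C₂ * Q (x, u) := by
    have := mul_le_mul_of_nonneg_right h2 h3.le
    rwa [inv_mul_cancel₀ h3.ne'] at this
  have h6 : C₁ ≤ max 1 (max C₁ C₂) := (le_max_left _ _).trans (le_max_right _ _)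
  have h7 : C₂ ≤ max 1 (max C₁ C₂) := (le_max_right _ _).trans (le_max_right _ _)
  have h8 : 0 < ‖a‖ ^ 2 := by positivity
  rw [h4]
  constructor
  · have h9 : 1 ≤ max 1 (max C₁ C₂) * Q (x, u) :=
      h5.trans (mul_le_mul_of_nonneg_right h7 h3.le)
    nlinarith
  · nlinarith

/-- The metric is comparable to the Euclidean metric of a chart. -/
lemma exists_chartMetric_bounds (g : SmoothMetric n M)
    (he : e ∈ IsManifold.maximalAtlas (𝓡 n) ∞ M) {x₀ : 𝔼} (hx₀ : x₀ ∈ e.target) :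
    ∃ C : ℝ, 1 ≤ C ∧ ∀ᶠ x in 𝓝 x₀, ∀ a, ‖a‖ ^ 2 ≤ C * chartMetric g e x a a ∧
      chartMetric g e x a a ≤ C * ‖a‖ ^ 2 := by
  have h1 : ContinuousOn (fun z : 𝔼 × 𝔼 => chartMetric g e z.1) (e.target ×ˢ univ) :=
    (contDiffOn_chartMetric g he).continuousOn.comp continuousOn_fst fun z hz => hz.1
  refine exists_bounds_of_homogeneous (Q := fun z : 𝔼 × 𝔼 => chartMetric g e z.1 z.2 z.2)
    e.open_target ((h1.clm_apply continuousOn_snd).clm_apply continuousOn_snd)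
    (fun x hx a ha => chartMetric_pos g he hx ha) (fun x a t => ?_) hx₀
  simp only [map_smul, smul_apply, smul_eq_mul]
  ring

/-- A chart description of the exponential map of `g`, on balls of radius `r` around a point `x₀`
of the target of the chart `e`: `X` is the exponential map, and `G ((x, v), b) + v` is the
logarithm at `x` of the exponential of `b` at `X (x, v)`. -/
structure IsExpModel (g : SmoothMetric n M)
    (e : OpenPartialHomeomorph M (EuclideanSpace ℝ (Fin n)))
    (x₀ : EuclideanSpace ℝ (Fin n)) (r : ℝ) (O : Set (EuclideanSpace ℝ (Fin n)))
    (X : EuclideanSpace ℝ (Fin n) × EuclideanSpace ℝ (Fin n) → EuclideanSpace ℝ (Fin n))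
    (G : (EuclideanSpace ℝ (Fin n) × EuclideanSpace ℝ (Fin n)) × EuclideanSpace ℝ (Fin n) →
      EuclideanSpace ℝ (Fin n)) : Prop where
  model : IsLocalModel x₀ r O X G
  ball_subset : Metric.ball x₀ r ⊆ e.target
  convex : Convex ℝ O
  exists_isCompact : ∃ K, IsCompact K ∧ O ⊆ K ∧ K ⊆ e.target
  rexp_eq : ∀ x ∈ Metric.ball x₀ r, ∀ v ∈ Metric.ball (0 : EuclideanSpace ℝ (Fin n)) r,
    rexp g (e.symm x) (symmDeriv e x v) = e.symm (X (x, v))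
  rexp_G : ∀ x ∈ Metric.ball x₀ r, ∀ v ∈ Metric.ball (0 : EuclideanSpace ℝ (Fin n)) r,
    ∀ b ∈ Metric.ball (0 : EuclideanSpace ℝ (Fin n)) r,
    rexp g (e.symm x) (symmDeriv e x (G ((x, v), b) + v)) =
      rexp g (e.symm (X (x, v))) (symmDeriv e (X (x, v)) b)
  rlog_eq : ∀ x ∈ Metric.ball x₀ r, ∀ v ∈ Metric.ball (0 : EuclideanSpace ℝ (Fin n)) r,
    ∀ b ∈ Metric.ball (0 : EuclideanSpace ℝ (Fin n)) r,
    rlog g (e.symm x) (rexp g (e.symm (X (x, v))) (symmDeriv e (X (x, v)) b)) =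
      symmDeriv e x (G ((x, v), b) + v)
  eq_of_rexp_eq : ∀ x ∈ Metric.ball x₀ r, ∀ v ∈ Metric.ball (0 : EuclideanSpace ℝ (Fin n)) r,
    ∀ b ∈ Metric.ball (0 : EuclideanSpace ℝ (Fin n)) r,
    ∀ a ∈ Metric.ball (0 : EuclideanSpace ℝ (Fin n)) r,
    rexp g (e.symm x) (symmDeriv e x a) =
      rexp g (e.symm (X (x, v))) (symmDeriv e (X (x, v)) b) → a = G ((x, v), b) + v

variable [T2Space M]

set_option maxHeartbeats 1000000 in
/-- Every point has a chart description of the exponential map. With the local inverse `S` of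
`(x, v) ↦ (x, X (x, v))`, the map `G` is the second component of `S (x, X (X (x, v), b))`,
minus `v`. -/
theorem exists_isExpModel (g : SmoothMetric n M) (he : e ∈ IsManifold.maximalAtlas (𝓡 n) ∞ M)
    {x₀ : 𝔼} (hx₀ : x₀ ∈ e.target) : ∃ r O X G, IsExpModel g e x₀ r O X G := by
  obtain ⟨X, hX1, hX2⟩ := exists_rexp_chart g he hx₀
  set Φ : 𝔼 × 𝔼 → 𝔼 × 𝔼 := fun z => (z.1, X z) with hΦ
  have hXx₀ : X (x₀, 0) = x₀ := hX2.self_of_nhds.2.2.2.1 rfl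
  have hΦs : ∀ᶠ z in 𝓝 (x₀, (0 : 𝔼)), ContDiffAt ℝ ∞ Φ z :=
    hX2.mono fun z hz => contDiffAt_fst.prodMk hz.1
  let L : (𝔼 × 𝔼) ≃L[ℝ] (𝔼 × 𝔼) := ContinuousLinearEquiv.skewProd
    (ContinuousLinearEquiv.refl ℝ 𝔼) (ContinuousLinearEquiv.refl ℝ 𝔼) (ContinuousLinearMap.id ℝ 𝔼)
  have hΦd : HasFDerivAt Φ (L : 𝔼 × 𝔼 →L[ℝ] 𝔼 × 𝔼) (x₀, 0) := by
    refine (hasFDerivAt_fst.prodMk hX1).congr_fderiv ?_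
    refine ContinuousLinearMap.ext fun z => ?_
    change (z.1, z.1 + z.2) = (z.1, z.2 + z.1)
    rw [add_comm]
  let S := hΦs.self_of_nhds.toOpenPartialHomeomorph Φ hΦd (by simp)
  have hS : ∀ z, S z = Φ z := fun z => rfl
  have hsrc : (x₀, (0 : 𝔼)) ∈ S.source :=
    ContDiffAt.mem_toOpenPartialHomeomorph_source hΦs.self_of_nhds hΦd (by simp)
  have hΦx₀ : Φ (x₀, 0) = (x₀, x₀) := by simp [hΦ, hXx₀]
  have htgt : (x₀, x₀) ∈ S.target := by
    have := S.map_source hsrc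
    rwa [hS, hΦx₀] at this
  have hSs : S.symm (x₀, x₀) = (x₀, 0) := by
    have := S.left_inv hsrc
    rwa [hS, hΦx₀] at this
  have hcontS : ContinuousAt S.symm (x₀, x₀) := S.continuousAt_symm htgt
  have hfd : ∀ᶠ z in 𝓝 (x₀, (0 : 𝔼)), ∃ L' : (𝔼 × 𝔼) ≃L[ℝ] (𝔼 × 𝔼),
      HasFDerivAt Φ (L' : 𝔼 × 𝔼 →L[ℝ] 𝔼 × 𝔼) z := by
    have h1 : ContinuousAt (fderiv ℝ Φ) (x₀, 0) :=
      (hΦs.self_of_nhds.fderiv_right (m := 0) (by simp)).continuousAt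
    have h2 := h1.eventually (by
      rw [hΦd.fderiv]
      exact ContinuousLinearEquiv.nhds L)
    filter_upwards [h2, hΦs] with z hz hz'
    obtain ⟨L', hL'⟩ := hz
    exact ⟨L', by rw [hL']; exact (hz'.differentiableAt (by simp)).hasFDerivAt⟩
  -- smoothness of the inverse near the diagonal
  have hSsm : ∀ᶠ y in 𝓝 (x₀, x₀), ContDiffAt ℝ ∞ S.symm y := by
    have h1 : ∀ᶠ y in 𝓝 (x₀, x₀), (∃ L' : (𝔼 × 𝔼) ≃L[ℝ] (𝔼 × 𝔼),
        HasFDerivAt Φ (L' : 𝔼 × 𝔼 →L[ℝ] 𝔼 × 𝔼) (S.symm y)) ∧ ContDiffAt ℝ ∞ Φ (S.symm y) :=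
      hcontS.eventually (by rw [hSs]; exact hfd.and hΦs)
    filter_upwards [h1, S.open_target.mem_nhds htgt] with y hy hyt
    obtain ⟨⟨L', hL'⟩, h3⟩ := hy
    exact S.contDiffAt_symm hyt hL' h3
  -- a neighbourhood on which the exponential map is known and injective
  obtain ⟨κ, hκ, hΩ⟩ := Metric.eventually_nhds_iff_ball.1
    (hX2.and (S.open_source.mem_nhds hsrc))
  have hinj : ∀ x a a', (x, a) ∈ Metric.ball (x₀, (0 : 𝔼)) κ →
      (x, a') ∈ Metric.ball (x₀, (0 : 𝔼)) κ →
      rexp g (e.symm x) (symmDeriv e x a) = rexp g (e.symm x) (symmDeriv e x a') → a = a' := by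
    intro x a a' ha ha' heq
    obtain ⟨⟨-, -, h3, -, h4⟩, h5⟩ := hΩ _ ha
    obtain ⟨⟨-, -, h3', -, h4'⟩, h5'⟩ := hΩ _ ha'
    have h6 : e.symm (X (x, a)) = e.symm (X (x, a')) := h4.symm.trans (heq.trans h4')
    have h7 : X (x, a) = X (x, a') := e.symm.injOn h3 h3' h6
    have h8 : (x, a) = (x, a') := S.injOn h5 h5' (by rw [hS, hS]; simp only [hΦ, h7])
    exact congrArg Prod.snd h8
  obtain ⟨C, hC1, hC⟩ := exists_chartMetric_bounds g he hx₀
  have hmem : ∀ {x a : 𝔼}, (x, a) ∈ Metric.ball (x₀, (0 : 𝔼)) κ ↔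
      x ∈ Metric.ball x₀ κ ∧ ‖a‖ < κ := by
    intro x a
    rw [← ball_prod_same, mem_prod, mem_ball_zero_iff]
  -- a vector with the same exponential which is not longer is small as well, and `hinj` applies
  have hlog : ∀ᶠ z in 𝓝 (x₀, (0 : 𝔼)), rlog g (e.symm z.1)
      (rexp g (e.symm z.1) (symmDeriv e z.1 z.2)) = symmDeriv e z.1 z.2 := by
    have h1 : ∀ᶠ z in 𝓝 (x₀, (0 : 𝔼)), C * ‖z.2‖ < κ := by
      have : Filter.Tendsto (fun z : 𝔼 × 𝔼 => C * ‖z.2‖) (𝓝 (x₀, 0)) (𝓝 (C * ‖(0 : 𝔼)‖)) :=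
        (continuous_const.mul continuous_snd.norm).tendsto (x₀, (0 : 𝔼))
      rw [norm_zero, mul_zero] at this
      exact this.eventually (gt_mem_nhds hκ)
    filter_upwards [h1, continuous_fst.continuousAt.eventually hC,
      Metric.ball_mem_nhds (x₀, (0 : 𝔼)) hκ,
      continuous_fst.continuousAt.eventually (e.open_target.mem_nhds hx₀)] with z hz1 hz2 hz3 hz4
    obtain ⟨x, a⟩ := z
    simp only at hz1 hz2 hz4 ⊢
    have key : ∀ ξ : TangentSpace (𝓡 n) (e.symm x),
        rexp g (e.symm x) ξ = rexp g (e.symm x) (symmDeriv e x a) →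
        g.inner (e.symm x) ξ ξ ≤ g.inner (e.symm x) (symmDeriv e x a) (symmDeriv e x a) →
        ξ = symmDeriv e x a := by
      intro ξ h1 h2
      obtain ⟨η, hη⟩ := symmDeriv_surjective he hz4 ξ
      have h3 : chartMetric g e x η η ≤ chartMetric g e x a a := by
        rw [← hη] at h2
        exact h2
      have h4 : ‖η‖ < κ := by
        have h5 := (hz2 η).1
        have h6 := (hz2 a).2
        have h7 : ‖η‖ ^ 2 ≤ (C * ‖a‖) ^ 2 := by
          calc ‖η‖ ^ 2 ≤ C * chartMetric g e x η η := h5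
            _ ≤ C * (C * ‖a‖ ^ 2) := by gcongr; exact h3.trans h6
            _ = (C * ‖a‖) ^ 2 := by ring
        exact (pow_le_pow_iff_left₀ (norm_nonneg _) (by positivity) two_ne_zero).1 h7 |>.trans_lt hz1
      have h5 := hinj x η a (hmem.2 ⟨(hmem.1 hz3).1, h4⟩) hz3 (by rw [hη]; exact h1)
      rw [← hη, h5]
    have H : ∃ ξ : TangentSpace (𝓡 n) (e.symm x),
        rexp g (e.symm x) ξ = rexp g (e.symm x) (symmDeriv e x a) ∧
        ∀ η : TangentSpace (𝓡 n) (e.symm x),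
          rexp g (e.symm x) η = rexp g (e.symm x) (symmDeriv e x a) →
          g.inner (e.symm x) ξ ξ ≤ g.inner (e.symm x) η η := by
      refine ⟨symmDeriv e x a, rfl, fun η hη => ?_⟩
      by_contra! hlt
      rw [key η hη hlt.le] at hlt
      exact lt_irrefl _ hlt
    rw [rlog, dif_pos H]
    exact key _ H.choose_spec.1 (H.choose_spec.2 _ rfl)
  obtain ⟨d, hd, hde⟩ := Metric.nhds_basis_closedBall.mem_iff.1 (e.open_target.mem_nhds hx₀)
  -- all the conditions hold for small arguments, by continuity
  set Y : (𝔼 × 𝔼) × 𝔼 → 𝔼 := fun q => X (X q.1, q.2) with hY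
  have t1 : Filter.Tendsto (fun q : (𝔼 × 𝔼) × 𝔼 => q.1) (𝓝 ((x₀, 0), 0)) (𝓝 (x₀, 0)) :=
    continuous_fst.continuousAt
  have hXc : Filter.Tendsto X (𝓝 (x₀, 0)) (𝓝 x₀) := by
    have := hX1.continuousAt.tendsto
    rwa [hXx₀] at this
  have t2 : Filter.Tendsto (fun q : (𝔼 × 𝔼) × 𝔼 => (X q.1, q.2)) (𝓝 ((x₀, 0), 0))
      (𝓝 (x₀, 0)) := (hXc.comp t1).prodMk_nhds continuous_snd.continuousAt
  have t3 : Filter.Tendsto (fun q : (𝔼 × 𝔼) × 𝔼 => (q.1.1, Y q)) (𝓝 ((x₀, 0), 0))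
      (𝓝 (x₀, x₀)) :=
    (continuous_fst.continuousAt.tendsto.comp t1).prodMk_nhds (hXc.comp t2)
  have t4 : Filter.Tendsto (fun q : (𝔼 × 𝔼) × 𝔼 => S.symm (q.1.1, Y q)) (𝓝 ((x₀, 0), 0))
      (𝓝 (x₀, 0)) := by
    have := hcontS.tendsto.comp t3
    rwa [hSs] at this
  have t5 : Filter.Tendsto (fun q : (𝔼 × 𝔼) × 𝔼 => (q.1.1, q.2)) (𝓝 ((x₀, 0), 0))
      (𝓝 (x₀, 0)) :=
    (continuous_fst.continuousAt.tendsto.comp t1).prodMk_nhds continuous_snd.continuousAt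
  have hball := Metric.ball_mem_nhds (x₀, (0 : 𝔼)) hκ
  have hall := (((t1.eventually hball).and (t2.eventually hball)).and
    ((t4.eventually hball).and (t5.eventually hball))).and
    (((t3.eventually (S.open_target.mem_nhds htgt)).and (t3.eventually hSsm)).and
    ((t4.eventually hlog).and ((hXc.comp t1).eventually (Metric.ball_mem_nhds x₀ hd))))
  obtain ⟨r, hr, hall'⟩ := Metric.eventually_nhds_iff_ball.1 hall
  have hq : ∀ x ∈ Metric.ball x₀ r, ∀ v ∈ Metric.ball (0 : 𝔼) r, ∀ b ∈ Metric.ball (0 : 𝔼) r,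
      ((x, v), b) ∈ Metric.ball ((x₀, (0 : 𝔼)), (0 : 𝔼)) r := by
    intro x hx v hv b hb
    rw [← ball_prod_same, ← ball_prod_same]
    exact ⟨⟨hx, hv⟩, hb⟩
  have h0r : (0 : 𝔼) ∈ Metric.ball (0 : 𝔼) r := Metric.mem_ball_self hr
  -- the inverse of `Φ` preserves the first component
  have hfst : ∀ {y}, y ∈ S.target → S.symm y = (y.1, (S.symm y).2) ∧ X (S.symm y) = y.2 := by
    intro y hy
    have h1 : Φ (S.symm y) = y := S.right_inv hy
    exact ⟨Prod.ext (show (Φ (S.symm y)).1 = y.1 from congrArg Prod.fst h1) rfl,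
      congrArg Prod.snd h1⟩
  have hcomp : ∀ x ∈ Metric.ball x₀ r, ∀ v ∈ Metric.ball (0 : 𝔼) r, ∀ b ∈ Metric.ball (0 : 𝔼) r,
      rexp g (e.symm x) (symmDeriv e x (S.symm (x, Y ((x, v), b))).2) =
        rexp g (e.symm (X (x, v))) (symmDeriv e (X (x, v)) b) := by
    intro x hx v hv b hb
    obtain ⟨⟨⟨-, h2⟩, h3, -⟩, ⟨⟨h4, -⟩, -⟩⟩ := hall' _ (hq x hx v hv b hb)
    obtain ⟨h5, h6⟩ := hfst h4
    simp only at h2 h3 h5 h6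
    rw [h5] at h3
    have h7 := (hΩ _ h2).1.2.2.2.2
    have h8 := (hΩ _ h3).1.2.2.2.2
    rw [h5] at h6
    rw [h6] at h8
    exact h8.trans h7.symm
  refine ⟨r, Metric.ball x₀ d, X, fun q => (S.symm (q.1.1, Y q)).2 - q.1.2, ⟨⟨hr,
    ?_, ?_, ?_, ?_, ?_, ?_⟩, ?_, convex_ball _ _, ⟨Metric.closedBall x₀ d, isCompact_closedBall _ _,
    Metric.ball_subset_closedBall, hde⟩, ?_, ?_, ?_, ?_⟩⟩
  · intro x hx v hv
    exact (hall' _ (hq x hx v hv 0 h0r)).2.2.2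
  · rintro ⟨x, v⟩ ⟨hx, hv⟩
    exact (hΩ _ (hall' _ (hq x hx v hv 0 h0r)).1.1.1).1.1.contDiffWithinAt
  · rintro ⟨⟨x, v⟩, b⟩ ⟨⟨hx, hv⟩, hb⟩
    obtain ⟨⟨⟨h1, h2⟩, -⟩, ⟨⟨-, h4⟩, -⟩⟩ := hall' _ (hq x hx v hv b hb)
    have s1 : ContDiffAt ℝ ∞ (fun q : (𝔼 × 𝔼) × 𝔼 => X q.1) ((x, v), b) :=
      ContDiffAt.comp (g := X) (f := fun q : (𝔼 × 𝔼) × 𝔼 => q.1) ((x, v), b)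
        (hΩ _ h1).1.1 contDiffAt_fst
    have s2 : ContDiffAt ℝ ∞ Y ((x, v), b) :=
      ContDiffAt.comp (g := X) (f := fun q : (𝔼 × 𝔼) × 𝔼 => (X q.1, q.2)) ((x, v), b)
        (hΩ _ h2).1.1 (s1.prodMk contDiffAt_snd)
    have s3 : ContDiffAt ℝ ∞ (fun q : (𝔼 × 𝔼) × 𝔼 => S.symm (q.1.1, Y q)) ((x, v), b) :=
      ContDiffAt.comp (g := S.symm) (f := fun q : (𝔼 × 𝔼) × 𝔼 => (q.1.1, Y q)) ((x, v), b)
        h4 (contDiffAt_fst.fst.prodMk s2)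
    exact (s3.snd.sub contDiffAt_fst.snd).contDiffWithinAt
  · intro x hx
    exact (hΩ _ (hall' _ (hq x hx 0 h0r 0 h0r)).1.1.1).1.2.2.2.1 rfl
  · intro x hx v hv
    obtain ⟨⟨⟨h1, h2⟩, -⟩, -⟩ := hall' _ (hq x hx v hv 0 h0r)
    have h3 : X (X (x, v), 0) = X (x, v) := (hΩ _ h2).1.2.2.2.1 rfl
    have h4 : S.symm (x, X (x, v)) = (x, v) := S.left_inv (hΩ _ h1).2
    simp only [hY, h3, h4, sub_self]
  · intro x hx b hb
    obtain ⟨⟨⟨h1, -⟩, -, h2⟩, -⟩ := hall' _ (hq x hx 0 h0r b hb)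
    have h3 : X (x, 0) = x := (hΩ _ h1).1.2.2.2.1 rfl
    have h4 : S.symm (x, X (x, b)) = (x, b) := S.left_inv (hΩ _ h2).2
    simp only [hY, h3, h4, sub_zero]
  · intro x hx
    exact (hΩ _ (hall' _ (hq x hx 0 h0r 0 h0r)).1.1.1).1.2.1
  · intro x hx v hv
    exact (hΩ _ (hall' _ (hq x hx v hv 0 h0r)).1.1.1).1.2.2.2.2
  · intro x hx v hv b hb
    simp only [sub_add_cancel]
    exact hcomp x hx v hv b hb
  · intro x hx v hv b hb
    obtain ⟨-, ⟨⟨h4, -⟩, h5, -⟩⟩ := hall' _ (hq x hx v hv b hb)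
    simp only [sub_add_cancel]
    rw [← hcomp x hx v hv b hb]
    obtain ⟨h6, -⟩ := hfst h4
    simp only at h5 h6
    rw [h6] at h5
    exact h5
  · intro x hx v hv b hb a ha heq
    simp only [sub_add_cancel]
    obtain ⟨⟨-, h3, -⟩, ⟨⟨h4, -⟩, -⟩⟩ := hall' _ (hq x hx v hv b hb)
    obtain ⟨h6, -⟩ := hfst h4
    simp only at h3 h6
    rw [h6] at h3
    exact hinj x a _ (hall' _ (hq x hx 0 h0r a ha)).1.2.2 h3 (heq.trans (hcomp x hx v hv b hb).symm)

namespace IsExpModel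

variable {x₀ : EuclideanSpace ℝ (Fin n)} {r : ℝ} {O : Set (EuclideanSpace ℝ (Fin n))}
  {X : EuclideanSpace ℝ (Fin n) × EuclideanSpace ℝ (Fin n) → EuclideanSpace ℝ (Fin n)}
  {G : (EuclideanSpace ℝ (Fin n) × EuclideanSpace ℝ (Fin n)) × EuclideanSpace ℝ (Fin n) →
      EuclideanSpace ℝ (Fin n)}

lemma exp_eq (hm : IsExpModel g e x₀ r O X G) (he : e ∈ IsManifold.maximalAtlas (𝓡 n) ∞ M)
    {v : VField n M} {x : 𝔼} (hx : x ∈ Metric.ball x₀ r)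
    (hv : pushChart e v x ∈ Metric.ball (0 : 𝔼) r) :
    Exp g v (e.symm x) = e.symm (X (x, pushChart e v x)) := by
  rw [← hm.rexp_eq x hx _ hv, symmDeriv_pushChart he (hm.ball_subset hx)]
  rfl

/-- The exponential of `w` at the exponential of `v`, in the chart. -/
lemma exp_comp_eq (hm : IsExpModel g e x₀ r O X G) (he : e ∈ IsManifold.maximalAtlas (𝓡 n) ∞ M)
    {v : VField n M} (w : VField n M) {x : 𝔼} (hx : x ∈ Metric.ball x₀ r)
    (hv : pushChart e v x ∈ Metric.ball (0 : 𝔼) r) :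
    Exp g w (Exp g v (e.symm x)) = rexp g (e.symm (X (x, pushChart e v x)))
      (symmDeriv e (X (x, pushChart e v x)) (pushChart e w (X (x, pushChart e v x)))) := by
  obtain ⟨K, -, hOK, hKe⟩ := hm.exists_isCompact
  rw [hm.exp_eq he hx hv, symmDeriv_pushChart he
    (hKe (hOK (hm.model.mapsTo x hx _ hv)))]
  rfl

/-- The vector field `s₁` in the chart. -/
lemma pushChart_s₁ (hm : IsExpModel g e x₀ r O X G) (he : e ∈ IsManifold.maximalAtlas (𝓡 n) ∞ M)
    {w v : VField n M} {x : 𝔼} (hx : x ∈ Metric.ball x₀ r)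
    (hv : pushChart e v x ∈ Metric.ball (0 : 𝔼) r)
    (hw : pushChart e w (X (x, pushChart e v x)) ∈ Metric.ball (0 : 𝔼) r) :
    pushChart e (s₁ g w v) x =
      G ((x, pushChart e v x), pushChart e w (X (x, pushChart e v x))) - pushChart e w x := by
  have hxe := hm.ball_subset hx
  have h1 := hm.rlog_eq x hx _ hv _ hw
  rw [← hm.exp_comp_eq he w hx hv] at h1
  refine symmDeriv_injective he hxe ?_
  have h2 : symmDeriv e x (pushChart e (s₁ g w v) x) =
      (rlog g (e.symm x) (Exp g w (Exp g v (e.symm x))) : 𝔼) - w (e.symm x) - v (e.symm x) :=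
    symmDeriv_pushChart he hxe _
  rw [h2, h1, ← symmDeriv_pushChart he hxe w, ← symmDeriv_pushChart he hxe v, map_add, map_sub]
  have key : ∀ a b c : 𝔼, a + b - c - b = a - c := fun a b c => by abel
  exact key _ _ _

/-- The defining equation of `s₁`, at one point. -/
lemma exp_s₁ (hm : IsExpModel g e x₀ r O X G) (he : e ∈ IsManifold.maximalAtlas (𝓡 n) ∞ M)
    {w v : VField n M} {x : 𝔼} (hx : x ∈ Metric.ball x₀ r)
    (hv : pushChart e v x ∈ Metric.ball (0 : 𝔼) r)
    (hw : pushChart e w (X (x, pushChart e v x)) ∈ Metric.ball (0 : 𝔼) r) :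
    Exp g w (Exp g v (e.symm x)) = Exp g (w + v + s₁ g w v) (e.symm x) := by
  have hxe := hm.ball_subset hx
  rw [hm.exp_comp_eq he w hx hv, ← hm.rexp_G x hx _ hv _ hw]
  have h1 : G ((x, pushChart e v x), pushChart e w (X (x, pushChart e v x))) + pushChart e v x =
      pushChart e (w + v + s₁ g w v) x := by
    rw [pushChart_add, pushChart_add, Pi.add_apply, Pi.add_apply, hm.pushChart_s₁ he hx hv hw]
    abel
  rw [h1, symmDeriv_pushChart he hxe]
  rfl

/-- Uniqueness of small solutions of the defining equation of `s₁`, at one point. -/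
lemma eq_s₁ (hm : IsExpModel g e x₀ r O X G) (he : e ∈ IsManifold.maximalAtlas (𝓡 n) ∞ M)
    {w v s : VField n M} {x : 𝔼} (hx : x ∈ Metric.ball x₀ r)
    (hv : pushChart e v x ∈ Metric.ball (0 : 𝔼) r)
    (hw : pushChart e w (X (x, pushChart e v x)) ∈ Metric.ball (0 : 𝔼) r)
    (hs : pushChart e (w + v + s) x ∈ Metric.ball (0 : 𝔼) r)
    (h : Exp g w (Exp g v (e.symm x)) = Exp g (w + v + s) (e.symm x)) :
    s (e.symm x) = s₁ g w v (e.symm x) := by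
  have hxe := hm.ball_subset hx
  rw [hm.exp_comp_eq he w hx hv] at h
  have h0 : Exp g (w + v + s) (e.symm x) =
      rexp g (e.symm x) (symmDeriv e x (pushChart e (w + v + s) x)) := by
    rw [symmDeriv_pushChart he hxe]
    rfl
  rw [h0] at h
  have h1 := hm.eq_of_rexp_eq x hx _ hv _ hw _ hs h.symm
  have h2 : pushChart e s x = pushChart e (s₁ g w v) x := by
    rw [hm.pushChart_s₁ he hx hv hw]
    rw [pushChart_add, pushChart_add, Pi.add_apply, Pi.add_apply] at h1
    rw [eq_sub_iff_add_eq]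
    have h3 := congrArg (fun z => z - pushChart e v x) h1
    simp only [add_sub_cancel_right] at h3
    rw [← h3]
    abel
  rw [← symmDeriv_pushChart he hxe s, h2, symmDeriv_pushChart he hxe]

lemma closedBall_subset (hm : IsExpModel g e x₀ r O X G) : Metric.closedBall x₀ (r / 2) ⊆ O := by
  intro x hx
  have hx' := Metric.closedBall_subset_ball (half_lt_self hm.model.pos) hx
  have := hm.model.mapsTo x hx' 0 (Metric.mem_ball_self hm.model.pos)
  rwa [hm.model.X_zero x hx'] at this

end IsExpModel

end ExpModel

/-! ### The estimates for `s₁` -/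

section Estimates

variable {n : ℕ} {M : Type*} [TopologicalSpace M] [ChartedSpace (EuclideanSpace ℝ (Fin n)) M]
  [IsManifold (𝓡 n) ∞ M] [T2Space M] [CompactSpace M] {g : SmoothMetric n M}
  {ι : Type*} [Fintype ι] {h : ι → OpenPartialHomeomorph M (EuclideanSpace ℝ (Fin n))}
  {φ : SmoothPartitionOfUnity ι (𝓡 n) M univ}

local notation "𝔼" => EuclideanSpace ℝ (Fin n)

/-- The models of the exponential map around a point `x₀` that apply to all vector fields of `C⁰`
norm less than `δ`. The bound `r / 6` leaves room for sums of three vector fields. -/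
def HasSmallModel (g : SmoothMetric n M)
    (h : ι → OpenPartialHomeomorph M (EuclideanSpace ℝ (Fin n)))
    (φ : SmoothPartitionOfUnity ι (𝓡 n) M univ) (δ : ℝ) (i : ι)
    (x₀ : EuclideanSpace ℝ (Fin n)) : Prop :=
  ∃ x₁ r O X G, IsExpModel g (h i) x₁ r O X G ∧ x₀ ∈ Metric.ball x₁ (r / 2) ∧
    ∀ v : VField n M, IsGamma 0 v → normC h φ 0 v < δ → ∀ y ∈ O, ‖pushChart (h i) v y‖ ≤ r / 6

lemma HasSmallModel.mono {δ δ' : ℝ} {i : ι} {x₀ : 𝔼} (hs : HasSmallModel g h φ δ i x₀)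
    (hδ : δ' ≤ δ) : HasSmallModel g h φ δ' i x₀ := by
  obtain ⟨x₁, r, O, X, G, hm, hx, hv⟩ := hs
  exact ⟨x₁, r, O, X, G, hm, hx, fun v h1 h2 => hv v h1 (h2.trans_le hδ)⟩

/-- By compactness, a common bound works near all points of the supports of the partition of
unity. -/
lemma exists_hasSmallModel (g : SmoothMetric n M)
    (hh : ∀ i, h i ∈ IsManifold.maximalAtlas (𝓡 n) ∞ M)
    (hφ : φ.IsSubordinate (fun i => (h i).source)) :
    ∃ δ > (0 : ℝ), ∀ i, ∀ x₀ ∈ h i '' tsupport (φ i), HasSmallModel g h φ δ i x₀ := by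
  have key : ∀ i, ∀ᶠ δ in 𝓝[>] (0 : ℝ), ∀ x₀ ∈ h i '' tsupport (φ i),
      HasSmallModel g h φ δ i x₀ := by
    intro i
    refine (isCompact_image_tsupport hφ i).induction_on
      (p := fun S => ∀ᶠ δ in 𝓝[>] (0 : ℝ), ∀ x₀ ∈ S, HasSmallModel g h φ δ i x₀)
      (by simp) (fun s t hst ht => ht.mono fun δ hδ x hx => hδ x (hst hx))
      (fun s t hs ht => ?_) (fun x hx => ?_)
    · filter_upwards [hs, ht] with δ h1 h2 x hx
      exact hx.elim (h1 x) (h2 x)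
    · obtain ⟨r, O, X, G, hm⟩ := exists_isExpModel g (hh i) (image_tsupport_subset hφ i hx)
      obtain ⟨K, hK, hOK, hKe⟩ := hm.exists_isCompact
      obtain ⟨C, hC1, hC⟩ := exists_norm_iteratedFDeriv_pushChart_le hh hφ (hh i) 0 hK hKe
      have hr := hm.model.pos
      refine ⟨Metric.ball x (r / 2), mem_nhdsWithin_of_mem_nhds
        (Metric.ball_mem_nhds _ (by linarith)), ?_⟩
      have hpos : 0 < r / 6 / C := by positivity
      filter_upwards [Ioo_mem_nhdsGT hpos] with δ hδ x₀ hx₀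
      refine ⟨x, r, O, X, G, hm, hx₀, fun v hv hvδ y hy => ?_⟩
      have h1 := (hC 0 le_rfl v hv y (hOK hy)).2
      rw [norm_iteratedFDeriv_zero] at h1
      refine h1.trans ?_
      have h2 := hvδ.trans hδ.2
      rw [lt_div_iff₀ (by linarith)] at h2
      linarith
  obtain ⟨δ, h1, h2⟩ := ((Filter.eventually_all.2 key).and self_mem_nhdsWithin).exists
  exact ⟨δ, h2, h1⟩

section

variable {e : OpenPartialHomeomorph M (EuclideanSpace ℝ (Fin n))}
  {x₀ : EuclideanSpace ℝ (Fin n)} {r : ℝ} {O : Set (EuclideanSpace ℝ (Fin n))}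
  {X : EuclideanSpace ℝ (Fin n) × EuclideanSpace ℝ (Fin n) → EuclideanSpace ℝ (Fin n)}
  {G : (EuclideanSpace ℝ (Fin n) × EuclideanSpace ℝ (Fin n)) × EuclideanSpace ℝ (Fin n) →
      EuclideanSpace ℝ (Fin n)}

lemma IsExpModel.X_mem (hm : IsExpModel g e x₀ r O X G) {x v : 𝔼}
    (hx : x ∈ Metric.closedBall x₀ (r / 2)) (hv : v ∈ Metric.closedBall (0 : 𝔼) (r / 2)) :
    X (x, v) ∈ O :=
  hm.model.mapsTo x (hm.model.closedBall_subset _ hx) v (hm.model.closedBall_subset _ hv)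

lemma IsExpModel.pushChart_s₁_eventuallyEq (hm : IsExpModel g e x₀ r O X G)
    (he : e ∈ IsManifold.maximalAtlas (𝓡 n) ∞ M) {w v : VField n M}
    (hv : ∀ y ∈ O, pushChart e v y ∈ Metric.closedBall (0 : 𝔼) (r / 2))
    (hw : ∀ y ∈ O, pushChart e w y ∈ Metric.closedBall (0 : 𝔼) (r / 2)) {x : 𝔼}
    (hx : x ∈ Metric.ball x₀ (r / 2)) :
    pushChart e (s₁ g w v) =ᶠ[𝓝 x] fun y =>
      G ((y, pushChart e v y), pushChart e w (X (y, pushChart e v y))) - pushChart e w y := by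
  filter_upwards [Metric.isOpen_ball.mem_nhds hx] with y hy
  have hy' := Metric.ball_subset_closedBall hy
  have hvy := hv y (hm.closedBall_subset hy')
  exact hm.pushChart_s₁ he (hm.model.closedBall_subset _ hy') (hm.model.closedBall_subset _ hvy)
    (hm.model.closedBall_subset _ (hw _ (hm.X_mem hy' hvy)))

end

lemma mem_closedBall_of_norm_le {x : 𝔼} {r : ℝ} (hr : 0 < r) (hx : ‖x‖ ≤ r / 6) :
    x ∈ Metric.closedBall (0 : 𝔼) (r / 2) := by
  rw [mem_closedBall_zero_iff]; linarith

variable {δ : ℝ}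

/-- `s₁` is continuous, and its `C⁰` norm is controlled by that of `w`. -/
theorem exists_normC_s₁_le (hh : ∀ i, h i ∈ IsManifold.maximalAtlas (𝓡 n) ∞ M)
    (hφ : φ.IsSubordinate (fun i => (h i).source))
    (hδ : ∀ i, ∀ x₀ ∈ h i '' tsupport (φ i), HasSmallModel g h φ δ i x₀) :
    ∃ C > (0 : ℝ), ∀ w v : VField n M, IsGamma 0 w → IsGamma 0 v →
      normC h φ 0 w < δ → normC h φ 0 v < δ →
      IsGamma 0 (s₁ g w v) ∧ normC h φ 0 (s₁ g w v) ≤ C * normC h φ 0 w := by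
  obtain ⟨C, hC0, hC⟩ := exists_normC_le hh hφ 0
    {p : VField n M × ℝ | ∃ w v, IsGamma 0 w ∧ IsGamma 0 v ∧ normC h φ 0 w < δ ∧
      normC h φ 0 v < δ ∧ p = (s₁ g w v, normC h φ 0 w)}
    (by rintro _ ⟨w, v, -, -, -, -, rfl⟩; exact normC_nonneg 0 w) (by
      intro i x₀ hx₀
      obtain ⟨x₁, r, O, X, G, hm, hx₁, hsm⟩ := hδ i x₀ hx₀
      have hr := hm.model.pos
      obtain ⟨K, hK, hOK, hKe⟩ := hm.exists_isCompact
      obtain ⟨C, hC1, hC⟩ := exists_norm_iteratedFDeriv_pushChart_le hh hφ (hh i) 0 hK hKe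
      obtain ⟨C', hC'0, hC'⟩ := hm.model.exists_growthAt 0 (le_max_left 1 (C * δ))
      refine ⟨Metric.ball x₁ (r / 2), Metric.isOpen_ball.mem_nhds hx₁, C' * C, by positivity, ?_⟩
      rintro _ ⟨w, v, hw, hv, hwδ, hvδ, rfl⟩ x hx
      have hx' := Metric.ball_subset_closedBall hx
      have hxO := hm.closedBall_subset hx'
      have hvO := fun y hy => mem_closedBall_of_norm_le hr (hsm v hv hvδ y hy)
      have hwO := fun y hy => mem_closedBall_of_norm_le hr (hsm w hw hwδ y hy)
      have hXO := hm.X_mem hx' (hvO x hxO)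
      have hW : ∀ y ∈ O, GrowthAt 0 (C * normC h φ 0 w) 1 (pushChart (h i) w) y := by
        intro y hy
        obtain ⟨h1, h2⟩ := hC 0 le_rfl w hw y (hOK hy)
        refine ⟨h1, fun k hk => ?_⟩
        obtain rfl : k = 0 := by omega
        simpa using h2
      have h1 := hC' (pushChart (h i) v) (pushChart (h i) w) (C * normC h φ 0 w) 1 x le_rfl
        ((mul_le_mul_of_nonneg_left hwδ.le (by linarith)).trans (le_max_right _ _)) hx' (hvO x hxO)
        ⟨(hC 0 le_rfl v hv x (hOK hxO)).1, fun k hk1 hk2 => by omega⟩ (hW x hxO) (hW _ hXO)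
        (hwO _ hXO)
      refine (h1.congr (hm.pushChart_s₁_eventuallyEq (hh i) hvO hwO hx)).mono zero_le_one ?_
      rw [mul_assoc])
  exact ⟨C, hC0, fun w v hw hv hwδ hvδ => hC _ ⟨w, v, hw, hv, hwδ, hvδ, rfl⟩⟩

lemma exists_mem_image_tsupport (φ : SmoothPartitionOfUnity ι (𝓡 n) M univ)
    (hφ : φ.IsSubordinate (fun i => (h i).source)) (m : M) :
    ∃ i, ∃ x ∈ h i '' tsupport (φ i), (h i).symm x = m := by
  obtain ⟨i, hi⟩ := φ.exists_pos_of_mem (mem_univ m)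
  have hm : m ∈ tsupport (φ i) := subset_tsupport _ hi.ne'
  exact ⟨i, h i m, ⟨m, hm, rfl⟩, (h i).left_inv (hφ i hm)⟩

/-- The defining equation of `s₁`. -/
lemma exp_comp_exp_eq (hh : ∀ i, h i ∈ IsManifold.maximalAtlas (𝓡 n) ∞ M)
    (hφ : φ.IsSubordinate (fun i => (h i).source))
    (hδ : ∀ i, ∀ x₀ ∈ h i '' tsupport (φ i), HasSmallModel g h φ δ i x₀) {w v : VField n M}
    (hw : IsGamma 0 w) (hv : IsGamma 0 v) (hwδ : normC h φ 0 w < δ) (hvδ : normC h φ 0 v < δ) :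
    Exp g w ∘ Exp g v = Exp g (w + v + s₁ g w v) := by
  ext1 m
  obtain ⟨i, x, hx, rfl⟩ := exists_mem_image_tsupport φ hφ m
  obtain ⟨x₁, r, O, X, G, hm, hx₁, hsm⟩ := hδ i x hx
  have hr := hm.model.pos
  have hx' := Metric.ball_subset_closedBall hx₁
  have hvx := mem_closedBall_of_norm_le hr (hsm v hv hvδ x (hm.closedBall_subset hx'))
  exact hm.exp_s₁ (hh i) (hm.model.closedBall_subset _ hx') (hm.model.closedBall_subset _ hvx)
    (hm.model.closedBall_subset _
      (mem_closedBall_of_norm_le hr (hsm w hw hwδ _ (hm.X_mem hx' hvx))))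

/-- Uniqueness of small solutions of the defining equation of `s₁`. -/
lemma eq_s₁_of_exp_eq (hh : ∀ i, h i ∈ IsManifold.maximalAtlas (𝓡 n) ∞ M)
    (hφ : φ.IsSubordinate (fun i => (h i).source))
    (hδ : ∀ i, ∀ x₀ ∈ h i '' tsupport (φ i), HasSmallModel g h φ δ i x₀) {w v s : VField n M}
    (hw : IsGamma 0 w) (hv : IsGamma 0 v) (hs : IsGamma 0 s) (hwδ : normC h φ 0 w < δ)
    (hvδ : normC h φ 0 v < δ) (hsδ : normC h φ 0 s < δ)
    (heq : Exp g w ∘ Exp g v = Exp g (w + v + s)) : s = s₁ g w v := by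
  ext1 m
  obtain ⟨i, x, hx, rfl⟩ := exists_mem_image_tsupport φ hφ m
  obtain ⟨x₁, r, O, X, G, hm, hx₁, hsm⟩ := hδ i x hx
  have hr := hm.model.pos
  have hx' := Metric.ball_subset_closedBall hx₁
  have hxO := hm.closedBall_subset hx'
  have hvx := mem_closedBall_of_norm_le hr (hsm v hv hvδ x hxO)
  refine hm.eq_s₁ (hh i) (hm.model.closedBall_subset _ hx') (hm.model.closedBall_subset _ hvx)
    (hm.model.closedBall_subset _
      (mem_closedBall_of_norm_le hr (hsm w hw hwδ _ (hm.X_mem hx' hvx)))) ?_ (congrFun heq _)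
  rw [pushChart_add, pushChart_add, Pi.add_apply, Pi.add_apply, mem_ball_zero_iff]
  have h1 := hsm v hv hvδ x hxO
  have h2 := hsm w hw hwδ x hxO
  have h3 := hsm s hs hsδ x hxO
  have h4 := norm_add₃_le (a := pushChart (h i) w x) (b := pushChart (h i) v x)
    (c := pushChart (h i) s x)
  linarith

set_option maxHeartbeats 1000000 in
/-- The `C⁰` estimate: the part `w₁` contributes its increment along the displacement by `v`. -/
theorem exists_normC_zero_le (hh : ∀ i, h i ∈ IsManifold.maximalAtlas (𝓡 n) ∞ M)
    (hφ : φ.IsSubordinate (fun i => (h i).source))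
    (hδ : ∀ i, ∀ x₀ ∈ h i '' tsupport (φ i), HasSmallModel g h φ δ i x₀) :
    ∃ C > (0 : ℝ), ∀ w₁ w₂ v : VField n M, IsGamma 1 w₁ → IsGamma 0 w₂ → IsGamma 0 v →
      normC h φ 0 w₁ + normC h φ 0 w₂ < δ → normC h φ 0 v < δ →
      IsGamma 0 (s₁ g (w₁ + w₂) v) ∧ normC h φ 0 (s₁ g (w₁ + w₂) v) ≤
        C * (normC h φ 1 w₁ * normC h φ 0 v + normC h φ 0 w₂) := by
  obtain ⟨Cs, _, hcont⟩ := exists_normC_s₁_le hh hφ hδ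
  have hΓ : ∀ w₁ w₂ : VField n M, IsGamma 1 w₁ → IsGamma 0 w₂ →
      normC h φ 0 w₁ + normC h φ 0 w₂ < δ →
      IsGamma 0 (w₁ + w₂) ∧ normC h φ 0 (w₁ + w₂) < δ := fun w₁ w₂ h1 h2 h3 =>
    ⟨(h1.mono zero_le_one).add h2, (normC_add_le hh hφ (h1.mono zero_le_one) h2).trans_lt h3⟩
  obtain ⟨C, hC0, hC⟩ := exists_normC_le hh hφ 0
    {p : VField n M × ℝ | ∃ w₁ w₂ v, IsGamma 1 w₁ ∧ IsGamma 0 w₂ ∧ IsGamma 0 v ∧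
      normC h φ 0 w₁ + normC h φ 0 w₂ < δ ∧ normC h φ 0 v < δ ∧
      p = (s₁ g (w₁ + w₂) v, normC h φ 1 w₁ * normC h φ 0 v + normC h φ 0 w₂)}
    (by
      rintro _ ⟨w₁, w₂, v, -, -, -, -, -, rfl⟩
      exact add_nonneg (mul_nonneg (normC_nonneg 1 w₁) (normC_nonneg 0 v)) (normC_nonneg 0 w₂)) (by
      intro i x₀ hx₀
      obtain ⟨x₁, r, O, X, G, hm, hx₁, hsm⟩ := hδ i x₀ hx₀
      have hr := hm.model.pos
      obtain ⟨K, hK, hOK, hKe⟩ := hm.exists_isCompact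
      obtain ⟨C, hC1, hC⟩ := exists_norm_iteratedFDeriv_pushChart_le hh hφ (hh i) 1 hK hKe
      obtain ⟨C', hC'1, hC'⟩ := hm.model.exists_norm_sub_le
      refine ⟨Metric.ball x₁ (r / 2), Metric.isOpen_ball.mem_nhds hx₁,
        C' * (C * C + C * r + C * C + 2 * C), by positivity, ?_⟩
      rintro _ ⟨w₁, w₂, v, hw₁, hw₂, hv, hwδ, hvδ, rfl⟩ x hx
      obtain ⟨hw, hwδ'⟩ := hΓ w₁ w₂ hw₁ hw₂ hwδ
      have hx' := Metric.ball_subset_closedBall hx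
      have hxO := hm.closedBall_subset hx'
      have hvO := fun y hy => mem_closedBall_of_norm_le hr (hsm v hv hvδ y hy)
      have hwO := fun y hy => mem_closedBall_of_norm_le hr (hsm _ hw hwδ' y hy)
      have hXO := hm.X_mem hx' (hvO x hxO)
      have hs := (hcont (w₁ + w₂) v hw hv hwδ' hvδ).1
      refine ⟨(hs.contDiffOn_pushChart (hh i)).contDiffAt
        ((h i).open_target.mem_nhds (hKe (hOK hxO))), fun k hk => ?_⟩
      obtain rfl : k = 0 := by omega
      rw [norm_iteratedFDeriv_zero, one_pow, mul_one,
        (hm.pushChart_s₁_eventuallyEq (hh i) hvO hwO hx).self_of_nhds]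
      simp only
      set V := pushChart (h i) v x with hV
      set Y := X (x, V) with hY
      have b₁ : ∀ y ∈ O, ‖pushChart (h i) w₁ y‖ ≤ C * normC h φ 1 w₁ := by
        intro y hy
        have h1 := (hC 0 zero_le_one w₁ (hw₁.mono zero_le_one) y (hOK hy)).2
        rw [norm_iteratedFDeriv_zero] at h1
        exact h1.trans (mul_le_mul_of_nonneg_left (normC_mono w₁ zero_le_one) (by linarith))
      have b₂ : ∀ y ∈ O, ‖pushChart (h i) w₂ y‖ ≤ C * normC h φ 0 w₂ := by
        intro y hy
        have h1 := (hC 0 zero_le_one w₂ hw₂ y (hOK hy)).2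
        rwa [norm_iteratedFDeriv_zero] at h1
      have bV : ‖V‖ ≤ C * normC h φ 0 v := by
        have h1 := (hC 0 zero_le_one v hv x (hOK hxO)).2
        rwa [norm_iteratedFDeriv_zero] at h1
      have bV' : ‖V‖ ≤ r := (hsm v hv hvδ x hxO).trans (by linarith)
      obtain ⟨hXx, hG⟩ := hC' x hx' V (hvO x hxO)
      have hG' := hG _ (hwO Y hXO)
      -- the mean value inequality for `w₁` between `x` and the displaced point
      have hmv : ‖pushChart (h i) w₁ Y - pushChart (h i) w₁ x‖ ≤
          C * normC h φ 1 w₁ * ‖Y - x‖ := by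
        refine hm.convex.norm_image_sub_le_of_norm_fderiv_le (𝕜 := ℝ) (fun y hy => ?_)
          (fun y hy => ?_) hxO hXO
        · exact (hC 1 le_rfl w₁ hw₁ y (hOK hy)).1.differentiableAt (by simp)
        · have h1 := (hC 1 le_rfl w₁ hw₁ y (hOK hy)).2
          rwa [← norm_iteratedFDeriv_one]
      have hsplit : ∀ y, pushChart (h i) (w₁ + w₂) y =
          pushChart (h i) w₁ y + pushChart (h i) w₂ y := fun y => by
        rw [pushChart_add, Pi.add_apply]
      rw [hsplit Y] at hG' ⊢
      rw [hsplit x]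
      set a := pushChart (h i) w₁ Y
      set b := pushChart (h i) w₂ Y
      set c := pushChart (h i) w₁ x
      set d := pushChart (h i) w₂ x
      -- the three parts are of the sizes of `‖V‖ ‖a + b‖`, of the increment of `w₁`, and of `w₂`
      have e1 : G ((x, V), a + b) - (c + d) = (G ((x, V), a + b) - (a + b)) + (a - c) + (b - d) := by
        abel
      have hN1 := normC_nonneg (h := h) (φ := φ) 1 w₁
      have hN2 := normC_nonneg (h := h) (φ := φ) 0 w₂
      have hN3 := normC_nonneg (h := h) (φ := φ) 0 v
      have hC0 : (0 : ℝ) ≤ C := by linarith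
      have hC'0 : (0 : ℝ) ≤ C' := by linarith
      have q1 : ‖V‖ * ‖a + b‖ ≤ C * C * (normC h φ 1 w₁ * normC h φ 0 v) + C * r * normC h φ 0 w₂ := by
        calc ‖V‖ * ‖a + b‖ ≤ ‖V‖ * (‖a‖ + ‖b‖) := by gcongr; exact norm_add_le _ _
          _ = ‖V‖ * ‖a‖ + ‖V‖ * ‖b‖ := mul_add _ _ _
          _ ≤ (C * normC h φ 0 v) * (C * normC h φ 1 w₁) + r * (C * normC h φ 0 w₂) := by
            gcongr
            · exact b₁ Y hXO
            · exact b₂ Y hXO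
          _ = _ := by ring
      have q2 : ‖a - c‖ ≤ C' * (C * C) * (normC h φ 1 w₁ * normC h φ 0 v) := by
        calc ‖a - c‖ ≤ C * normC h φ 1 w₁ * (C' * (C * normC h φ 0 v)) := by
              refine hmv.trans ?_
              gcongr
              exact hXx.trans (by gcongr)
          _ = _ := by ring
      have q3 : ‖b - d‖ ≤ C' * (2 * C) * normC h φ 0 w₂ := by
        calc ‖b - d‖ ≤ ‖b‖ + ‖d‖ := norm_sub_le _ _
          _ ≤ C * normC h φ 0 w₂ + C * normC h φ 0 w₂ := add_le_add (b₂ Y hXO) (b₂ x hxO)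
          _ = 1 * (2 * C) * normC h φ 0 w₂ := by ring
          _ ≤ _ := by gcongr
      have p1 : 0 ≤ normC h φ 1 w₁ * normC h φ 0 v := mul_nonneg hN1 hN3
      rw [e1]
      calc ‖(G ((x, V), a + b) - (a + b)) + (a - c) + (b - d)‖
          ≤ ‖G ((x, V), a + b) - (a + b)‖ + ‖a - c‖ + ‖b - d‖ := norm_add₃_le
        _ ≤ C' * (C * C * (normC h φ 1 w₁ * normC h φ 0 v) + C * r * normC h φ 0 w₂) +
            C' * (C * C) * (normC h φ 1 w₁ * normC h φ 0 v) +
            C' * (2 * C) * normC h φ 0 w₂ :=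
          add_le_add (add_le_add (hG'.trans (mul_le_mul_of_nonneg_left q1 hC'0)) q2) q3
        _ ≤ C' * (C * C + C * r + C * C + 2 * C) *
            (normC h φ 1 w₁ * normC h φ 0 v + normC h φ 0 w₂) := by
          set P := normC h φ 1 w₁ * normC h φ 0 v
          set Q := normC h φ 0 w₂
          have k1 : 0 ≤ C' * (C * r + 2 * C) * P := by positivity
          have k2 : 0 ≤ C' * (C * C + C * C) * Q := by positivity
          linarith)
  exact ⟨C, hC0, fun w₁ w₂ v h1 h2 h3 h4 h5 => hC _ ⟨w₁, w₂, v, h1, h2, h3, h4, h5, rfl⟩⟩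

/-- A growth bound with `l ≥ 1` implies a uniform bound for the derivatives. -/
lemma GrowthAt.uniform {F G : Type*} [NormedAddCommGroup F] [NormedSpace ℝ F]
    [NormedAddCommGroup G] [NormedSpace ℝ G] {R : ℕ} {A l : ℝ} {f : F → G} {x : F}
    (hf : GrowthAt R A l f x) (hl : 1 ≤ l) (hA : 0 ≤ A) : GrowthAt R (A * l ^ (R - 1)) 1 f x := by
  refine ⟨hf.1, fun k hk => (hf.2 k hk).trans ?_⟩
  rw [one_pow, mul_one]
  gcongr

set_option maxHeartbeats 1000000 in
/-- The first `C^R` estimate. It is proved for every geometric majorant `A l ^ k` of the norms of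
`w` and `v`, and then `le_of_geometric_majorants` selects the majorant. -/
theorem exists_normC_le_first (hh : ∀ i, h i ∈ IsManifold.maximalAtlas (𝓡 n) ∞ M)
    (hφ : φ.IsSubordinate (fun i => (h i).source)) (hδ1 : δ ≤ 1)
    (hδ : ∀ i, ∀ x₀ ∈ h i '' tsupport (φ i), HasSmallModel g h φ δ i x₀) (R : ℕ) (hR : 1 ≤ R) :
    ∃ C > (0 : ℝ), ∀ w v : VField n M, IsGamma R w → IsGamma R v →
      normC h φ 1 w < δ → normC h φ 1 v < δ → IsGamma R (s₁ g w v) ∧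
      normC h φ R (s₁ g w v) ≤ C * (normC h φ R w + normC h φ 1 w * normC h φ R v) := by
  have h3 : (1 : ℝ) ≤ 3 ^ R ^ 2 := one_le_pow₀ (by norm_num)
  obtain ⟨C, hC0, hC⟩ := exists_normC_le hh hφ R
    {p : VField n M × ℝ | ∃ w v A l, IsGamma R w ∧ IsGamma R v ∧ normC h φ 1 w < δ ∧
      normC h φ 1 v < δ ∧ 0 < A ∧ 1 ≤ l ∧ A ≤ 1 ∧
      (∀ k, k < R → normC h φ (k + 1) w ≤ 3 ^ (R ^ 2) * A * l ^ k) ∧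
      (∀ k, k < R → normC h φ (k + 1) v ≤ 3 ^ (R ^ 2) * l ^ k) ∧
      p = (s₁ g w v, A * l ^ (R - 1))}
    (by
      rintro _ ⟨w, v, A, l, -, -, -, -, hA, hl, -, -, -, rfl⟩
      exact mul_nonneg hA.le (pow_nonneg (by linarith) _)) (by
      intro i x₀ hx₀
      obtain ⟨x₁, r, O, X, G, hm, hx₁, hsm⟩ := hδ i x₀ hx₀
      have hr := hm.model.pos
      obtain ⟨K, hK, hOK, hKe⟩ := hm.exists_isCompact
      obtain ⟨C, hC1, hC⟩ := exists_norm_iteratedFDeriv_pushChart_le hh hφ (hh i) R hK hKe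
      have hB : 1 ≤ C * 3 ^ R ^ 2 := one_le_mul_of_one_le_of_one_le hC1 h3
      obtain ⟨C', hC'0, hC'⟩ := hm.model.exists_growthAt R hB
      refine ⟨Metric.ball x₁ (r / 2), Metric.isOpen_ball.mem_nhds hx₁, C' * (C * 3 ^ R ^ 2),
        by positivity, ?_⟩
      rintro _ ⟨w, v, A, l, hw, hv, hwδ, hvδ, hA, hl, hA1, hwl, hvl, rfl⟩ x hx
      have hw0 := (normC_mono (h := h) (φ := φ) w zero_le_one).trans_lt hwδ
      have hv0 := (normC_mono (h := h) (φ := φ) v zero_le_one).trans_lt hvδ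
      have hx' := Metric.ball_subset_closedBall hx
      have hxO := hm.closedBall_subset hx'
      have hvO := fun y hy =>
        mem_closedBall_of_norm_le hr (hsm v (hv.mono (Nat.zero_le R)) hv0 y hy)
      have hwO := fun y hy =>
        mem_closedBall_of_norm_le hr (hsm w (hw.mono (Nat.zero_le R)) hw0 y hy)
      have hXO := hm.X_mem hx' (hvO x hxO)
      have hW : ∀ y ∈ O, GrowthAt R (C * 3 ^ R ^ 2 * A) l (pushChart (h i) w) y := by
        intro y hy
        refine ⟨(hC R le_rfl w hw y (hOK hy)).1, fun k hk => ?_⟩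
        refine ((hC k hk w (hw.mono hk) y (hOK hy)).2).trans ?_
        rw [mul_assoc C, mul_assoc C]
        refine mul_le_mul_of_nonneg_left ?_ (by linarith)
        rcases k with _ | k
        · exact (normC_mono w zero_le_one).trans (hwl 0 (by omega))
        · exact hwl k (by omega)
      have hV : DerivGrowthAt R (C * 3 ^ R ^ 2) l (pushChart (h i) v) x := by
        refine ⟨(hC R le_rfl v hv x (hOK hxO)).1, fun k hk1 hk => ?_⟩
        refine ((hC k hk v (hv.mono hk) x (hOK hxO)).2).trans ?_
        rw [mul_assoc C]
        refine mul_le_mul_of_nonneg_left ?_ (by linarith)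
        obtain ⟨j, rfl⟩ : ∃ j, k = j + 1 := ⟨k - 1, by omega⟩
        exact hvl j (by omega)
      have h1 := hC' (pushChart (h i) v) (pushChart (h i) w) (C * 3 ^ R ^ 2 * A) l x hl
        (mul_le_of_le_one_right (by linarith) hA1) hx' (hvO x hxO) hV (hW x hxO) (hW _ hXO)
        (hwO _ hXO)
      have h2 := (h1.congr (hm.pushChart_s₁_eventuallyEq (hh i) hvO hwO hx)).uniform hl
        (by positivity)
      refine h2.mono zero_le_one (le_of_eq ?_)
      simp only
      ring)
  refine ⟨2 * C, by positivity, fun w v hw hv hwδ hvδ => ?_⟩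
  have hN := fun (u : VField n M) k => normC_nonneg (h := h) (φ := φ) k u
  have hconv : ∀ u : VField n M, IsGamma R u → ∀ k, k + 1 < R →
      normC h φ (k + 1) u ^ 2 ≤ 3 ^ 2 * (normC h φ k u * normC h φ (k + 2) u) := fun u hu k hk =>
    sq_normC_le hh hφ (hu.mono (by omega))
  refine ⟨?_, le_of_geometric_majorants (K := 3) (by norm_num) R hR hC0.le (hN w) (hN v)
    (normC_mono w) (hconv w hw) (hconv v hv) (hvδ.le.trans hδ1) fun A l hA hl hwl hvl hA1 => ?_⟩
  · -- some geometric majorant exists: take `A = 1` and `l` large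
    obtain ⟨l, hl1, hl⟩ : ∃ l : ℝ, 1 ≤ l ∧ ∀ k, k < R → normC h φ (k + 1) w ≤ l ^ k ∧
        normC h φ (k + 1) v ≤ l ^ k := by
      refine ⟨max 1 (max (normC h φ R w) (normC h φ R v)), le_max_left _ _, fun k hk => ?_⟩
      rcases Nat.eq_zero_or_pos k with rfl | hk0
      · rw [pow_zero]
        exact ⟨hwδ.le.trans hδ1, hvδ.le.trans hδ1⟩
      · have h4 : max 1 (max (normC h φ R w) (normC h φ R v)) ≤
            max 1 (max (normC h φ R w) (normC h φ R v)) ^ k :=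
          le_self_pow₀ (le_max_left _ _) (by omega)
        exact ⟨((normC_mono w (by omega : k + 1 ≤ R)).trans
          ((le_max_left _ _).trans (le_max_right _ _))).trans h4,
          ((normC_mono v (by omega : k + 1 ≤ R)).trans
          ((le_max_right _ _).trans (le_max_right _ _))).trans h4⟩
    refine (hC (s₁ g w v, 1 * l ^ (R - 1)) ⟨w, v, 1, l, hw, hv, hwδ, hvδ, one_pos, hl1, le_rfl,
      fun k hk => ?_, fun k hk => ?_, rfl⟩).1
    · rw [mul_one]
      exact (hl k hk).1.trans (le_mul_of_one_le_left (pow_nonneg (by linarith) _) h3)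
    · exact (hl k hk).2.trans (le_mul_of_one_le_left (pow_nonneg (by linarith) _) h3)
  · rw [max_eq_left (hwδ.le.trans hδ1)] at hA1
    exact (hC _ ⟨w, v, A, l, hw, hv, hwδ, hvδ, hA, hl, hA1, hwl, hvl, rfl⟩).2

set_option maxHeartbeats 1000000 in
/-- The second `C^R` estimate, by the same method as the first. Here `A` and `B` stand for the
sizes of `normC h φ 2 w` and `normC h φ 0 v`. -/
theorem exists_normC_le_second (hh : ∀ i, h i ∈ IsManifold.maximalAtlas (𝓡 n) ∞ M)
    (hφ : φ.IsSubordinate (fun i => (h i).source)) (hδ1 : δ ≤ 1)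
    (hδ : ∀ i, ∀ x₀ ∈ h i '' tsupport (φ i), HasSmallModel g h φ δ i x₀) (R : ℕ) (hR : 1 ≤ R) :
    ∃ C > (0 : ℝ), ∀ w v : VField n M, IsGamma (R + 1) w → IsGamma R v →
      normC h φ 1 w < δ → normC h φ 1 v < δ →
      normC h φ R (s₁ g w v) ≤
        C * (normC h φ 2 w * normC h φ R v + normC h φ (R + 1) w * normC h φ 0 v) := by
  have h3 : (1 : ℝ) ≤ 3 ^ R ^ 2 := one_le_pow₀ (by norm_num)
  obtain ⟨Cf, _, hΓ⟩ := exists_normC_le_first hh hφ hδ1 hδ R hR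
  obtain ⟨C, hC0, hC⟩ := exists_normC_le hh hφ R
    {p : VField n M × ℝ | ∃ w v A B l, IsGamma (R + 1) w ∧ IsGamma R v ∧ normC h φ 1 w < δ ∧
      normC h φ 1 v < δ ∧ 0 < A ∧ 0 < B ∧ 1 ≤ l ∧ normC h φ 2 w ≤ A ∧
      (∀ k, k < R → normC h φ (k + 2) w ≤ 3 ^ (R ^ 2) * A * l ^ k) ∧
      (∀ k, k < R → normC h φ (k + 1) w ≤ 3 ^ (R ^ 2) * l ^ k) ∧
      (∀ k, k < R → normC h φ (k + 1) v ≤ 3 ^ (R ^ 2) * l ^ k) ∧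
      (∀ k, k ≤ R → normC h φ k v ≤ 3 ^ (R ^ 2) * B * l ^ k) ∧
      p = (s₁ g w v, normC h φ 1 w * normC h φ R v + A * B * l ^ (R - 1))}
    (by
      rintro _ ⟨w, v, A, B, l, -, -, -, -, hA, hB, hl, -, -, -, -, -, rfl⟩
      exact add_nonneg (mul_nonneg (normC_nonneg 1 w) (normC_nonneg R v))
        (mul_nonneg (mul_nonneg hA.le hB.le) (pow_nonneg (by linarith) _))) (by
      intro i x₀ hx₀
      obtain ⟨x₁, r, O, X, G, hm, hx₁, hsm⟩ := hδ i x₀ hx₀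
      have hr := hm.model.pos
      obtain ⟨K, hK, hOK, hKe⟩ := hm.exists_isCompact
      obtain ⟨C, hC1, hC⟩ := exists_norm_iteratedFDeriv_pushChart_le hh hφ (hh i) (R + 1) hK hKe
      have hB : 1 ≤ C * 3 ^ R ^ 2 := one_le_mul_of_one_le_of_one_le hC1 h3
      obtain ⟨C', hC'0, hC'⟩ := hm.model.exists_norm_iteratedFDeriv_le R hB
      refine ⟨Metric.ball x₁ (r / 2), Metric.isOpen_ball.mem_nhds hx₁,
        C' * ((C * 3 ^ R ^ 2) * (C * 3 ^ R ^ 2)), by positivity, ?_⟩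
      rintro _ ⟨w, v, A, B, l, hw, hv, hwδ, hvδ, hA, hB0, hl, hwA, hwl2, hwl1, hvl1, hvl, rfl⟩ x hx
      have hw0 := (normC_mono (h := h) (φ := φ) w zero_le_one).trans_lt hwδ
      have hv0 := (normC_mono (h := h) (φ := φ) v zero_le_one).trans_lt hvδ
      have hx' := Metric.ball_subset_closedBall hx
      have hxO := hm.closedBall_subset hx'
      have hvO := fun y hy =>
        mem_closedBall_of_norm_le hr (hsm v (hv.mono (Nat.zero_le R)) hv0 y hy)
      have hwO := fun y hy =>
        mem_closedBall_of_norm_le hr (hsm w (hw.mono (Nat.zero_le (R + 1))) hw0 y hy)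
      have hXO := hm.X_mem hx' (hvO x hxO)
      have hl0 : (0 : ℝ) ≤ l := by linarith
      have hC0' : (0 : ℝ) ≤ C := by linarith
      have hAA : A ≤ 3 ^ R ^ 2 * A := le_mul_of_one_le_left hA.le h3
      have hW : ∀ y ∈ O, ∀ k ≤ R + 1, ‖iteratedFDeriv ℝ k (pushChart (h i) w) y‖ ≤
          C * normC h φ k w := fun y hy k hk => (hC k hk w (hw.mono hk) y (hOK hy)).2
      have hNk : ∀ k ≤ R, normC h φ k w ≤ 3 ^ R ^ 2 * A * l ^ (k - 1) := by
        intro k hk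
        rcases Nat.lt_or_ge k 2 with hk2 | hk2
        · rw [show k - 1 = 0 by omega, pow_zero, mul_one]
          exact ((normC_mono w hk2.le).trans hwA).trans hAA
        · obtain ⟨j, rfl⟩ : ∃ j, k = j + 2 := ⟨k - 2, by omega⟩
          refine (hwl2 j (by omega)).trans ?_
          gcongr
          omega
      have hNk' : ∀ k ≤ R, normC h φ (k + 1) w ≤ 3 ^ R ^ 2 * A * l ^ (k - 1) := by
        intro k hk
        rcases k with _ | j
        · rw [pow_zero, mul_one]
          exact ((normC_mono w (by norm_num : 0 + 1 ≤ 2)).trans hwA).trans hAA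
        · exact hwl2 j (by omega)
      have key := hC' (pushChart (h i) v) (pushChart (h i) w) (C * 3 ^ R ^ 2 * A)
        (C * normC h φ R v) (C * normC h φ 1 w) (C * 3 ^ R ^ 2 * B) l x hl (by positivity) hx'
        (hvO x hxO)
        ⟨(hC R (by omega) v hv x (hOK hxO)).1, fun k hk1 hk => by
          refine ((hC k (by omega) v (hv.mono hk) x (hOK hxO)).2).trans ?_
          rw [mul_assoc C]
          refine mul_le_mul_of_nonneg_left ?_ hC0'
          obtain ⟨j, rfl⟩ : ∃ j, k = j + 1 := ⟨k - 1, by omega⟩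
          exact hvl1 j (by omega)⟩
        (fun k hk => by
          refine ((hC k (by omega) v (hv.mono hk) x (hOK hxO)).2).trans ?_
          rw [mul_assoc C, mul_assoc C]
          exact mul_le_mul_of_nonneg_left (hvl k hk) hC0')
        (fun k hk => ((hC k (by omega) v (hv.mono hk) x (hOK hxO)).2).trans
          (mul_le_mul_of_nonneg_left (normC_mono v hk) hC0'))
        (fun y hy => by
          have hWs : ContDiffAt ℝ (R + 1 : ℕ) (pushChart (h i) w) y :=
            (hC (R + 1) le_rfl w hw y (hOK hy)).1
          have hWs' : ContDiffAt ℝ R (pushChart (h i) w) y :=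
            hWs.of_le (by exact_mod_cast Nat.le_succ R)
          refine ⟨hWs, hwO y hy, ⟨hWs', fun k hk1 hk => ?_⟩, ⟨hWs', fun k hk => ?_⟩,
            growthAt_fderiv hWs fun k hk => ?_, ?_, ?_⟩
          · refine (hW y hy k (by omega)).trans ?_
            rw [mul_assoc C]
            refine mul_le_mul_of_nonneg_left ?_ hC0'
            obtain ⟨j, rfl⟩ : ∃ j, k = j + 1 := ⟨k - 1, by omega⟩
            exact hwl1 j (by omega)
          · refine (hW y hy k (by omega)).trans ?_
            rw [mul_assoc C, mul_assoc C]
            exact mul_le_mul_of_nonneg_left (hNk k hk) hC0'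
          · refine (hW y hy (k + 1) (by omega)).trans ?_
            rw [mul_assoc C, mul_assoc C]
            exact mul_le_mul_of_nonneg_left (hNk' k hk) hC0'
          · have h1 := hW y hy 0 (by omega)
            rw [norm_iteratedFDeriv_zero] at h1
            exact h1.trans (mul_le_mul_of_nonneg_left (normC_mono w zero_le_one) hC0')
          · have h1 := hW y hy 1 (by omega)
            rwa [norm_iteratedFDeriv_one] at h1)
      have hs := (hΓ w v (hw.mono (Nat.le_succ R)) hv hwδ hvδ).1
      refine GrowthAt.congr ⟨?_, fun k hk => (key k hk).trans ?_⟩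
        (hm.pushChart_s₁_eventuallyEq (hh i) hvO hwO hx)
      · exact ((hs.contDiffOn_pushChart (hh i)).contDiffAt
          ((h i).open_target.mem_nhds (hKe (hOK hxO)))).congr_of_eventuallyEq
          (hm.pushChart_s₁_eventuallyEq (hh i) hvO hwO hx).symm
      · rw [one_pow, mul_one, mul_assoc C']
        refine mul_le_mul_of_nonneg_left ?_ hC'0
        have hp : 0 ≤ normC h φ 1 w * normC h φ R v :=
          mul_nonneg (normC_nonneg 1 w) (normC_nonneg R v)
        have e1 : C * normC h φ 1 w * (C * normC h φ R v) + C * 3 ^ R ^ 2 * A *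
            (C * 3 ^ R ^ 2 * B) * l ^ (R - 1) = C * C * (normC h φ 1 w * normC h φ R v) +
            (C * 3 ^ R ^ 2) * (C * 3 ^ R ^ 2) * (A * B * l ^ (R - 1)) := by ring
        rw [e1]
        simp only
        rw [mul_add]
        have e2 : C ≤ C * 3 ^ R ^ 2 := le_mul_of_one_le_right hC0' h3
        gcongr)
  refine ⟨8 * 3 ^ (R ^ 2) * C, by positivity, fun w v hw hv hwδ hvδ => ?_⟩
  have hN := fun (u : VField n M) k => normC_nonneg (h := h) (φ := φ) k u
  exact le_of_geometric_majorants' (K := 3) (by norm_num) R hR hC0.le (hN w) (hN v)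
    (normC_mono w) (normC_mono v) (fun k hk => sq_normC_le hh hφ (hw.mono (by omega)))
    (fun k hk => sq_normC_le hh hφ (hv.mono (by omega))) (hvδ.le.trans hδ1) (hwδ.le.trans hδ1)
    fun A B l hA hB hl hwA hwl2 hwl1 hvl1 hvl =>
      (hC _ ⟨w, v, A, B, l, hw, hv, hwδ, hvδ, hA, hB, hl, hwA, hwl2, hwl1, hvl1, hvl, rfl⟩).2

end Estimates

theorem proposition2p2 {n : ℕ} {M : Type*} [TopologicalSpace M]
    [ChartedSpace (EuclideanSpace ℝ (Fin n)) M] [IsManifold (𝓡 n) ∞ M]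
    [T2Space M] [CompactSpace M] (g : SmoothMetric n M)
    {ι : Type*} [Fintype ι] (h : ι → OpenPartialHomeomorph M (EuclideanSpace ℝ (Fin n)))
    (hh : ∀ i, h i ∈ IsManifold.maximalAtlas (𝓡 n) ∞ M)
    (φ : SmoothPartitionOfUnity ι (𝓡 n) M univ)
    (hφ : φ.IsSubordinate (fun i => (h i).source)) :
    ∃ δ > (0 : ℝ), ∃ ρ > (0 : ℝ),
      -- `s₁(w, v)` is well defined by its equation: it is the only small solution
      (∀ w v : VField n M, IsGamma 0 w → IsGamma 0 v →
        normC h φ 0 w < δ → normC h φ 0 v < δ →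
        IsGamma 0 (s₁ g w v) ∧ normC h φ 0 (s₁ g w v) < ρ ∧
        Exp g w ∘ Exp g v = Exp g (w + v + s₁ g w v) ∧
        ∀ s : VField n M, IsGamma 0 s → normC h φ 0 s < ρ →
          Exp g w ∘ Exp g v = Exp g (w + v + s) → s = s₁ g w v) ∧
      -- the `C⁰` estimate
      (∃ C > (0 : ℝ), ∀ w₁ w₂ v : VField n M,
        IsGamma 1 w₁ → IsGamma 1 w₂ → IsGamma 0 v →
        normC h φ 1 w₁ < δ → normC h φ 0 w₂ < δ → normC h φ 0 v < δ →
        IsGamma 0 (s₁ g (w₁ + w₂) v) ∧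
        normC h φ 0 (s₁ g (w₁ + w₂) v) ≤
          C * (normC h φ 1 w₁ * normC h φ 0 v + normC h φ 0 w₂)) ∧
      -- the `C^R` estimates
      (∀ R : ℕ, 1 ≤ R → ∃ C > (0 : ℝ), ∀ w v : VField n M,
        IsGamma R w → IsGamma R v → normC h φ 1 w < δ → normC h φ 1 v < δ →
        IsGamma R (s₁ g w v) ∧
        normC h φ R (s₁ g w v) ≤ C * (normC h φ R w + normC h φ 1 w * normC h φ R v) ∧
        (IsGamma (R + 1) w →
          normC h φ R (s₁ g w v) ≤
            C * (normC h φ 2 w * normC h φ R v + normC h φ (R + 1) w * normC h φ 0 v))) := by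
  -- `ρ` makes all fields small enough for the local models, and `δ` makes `s₁` smaller than `ρ`
  obtain ⟨ρ, hρ0, hρ⟩ := exists_hasSmallModel g hh hφ
  obtain ⟨C₀, hC₀, hs⟩ := exists_normC_s₁_le hh hφ hρ
  set δ := min (min 1 (ρ / 2)) (ρ / C₀) with hδ
  have hδ0 : 0 < δ := lt_min (lt_min one_pos (by linarith)) (by positivity)
  have hδ1 : δ ≤ 1 := (min_le_left _ _).trans (min_le_left _ _)
  have hδρ2 : δ ≤ ρ / 2 := (min_le_left _ _).trans (min_le_right _ _)
  have hδρ : δ ≤ ρ := by linarith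
  have hδC : C₀ * δ ≤ ρ := by
    have := (min_le_right _ _ : δ ≤ ρ / C₀)
    rwa [le_div_iff₀ hC₀, mul_comm] at this
  have hsm : ∀ i, ∀ x₀ ∈ h i '' tsupport (φ i), HasSmallModel g h φ δ i x₀ :=
    fun i x hx => (hρ i x hx).mono hδρ
  refine ⟨δ, hδ0, ρ, hρ0, fun w v hw hv hwδ hvδ => ?_, ?_, fun R hR => ?_⟩
  · obtain ⟨h1, h2⟩ := hs w v hw hv (hwδ.trans_le hδρ) (hvδ.trans_le hδρ)
    refine ⟨h1, h2.trans_lt ((mul_lt_mul_of_pos_left hwδ hC₀).trans_le hδC),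
      exp_comp_exp_eq hh hφ hsm hw hv hwδ hvδ, fun s hs hsρ heq => ?_⟩
    exact eq_s₁_of_exp_eq hh hφ hρ hw hv hs (hwδ.trans_le hδρ) (hvδ.trans_le hδρ) hsρ heq
  · obtain ⟨C, hC0, hC⟩ := exists_normC_zero_le hh hφ hρ
    refine ⟨C, hC0, fun w₁ w₂ v h1 h2 h3 h4 h5 h6 => ?_⟩
    refine hC w₁ w₂ v h1 (h2.mono zero_le_one) h3 ?_ (h6.trans_le hδρ)
    have := (normC_mono (h := h) (φ := φ) w₁ zero_le_one).trans_lt h4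
    simp only at this
    linarith
  · obtain ⟨C₁, hC₁0, hC₁⟩ := exists_normC_le_first hh hφ hδ1 hsm R hR
    obtain ⟨C₂, hC₂0, hC₂⟩ := exists_normC_le_second hh hφ hδ1 hsm R hR
    refine ⟨max C₁ C₂, lt_max_of_lt_left hC₁0, fun w v hw hv hwδ hvδ => ?_⟩
    obtain ⟨h1, h2⟩ := hC₁ w v hw hv hwδ hvδ
    have hN := fun (u : VField n M) k => normC_nonneg (h := h) (φ := φ) k u
    refine ⟨h1, h2.trans (mul_le_mul_of_nonneg_right (le_max_left _ _) ?_), fun hw' =>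
      (hC₂ w v hw' hv hwδ hvδ).trans (mul_le_mul_of_nonneg_right (le_max_right _ _) ?_)⟩
    · exact add_nonneg (hN w R) (mul_nonneg (hN w 1) (hN v R))
    · exact add_nonneg (mul_nonneg (hN w 2) (hN v R)) (mul_nonneg (hN w (R + 1)) (hN v 0))
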